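/- **Theorem 3.10.** Let $n\ge 1$, $0\le p\le n$, and let $d$, $\delta=-\sum_k i_{e_k}\partial_k$, $i_v$, $\varepsilon_v$ be the exterior differential, the co-differential, and the interior and exterior products on complex-valued differential $p$-forms on $\mathbb R^n$. For $\operatorname{Re}\mu>-n$ let $$R_p^{\mu}(x)=|x|^{\mu-2}\,(i_x\varepsilon_x-\varepsilon_x i_x),$$ and for $\mu\in\mathbb C\setminus\{-n-2k:k\in\mathbb N_0\}$ let $R_p^\mu$ be its meromorphic continuation as a distribution. Let $$(I^p_\gamma\omega)(x)=(R_p^{-2\gamma}\star\omega)(x)=\int_{\mathbb R^n}R_p^{-2\gamma}(x-y)\,\omega(y)\,dy ,$$ understood through this continuation for all smooth $p$-forms $\omega$ for which, at every $x$, the integral over $|x-y|>1$ converges absolutely; let $M_{x_n}$ be multiplication by $x_n$, and put $$\bar c_\mu=2^{\mu+n}\pi^{\frac n2}\,\frac{\Gamma\!\left(\frac{\mu+n}{2}\right)}{\Gamma\!\left(1-\frac{\mu}{2}\right)} .$$ Let $\lambda\in\mathbb C$ be such that neither $-2(n-\lambda)$ nor $-2(\lambda+1)$ lies in $\{-n-2k:k\in\mathbb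 N_0\}$ (that is, $\lambda\notin\frac n2+\mathbb Z$). Then the composition $$D^p(\lambda)=I^p_{\lambda+1}\circ M_{x_n}\circ I^p_{n-\lambda}$$ is well defined on every Schwartz $p$-form $\omega$, and it is the differential operator of order $2$ $$\begin{aligned} D^p(\lambda)\omega=\bar c_{-2\lambda-2}\,\bar c_{2\lambda-2n}\Big[&(2\lambda-n)(\lambda-p+1)(\lambda-n+p+1)\,\partial_n\omega\\ &+(2\lambda-n)\big[(\lambda-p+1)\,\delta(\varepsilon_{e_n}\omega)-(\lambda-n+p+1)\,d(i_{e_n}\omega)\big]\\ &+\big[(\lambda-p+1)(n-\lambda-p)\,\delta d+(\lambda-p)(n-\lambda-p-1)\,d\delta\big](x_n\cdot\omega)\Big]. \end{aligned}$$ -/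

import Mathlib

open MeasureTheory
open scoped SchwartzMap ContDiff

namespace FormKnappStein

noncomputable section

/-- Euclidean space `ℝⁿ` with its standard inner product. -/
abbrev Euc (n : ℕ) : Type := EuclideanSpace ℝ (Fin n)

/-- Complex-valued exterior `p`-forms on `ℝⁿ` (the space `Λᵖ(ℝⁿ)* ⊗ ℂ`). A differential `p`-form is
a map `Euc n → Form n p`. -/
abbrev Form (n p : ℕ) : Type := (Euc n) [⋀^Fin p]→L[ℝ] ℂ

/-- The last unit coordinate vector `e_n`. -/
def eLast (n : ℕ) [NeZero n] : Euc n :=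
  EuclideanSpace.single ⟨n - 1, Nat.sub_one_lt (NeZero.ne n)⟩ 1

/-- The last coordinate `x_n` of a point. -/
def lastCoord {n : ℕ} [NeZero n] (x : Euc n) : ℝ :=
  x ⟨n - 1, Nat.sub_one_lt (NeZero.ne n)⟩

/-- Exterior product `ε_v` with the covector `⟨v, ·⟩`:
`(ε_v η)(v₀, …, v_p) = ∑ᵢ (-1)ⁱ ⟨v, vᵢ⟩ η(v₀, …, v̂ᵢ, …, v_p)`. -/
def extProd {n p : ℕ} (v : Euc n) (η : Form n p) : Form n (p + 1) :=
  ContinuousAlternatingMap.alternatizeUncurryFin ((innerSL ℝ v).smulRight η)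

/-- Interior product `i_v`: `(i_v η)(v₁, …, v_p) = η(v, v₁, …, v_p)`. -/
def ins {n p : ℕ} (v : Euc n) (η : Form n (p + 1)) : Form n p :=
  η.curryLeft v

/-- The composition `ε_v i_w` on `p`-forms; it vanishes on `0`-forms. -/
def extIns {n : ℕ} : {p : ℕ} → Euc n → Euc n → Form n p → Form n p
  | 0, _, _, _ => 0
  | _ + 1, v, w, η => extProd v (ins w η)

/-- The co-differential `δ = -∑ₖ i_{e_k} ∂ₖ` on forms of positive degree. -/
def codiff {n p : ℕ} (θ : Euc n → Form n (p + 1)) (x : Euc n) : Form n p :=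
  -∑ k : Fin n, ins (EuclideanSpace.single k 1) (fderiv ℝ θ x (EuclideanSpace.single k 1))

/-- `δ d` on differential `p`-forms. -/
def codiffD {n p : ℕ} (θ : Euc n → Form n p) : Euc n → Form n p :=
  codiff (extDeriv θ)

/-- `d δ` on differential `p`-forms; it vanishes on `0`-forms. -/
def dCodiff {n : ℕ} : {p : ℕ} → (Euc n → Form n p) → Euc n → Form n p
  | 0, _ => fun _ => 0
  | _ + 1, θ => extDeriv (codiff θ)

/-- `δ (ε_{e_n} ·)` on differential `p`-forms. -/
def codiffExt {n p : ℕ} [NeZero n] (θ : Euc n → Form n p) : Euc n → Form n p :=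
  codiff (fun x => extProd (eLast n) (θ x))

/-- `d (i_{e_n} ·)` on differential `p`-forms; it vanishes on `0`-forms. -/
def dIns {n : ℕ} [NeZero n] : {p : ℕ} → (Euc n → Form n p) → Euc n → Form n p
  | 0, _ => fun _ => 0
  | _ + 1, θ => extDeriv (fun x => ins (eLast n) (θ x))

/-- The partial derivative `∂_n`. -/
def dLast {n p : ℕ} [NeZero n] (θ : Euc n → Form n p) (x : Euc n) : Form n p :=
  fderiv ℝ θ x (eLast n)

/-- The multiplication operator `M_{x_n}`. -/
def mulLast {n p : ℕ} [NeZero n] (θ : Euc n → Form n p) (x : Euc n) : Form n p :=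
  lastCoord x • θ x

/-- The pointwise form Riesz kernel `|x|^{μ-2} (i_x ε_x - ε_x i_x)` applied to a `p`-form. -/
def rieszKernel {n p : ℕ} (μ : ℂ) (x : Euc n) (η : Form n p) : Form n p :=
  ((‖x‖ : ℂ) ^ (μ - 2)) • (ins x (extProd x η) - extIns x x η)

/-- The pole set `{-n - 2k : k ∈ ℕ₀}` of the meromorphic family of form Riesz distributions. -/
def IsRieszPole (n : ℕ) (μ : ℂ) : Prop := ∃ k : ℕ, μ = -(n : ℂ) - 2 * (k : ℂ)

/-- The homogeneous Taylor term of degree `j` at the origin, `y ↦ (1/j!) Dʲψ(0)(y, …, y)`. -/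
def taylorTerm {n p : ℕ} (ψ : Euc n → Form n p) (j : ℕ) (y : Euc n) : Form n p :=
  ((j.factorial : ℝ)⁻¹) • iteratedFDeriv ℝ j ψ 0 (fun _ => y)

/-- The number of Taylor terms removed at the origin: the least `N ∈ ℕ₀` with `Re μ + N > -n`. -/
def taylorOrder (n : ℕ) (μ : ℂ) : ℕ := ⌊1 - (n : ℝ) - μ.re⌋₊

/-- `ψ` minus its first `taylorOrder n μ` Taylor terms at the origin. -/
def taylorRemainder {n p : ℕ} (μ : ℂ) (ψ : Euc n → Form n p) (y : Euc n) : Form n p :=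
  ψ y - ∑ j ∈ Finset.range (taylorOrder n μ), taylorTerm ψ j y

/-- The form Riesz distribution `R_p^μ`, evaluated on a smooth `p`-form `ψ`: the meromorphic
continuation in `μ`, from the half-plane `Re μ > -n`, of `∫ R_p^μ(y) ψ(y) dy`, written out by the
usual regularization at the origin,
`∫_{|y|>1} R^μ ψ + ∫_{|y|≤1} R^μ (ψ - ∑_{j<N} Pⱼ) + ∑_{j<N} "∫_{|y|≤1} R^μ Pⱼ"`,
`Pⱼ` being the Taylor terms of `ψ`. Since `R^μ Pⱼ` is homogeneous of degree `μ + j`, the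
continuation of `μ ↦ ∫_{|y|≤1} R^μ Pⱼ` is `(n + j)/(μ + n + j) · ∫_{|y|≤1} R⁰ Pⱼ`. For odd `j` the
last integral is zero because `R⁰` is even, so that the only poles are those with `j` even. If
`Re μ > -n`, then no Taylor term is removed and this is `∫ R_p^μ(y) ψ(y) dy`. -/
def rieszPairing {n p : ℕ} (μ : ℂ) (ψ : Euc n → Form n p) : Form n p :=
  (∫ y in (Metric.closedBall (0 : Euc n) 1)ᶜ, rieszKernel μ y (ψ y)) +
  (∫ y in Metric.closedBall (0 : Euc n) 1, rieszKernel μ y (taylorRemainder μ ψ y)) +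
  ∑ j ∈ Finset.range (taylorOrder n μ),
    (((n : ℂ) + j) / (μ + n + j)) •
      ∫ y in Metric.closedBall (0 : Euc n) 1, rieszKernel 0 y (taylorTerm ψ j y)

/-- The pairing of `R_p^μ` with `ψ` is well defined: `μ` is not a pole, `ψ` is smooth, and the
integrals near infinity and near the origin converge absolutely. -/
def RieszConverges {n p : ℕ} (μ : ℂ) (ψ : Euc n → Form n p) : Prop :=
  ¬ IsRieszPole n μ ∧ ContDiff ℝ ∞ ψ ∧
  IntegrableOn (fun y => rieszKernel μ y (ψ y)) (Metric.closedBall (0 : Euc n) 1)ᶜ ∧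
  IntegrableOn (fun y => rieszKernel μ y (taylorRemainder μ ψ y)) (Metric.closedBall (0 : Euc n) 1)

/-- The Knapp–Stein operator `(I^p_γ θ)(x) = (R_p^{-2γ} ⋆ θ)(x) = ∫ R_p^{-2γ}(y) θ(x - y) dy`, in the
sense of the continued distribution `R_p^{-2γ}`. -/
def knappStein {n p : ℕ} (γ : ℂ) (θ : Euc n → Form n p) (x : Euc n) : Form n p :=
  rieszPairing (-2 * γ) (fun y => θ (x - y))

/-- `I^p_γ θ` is well defined at every point. -/
def KnappSteinDefined {n p : ℕ} (γ : ℂ) (θ : Euc n → Form n p) : Prop :=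
  ∀ x : Euc n, RieszConverges (-2 * γ) (fun y => θ (x - y))

/-- `D^p(λ) = I^p_{λ+1} ∘ M_{x_n} ∘ I^p_{n-λ}`. -/
def opD {n p : ℕ} [NeZero n] (lam : ℂ) (θ : Euc n → Form n p) : Euc n → Form n p :=
  knappStein (lam + 1) (mulLast (knappStein ((n : ℂ) - lam) θ))

/-- The normalizing constant in the Fourier transform of `R_p^μ`,
`c̄_μ = 2^{μ+n} π^{n/2} Γ((μ+n)/2) / Γ(1-μ/2)`. -/
def cBar (n : ℕ) (μ : ℂ) : ℂ :=
  (2 : ℂ) ^ (μ + n) * (Real.pi : ℂ) ^ ((n : ℂ) / 2) *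
    Complex.Gamma ((μ + n) / 2) / Complex.Gamma (1 - μ / 2)

end

end FormKnappStein

open FormKnappStein

/-! The kernel of `R_p^μ` is |y|^(μ-2) times an operator-valued quadratic form, so away from the
origin its Fourier transform is |ξ|^(-μ-n-2) times another quadratic form
(`regPairing_eq_integral_fourierSymbol`). For 2-n < Re μ < 2 this follows from Gaussians, a Mellin
transform and two integrations by parts; analytic continuation in μ reaches every non-pole. For
forms the quadratic form is |y|² - 2 ε_y i_y, and P = ε_ξ i_ξ / |ξ|² is a projection, so the symbol
m_μ is a scalar multiple of |ξ|^(-μ-n) acting by -(2p+μ) on ker P and by μ+2n-2p on im P.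

Multiplication by x_n becomes (i/2π) ∂_n in frequency, so the composition has the form (i/2π) m_{μ₂}
∂_n m_{μ₁} with μ₁ = 2λ-2n and μ₂ = -2λ-2. Since μ₁+μ₂ = -2n-2, the powers of |ξ| multiply to |ξ|²,
and both m_{μ₂} m_{μ₁} and m_{μ₂} (∂_n m_{μ₁}) are polynomial in ξ, of degrees 2 and 1. The
eigenvalue products -4(λ-p+1)(λ-n+p) and -4(λ-p)(λ-n+p+1) give the coefficients of δd and dδ; the
second product gives the first order terms.

This settles forms whose Fourier transform vanishes near 0 (`regComp_eq_diffOp_of_vanishesNear`).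
For a general form, both sides satisfy D(θ(ε·))(x) = ε (Dθ)(εx). The frequencies of θ of order at
most ε form a dilate by ε of some h_ε, and the h_ε stay bounded in the Schwartz space, so the two
sides differ at x by ε times a bounded quantity, hence not at all (`regComp_eq_diffOp`).

The composition makes sense because the first convolution is smooth with all derivatives
O((1+|x|)^(Re μ₁)), and Re μ₁ + 1 + Re μ₂ = -2n-1 < -n (`exists_seminorm_regComp`). -/

namespace FormKnappStein

open MeasureTheory Set Filter Metric
open scoped SchwartzMap ContDiff Topology LineDeriv FourierTransform

/-! ### Homogeneous operator-valued kernels and their integrals over radial sets -/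

noncomputable section

variable {n : ℕ} {E : Type*} [NormedAddCommGroup E] [NormedSpace ℂ E]

/-- The operator-valued quadratic form `∑ yᵢ yⱼ qᵢⱼ`. -/
def quad (q : Fin n → Fin n → E →L[ℂ] E) (y : Euc n) : E →L[ℂ] E :=
  ∑ i, ∑ j, ((y i * y j : ℝ) : ℂ) • q i j

/-- The homogeneous kernel `|y|^{μ-2} ∑ yᵢ yⱼ qᵢⱼ`. -/
def homKernel (q : Fin n → Fin n → E →L[ℂ] E) (μ : ℂ) (y : Euc n) : E →L[ℂ] E :=
  ((‖y‖ : ℂ) ^ (μ - 2)) • quad q y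

variable (q : Fin n → Fin n → E →L[ℂ] E)

/-- An upper bound for the quadratic form on the unit sphere. -/
def quadBound : ℝ := ∑ i, ∑ j, ‖q i j‖

lemma quadBound_nonneg : 0 ≤ quadBound q :=
  Finset.sum_nonneg fun _ _ => Finset.sum_nonneg fun _ _ => norm_nonneg _

lemma quad_apply (y : Euc n) (η : E) :
    quad q y η = ∑ i, ∑ j, ((y i * y j : ℝ) : ℂ) • q i j η := by
  simp [quad]

lemma quad_smul (c : ℝ) (y : Euc n) : quad q (c • y) = ((c : ℂ) ^ 2) • quad q y := by
  simp only [quad, Finset.smul_sum, smul_smul]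
  refine Finset.sum_congr rfl fun i _ => Finset.sum_congr rfl fun j _ => ?_
  congr 1
  simp
  ring

lemma quad_zero : quad q 0 = 0 := by simp [quad]

lemma quad_neg (y : Euc n) : quad q (-y) = quad q y := by simp [quad]

lemma norm_quad_le (y : Euc n) : ‖quad q y‖ ≤ quadBound q * ‖y‖ ^ 2 := by
  rw [quad, quadBound, Finset.sum_mul]
  refine (norm_sum_le _ _).trans (Finset.sum_le_sum fun i _ => ?_)
  rw [Finset.sum_mul]
  refine (norm_sum_le _ _).trans (Finset.sum_le_sum fun j _ => ?_)
  rw [norm_smul, Complex.norm_real, norm_mul, mul_comm, sq]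
  gcongr <;> exact PiLp.norm_apply_le y _

lemma continuous_quad : Continuous (quad q) := by
  unfold quad
  fun_prop

lemma norm_homKernel_le (μ : ℂ) (y : Euc n) :
    ‖homKernel q μ y‖ ≤ quadBound q * ‖y‖ ^ μ.re := by
  rcases eq_or_ne y 0 with rfl | hy
  · simp only [homKernel, quad_zero, smul_zero, norm_zero]
    exact mul_nonneg (quadBound_nonneg q) (Real.rpow_nonneg le_rfl _)
  have h0 : 0 < ‖y‖ := norm_pos_iff.2 hy
  rw [homKernel, norm_smul, Complex.norm_cpow_eq_rpow_re_of_pos h0]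
  calc ‖y‖ ^ (μ - 2).re * ‖quad q y‖ ≤ ‖y‖ ^ (μ - 2).re * (quadBound q * ‖y‖ ^ 2) := by
        gcongr; exact norm_quad_le q y
    _ = quadBound q * (‖y‖ ^ (μ - 2).re * ‖y‖ ^ (2 : ℝ)) := by
        rw [Real.rpow_two]; ring
    _ = _ := by rw [← Real.rpow_add h0]; simp

lemma norm_homKernel_apply_le (μ : ℂ) (y : Euc n) (η : E) :
    ‖homKernel q μ y η‖ ≤ quadBound q * ‖y‖ ^ μ.re * ‖η‖ :=
  (ContinuousLinearMap.le_opNorm _ _).trans (by gcongr; exact norm_homKernel_le q μ y)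

lemma homKernel_neg (μ : ℂ) (y : Euc n) : homKernel q μ (-y) = homKernel q μ y := by
  simp [homKernel, quad_neg]

lemma homKernel_smul (μ : ℂ) {r : ℝ} (hr : 0 < r) (y : Euc n) :
    homKernel q μ (r • y) = ((r : ℂ) ^ μ) • homKernel q μ y := by
  have hr' : (r : ℂ) ≠ 0 := by exact_mod_cast hr.ne'
  rw [homKernel, homKernel, quad_smul, norm_smul, Real.norm_of_nonneg hr.le, smul_smul, smul_smul,
    Complex.ofReal_mul, Complex.mul_cpow_ofReal_nonneg hr.le (norm_nonneg _)]
  congr 1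
  rw [mul_right_comm, ← Complex.cpow_natCast, ← Complex.cpow_add _ _ hr']
  simp

lemma homKernel_of_norm_eq_one (μ : ℂ) {y : Euc n} (hy : ‖y‖ = 1) :
    homKernel q μ y = quad q y := by simp [homKernel, hy]

lemma aestronglyMeasurable_homKernel_apply (μ : ℂ) {ψ : Euc n → E} {ν : Measure (Euc n)}
    (hψ : AEStronglyMeasurable ψ ν) :
    AEStronglyMeasurable (fun y => homKernel q μ y (ψ y)) ν := by
  have h1 : AEStronglyMeasurable (fun y : Euc n => ((‖y‖ : ℂ) ^ (μ - 2))) ν := by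
    have : Measurable (fun y : Euc n => ((‖y‖ : ℂ) ^ (μ - 2))) := by fun_prop
    exact this.aestronglyMeasurable
  have h2 : AEStronglyMeasurable (fun y => quad q y (ψ y)) ν :=
    isBoundedBilinearMap_apply.continuous.comp_aestronglyMeasurable₂
      (continuous_quad q).aestronglyMeasurable hψ
  exact h1.smul h2

section Radial

variable [NeZero n]

lemma integrableOn_norm_rpow_closedBall {s : ℝ} (hs : -(n : ℝ) < s) :
    IntegrableOn (fun y : Euc n => ‖y‖ ^ s) (closedBall 0 1) := by
  have h : IntegrableOn (fun y : Euc n => ‖y‖ ^ s) (ball 0 2) := by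
    rw [integrableOn_fun_norm_addHaar volume (f := fun r : ℝ => r ^ s)]
    have h2 : IntegrableOn (fun r : ℝ => r ^ ((n : ℝ) - 1 + s)) (Ioo 0 2) :=
      (intervalIntegral.integrableOn_Ioo_rpow_iff two_pos).2 (by linarith)
    refine h2.congr_fun (fun r hr => ?_) measurableSet_Ioo
    have hr0 : 0 < r := hr.1
    have hn : 1 ≤ n := Nat.one_le_iff_ne_zero.2 (NeZero.ne n)
    simp only [finrank_euclideanSpace, Fintype.card_fin, smul_eq_mul]
    rw [Real.rpow_add hr0, ← Real.rpow_natCast, Nat.cast_sub hn, Nat.cast_one]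
  exact h.mono_set (closedBall_subset_ball one_lt_two)

/-- Outside the unit ball |x| ≤ 1+|x| ≤ 2|x|, so the kernel can be compared with powers of 1+|x|, to
which Peetre's inequality applies. -/
lemma norm_rpow_le_of_one_le {x : Euc n} (hx : 1 ≤ ‖x‖) (s : ℝ) :
    ‖x‖ ^ s ≤ 2 ^ |s| * (1 + ‖x‖) ^ s := by
  have h0 : 0 < ‖x‖ := by linarith
  rcases le_total 0 s with hs | hs
  · rw [abs_of_nonneg hs]
    calc ‖x‖ ^ s ≤ (1 + ‖x‖) ^ s := Real.rpow_le_rpow h0.le (by linarith) hs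
      _ ≤ 2 ^ s * (1 + ‖x‖) ^ s :=
        le_mul_of_one_le_left (by positivity) (Real.one_le_rpow one_le_two hs)
  · rw [abs_of_nonpos hs, Real.rpow_neg two_pos.le, ← Real.inv_rpow two_pos.le,
      ← Real.mul_rpow (by positivity) (by positivity)]
    exact Real.rpow_le_rpow_of_nonpos (by positivity) (by linarith) hs

lemma integrable_one_add_norm_rpow {s : ℝ} (hs : s < -(n : ℝ)) :
    Integrable (fun y : Euc n => (1 + ‖y‖) ^ s) := by
  have := integrable_one_add_norm (E := Euc n) (μ := volume) (r := -s) (by simp; linarith)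
  simpa using this

lemma homeomorph_smul_eq (x : ({0}ᶜ : Set (Euc n))) :
    ((homeomorphUnitSphereProd (Euc n) x).2 : ℝ) • ((homeomorphUnitSphereProd (Euc n) x).1 : Euc n)
      = x := by
  have : ‖(x : Euc n)‖ ≠ 0 := norm_ne_zero_iff.2 x.2
  simp [smul_smul, this]

/-- Polar coordinates for the integral of a homogeneous function over a radial set. -/
lemma integral_radial_homogeneous {F : Type*} [NormedAddCommGroup F] [NormedSpace ℂ F]
    {g : Euc n → F} {s : ℂ} {A : Set ℝ} (hA : MeasurableSet A)
    (hg : ∀ r : ℝ, 0 < r → ∀ y, ‖y‖ = 1 → g (r • y) = ((r : ℂ) ^ s) • g y) :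
    ∫ y in {y : Euc n | ‖y‖ ∈ A}, g y =
      (∫ r in Ioi (0 : ℝ) ∩ A, (r : ℂ) ^ (s + n - 1)) •
        ∫ y : sphere (0 : Euc n) 1, g y ∂(volume : Measure (Euc n)).toSphere := by
  have hS : MeasurableSet {y : Euc n | ‖y‖ ∈ A} := measurable_norm hA
  have hn : 1 ≤ n := Nat.one_le_iff_ne_zero.2 (NeZero.ne n)
  -- In polar coordinates the integrand times the indicator factors as a function of the radius
  -- times a function on the sphere. `integral_prod_smul` then needs no integrability.
  set c : ℝ → ℂ := A.indicator (fun r => (r : ℂ) ^ s) with hc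
  have indicator_eq : ∫ y in {y : Euc n | ‖y‖ ∈ A}, g y
      = ∫ x : ({0}ᶜ : Set (Euc n)), ({y : Euc n | ‖y‖ ∈ A}.indicator g) x
        ∂((volume : Measure (Euc n)).comap (↑)) := by
    rw [integral_subtype_comap (measurableSet_singleton _).compl, restrict_compl_singleton,
      integral_indicator hS]
  have indicator_apply : ∀ x : ({0}ᶜ : Set (Euc n)), ({y : Euc n | ‖y‖ ∈ A}.indicator g) x =
      (fun z : sphere (0 : Euc n) 1 × Ioi (0 : ℝ) => c z.2 • g z.1)
        (homeomorphUnitSphereProd (Euc n) x) := by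
    intro x
    have hx := homeomorph_smul_eq x
    set z := homeomorphUnitSphereProd (Euc n) x with hz
    have hz1 : ‖(z.1 : Euc n)‖ = 1 := by simp
    have hz2 : 0 < (z.2 : ℝ) := z.2.2
    have hz3 : ‖(x : Euc n)‖ = z.2 := by
      rw [← hx, norm_smul, hz1, mul_one, Real.norm_of_nonneg hz2.le]
    by_cases h : (z.2 : ℝ) ∈ A
    · have h' : (x : Euc n) ∈ {y : Euc n | ‖y‖ ∈ A} := by rw [mem_ofPred_eq, hz3]; exact h
      rw [indicator_of_mem h', ← hx, hg _ hz2 _ hz1]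
      simp only [hc, indicator_of_mem h]
    · have h' : (x : Euc n) ∉ {y : Euc n | ‖y‖ ∈ A} := by rw [mem_ofPred_eq, hz3]; exact h
      rw [indicator_of_notMem h']
      simp only [hc, indicator_of_notMem h, zero_smul]
  rw [indicator_eq]
  simp_rw [indicator_apply]
  have polar_eq := (volume : Measure (Euc n)).measurePreserving_homeomorphUnitSphereProd.integral_comp
    (Homeomorph.measurableEmbedding _)
    (fun z : sphere (0 : Euc n) 1 × Ioi (0 : ℝ) => c z.2 • g z.1)
  rw [polar_eq]
  have prod_eq : ∫ z : sphere (0 : Euc n) 1 × Ioi (0 : ℝ), c z.2 • g z.1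
      ∂((volume : Measure (Euc n)).toSphere.prod
        (Measure.volumeIoiPow (Module.finrank ℝ (Euc n) - 1))) =
      (∫ r : Ioi (0 : ℝ), c r ∂(Measure.volumeIoiPow (Module.finrank ℝ (Euc n) - 1))) •
        ∫ y : sphere (0 : Euc n) 1, g y ∂(volume : Measure (Euc n)).toSphere := by
    rw [← integral_prod_swap]
    exact integral_prod_smul (fun r : Ioi (0 : ℝ) => c r) (fun y : sphere (0 : Euc n) 1 => g y)
  rw [prod_eq]
  congr 1
  simp only [Measure.volumeIoiPow, ENNReal.ofReal]
  rw [integral_withDensity_eq_integral_smul (by fun_prop),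
    integral_subtype_comap measurableSet_Ioi fun r : ℝ =>
      (r ^ (Module.finrank ℝ (Euc n) - 1)).toNNReal • c r, inter_comm, ← Measure.restrict_restrict hA,
      ← integral_indicator hA]
  refine setIntegral_congr_fun measurableSet_Ioi fun r hr => ?_
  have hr0 : (0 : ℝ) < r := hr
  have hr' : (r : ℂ) ≠ 0 := by exact_mod_cast hr0.ne'
  simp only [hc, indicator]
  split_ifs
  · simp only [finrank_euclideanSpace, Fintype.card_fin, NNReal.smul_def,
      Real.coe_toNNReal _ (pow_nonneg hr0.le _), Complex.real_smul, Complex.ofReal_pow]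
    rw [← Complex.cpow_natCast, Nat.cast_sub hn, ← Complex.cpow_add _ _ hr']
    congr 1
    push_cast
    ring
  · simp

lemma integral_Ioc_cpow_sub_one {a : ℂ} (ha : 0 < a.re) :
    ∫ r in Ioc (0 : ℝ) 1, (r : ℂ) ^ (a - 1) = 1 / a := by
  have h0 : a ≠ 0 := by rintro rfl; simp at ha
  rw [← intervalIntegral.integral_of_le zero_le_one, integral_cpow (Or.inl (by simpa using ha))]
  simp [h0]

lemma integral_Ioc_cpow_sub_one' {a : ℂ} (ha : a ≠ 0) {ε : ℝ} (hε : 0 < ε) (hε1 : ε ≤ 1) :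
    ∫ r in Ioc ε 1, (r : ℂ) ^ (a - 1) = (1 - (ε : ℂ) ^ a) / a := by
  rw [← intervalIntegral.integral_of_le hε1, integral_cpow (Or.inr ⟨fun h => ha (by linear_combination h),
    by rw [uIcc_of_le hε1]; exact fun h => absurd h.1 (not_le.2 hε)⟩)]
  simp

/-- Integral over the unit ball of the kernel against a homogeneous function. -/
lemma integral_closedBall_homKernel {P : Euc n → E} {j : ℕ}
    (hP : ∀ (r : ℝ) y, P (r • y) = (r ^ j) • P y) {μ : ℂ} (hμ : 0 < μ.re + n + j) :
    ∫ y in closedBall (0 : Euc n) 1, homKernel q μ y (P y) =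
      (((n : ℂ) + j) / (μ + n + j)) •
        ∫ y in closedBall (0 : Euc n) 1, homKernel q 0 y (P y) := by
  have hset : closedBall (0 : Euc n) 1 = {y : Euc n | ‖y‖ ∈ Iic (1 : ℝ)} := by
    ext y; simp
  have hIoc : Ioi (0 : ℝ) ∩ Iic 1 = Ioc 0 1 := rfl
  -- The spherical integral does not depend on ν, since the kernel on the unit sphere is `quad q`.
  -- Comparing ν = μ with ν = 0 gives the ratio (n+j)/(μ+n+j) of the radial integrals.
  have key : ∀ ν : ℂ, 0 < ν.re + n + j →
      ∫ y in closedBall (0 : Euc n) 1, homKernel q ν y (P y) = (1 / (ν + n + j)) •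
        ∫ y : sphere (0 : Euc n) 1, quad q y (P y) ∂(volume : Measure (Euc n)).toSphere := by
    intro ν hν
    rw [hset, integral_radial_homogeneous (s := ν + j) measurableSet_Iic]
    · rw [hIoc, show ν + j + n - 1 = (ν + n + j) - 1 by ring,
        integral_Ioc_cpow_sub_one (by simpa using hν)]
      congr 1
      refine integral_congr_ae (Eventually.of_forall fun y => ?_)
      simp only
      rw [homKernel_of_norm_eq_one _ _ (by simp)]
    · intro r hr y _
      have hr' : (r : ℂ) ≠ 0 := by exact_mod_cast hr.ne'
      rw [homKernel_smul _ _ hr, hP, Complex.cpow_add _ _ hr', Complex.cpow_natCast,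
        ← Complex.coe_smul (r ^ j)]
      simp [smul_smul, mul_comm]
  have hn : (0 : ℝ) < n := Nat.cast_pos.2 (Nat.pos_of_ne_zero (NeZero.ne n))
  have hnj : ((n : ℂ) + j) ≠ 0 := by
    intro h
    have h' := congrArg Complex.re h
    simp at h'
    have : (0 : ℝ) ≤ j := Nat.cast_nonneg j
    linarith
  rw [key μ hμ, key 0 (by simp; positivity), smul_smul]
  congr 1
  rw [zero_add]
  field_simp

/-- Integral over an annulus of the kernel against a homogeneous function. -/
lemma integral_annulus_homKernel {P : Euc n → E} {j : ℕ}
    (hP : ∀ (r : ℝ) y, P (r • y) = (r ^ j) • P y) {μ : ℂ} (hμ : μ + n + j ≠ 0)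
    {ε : ℝ} (hε : 0 < ε) (hε1 : ε ≤ 1) :
    ∫ y in {y : Euc n | ‖y‖ ∈ Ioc ε 1}, homKernel q μ y (P y) =
      ((((n : ℂ) + j) / (μ + n + j)) * (1 - (ε : ℂ) ^ (μ + n + j))) •
        ∫ y in closedBall (0 : Euc n) 1, homKernel q 0 y (P y) := by
  have hset : closedBall (0 : Euc n) 1 = {y : Euc n | ‖y‖ ∈ Iic (1 : ℝ)} := by
    ext y; simp
  have hIoc : Ioi (0 : ℝ) ∩ Iic 1 = Ioc 0 1 := rfl
  have hIoc2 : Ioi (0 : ℝ) ∩ Ioc ε 1 = Ioc ε 1 :=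
    inter_eq_right.2 fun r hr => hε.trans hr.1
  have key : ∀ (ν : ℂ) {A : Set ℝ}, MeasurableSet A →
      ∫ y in {y : Euc n | ‖y‖ ∈ A}, homKernel q ν y (P y) =
      (∫ r in Ioi (0 : ℝ) ∩ A, (r : ℂ) ^ ((ν + n + j) - 1)) •
        ∫ y : sphere (0 : Euc n) 1, quad q y (P y) ∂(volume : Measure (Euc n)).toSphere := by
    intro ν A hA
    rw [integral_radial_homogeneous (s := ν + j) hA]
    · rw [show ν + j + n - 1 = (ν + n + j) - 1 by ring]
      congr 1
      refine integral_congr_ae (Eventually.of_forall fun y => ?_)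
      simp only
      rw [homKernel_of_norm_eq_one _ _ (by simp)]
    · intro r hr y _
      have hr' : (r : ℂ) ≠ 0 := by exact_mod_cast hr.ne'
      rw [homKernel_smul _ _ hr, hP, Complex.cpow_add _ _ hr', Complex.cpow_natCast,
        ← Complex.coe_smul (r ^ j)]
      simp [smul_smul, mul_comm]
  have hn : (0 : ℝ) < n := Nat.cast_pos.2 (Nat.pos_of_ne_zero (NeZero.ne n))
  have hnj' : 0 < ((n : ℂ) + j).re := by simp; positivity
  have hnj : ((n : ℂ) + j) ≠ 0 := by
    intro h
    rw [h] at hnj'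
    simp at hnj'
  rw [hset, key μ measurableSet_Ioc, key 0 measurableSet_Iic, hIoc, hIoc2, smul_smul,
    integral_Ioc_cpow_sub_one' hμ hε hε1, zero_add, integral_Ioc_cpow_sub_one hnj']
  congr 1
  field_simp

lemma integral_radial_odd {F : Type*} [NormedAddCommGroup F] [NormedSpace ℝ F] {g : Euc n → F}
    (hg : ∀ y, g (-y) = -g y) {A : Set ℝ} (hA : MeasurableSet A) :
    ∫ y in {y : Euc n | ‖y‖ ∈ A}, g y = 0 := by
  have hS : MeasurableSet {y : Euc n | ‖y‖ ∈ A} := measurable_norm hA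
  have h : ∫ y in {y : Euc n | ‖y‖ ∈ A}, g y = -∫ y in {y : Euc n | ‖y‖ ∈ A}, g y := by
    conv_lhs => rw [← integral_indicator hS, ← integral_neg_eq_self]
    rw [← integral_indicator hS, ← integral_neg]
    congr 1
    ext y
    by_cases h : ‖y‖ ∈ A
    · have h1 : y ∈ {y : Euc n | ‖y‖ ∈ A} := h
      have h2 : -y ∈ {y : Euc n | ‖y‖ ∈ A} := by rw [mem_ofPred_eq, norm_neg]; exact h
      rw [indicator_of_mem h1, indicator_of_mem h2, hg]
    · have h1 : y ∉ {y : Euc n | ‖y‖ ∈ A} := h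
      have h2 : -y ∉ {y : Euc n | ‖y‖ ∈ A} := by rw [mem_ofPred_eq, norm_neg]; exact h
      rw [indicator_of_notMem h1, indicator_of_notMem h2, neg_zero]
  have h2 : (2 : ℝ) • ∫ y in {y : Euc n | ‖y‖ ∈ A}, g y = 0 := by
    rw [two_smul]
    nth_rewrite 2 [h]
    exact add_neg_cancel _
  exact (smul_eq_zero.1 h2).resolve_left two_ne_zero

end Radial

end

/-! ### Taylor polynomials and symmetric higher derivatives -/

noncomputable section

variable {n : ℕ} {E : Type*} [NormedAddCommGroup E] [NormedSpace ℂ E]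

/-- The homogeneous Taylor polynomial of degree `j` at the origin of a vector-valued function. -/
def taylorPart (ψ : Euc n → E) (j : ℕ) (y : Euc n) : E :=
  ((j.factorial : ℝ)⁻¹) • iteratedFDeriv ℝ j ψ 0 (fun _ => y)

lemma taylorPart_smul_arg (ψ : Euc n → E) (j : ℕ) (r : ℝ) (y : Euc n) :
    taylorPart ψ j (r • y) = (r ^ j) • taylorPart ψ j y := by
  have := (iteratedFDeriv ℝ j ψ 0).map_smul_univ (fun _ => r) (fun _ => y)
  simp only [Finset.prod_const, Finset.card_univ, Fintype.card_fin] at this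
  rw [taylorPart, taylorPart, this, smul_comm]

lemma continuous_taylorPart (ψ : Euc n → E) (j : ℕ) : Continuous (taylorPart ψ j) := by
  unfold taylorPart
  fun_prop

lemma norm_taylorPart_le (ψ : Euc n → E) (j : ℕ) (y : Euc n) :
    ‖taylorPart ψ j y‖ ≤ ‖iteratedFDeriv ℝ j ψ 0‖ * ‖y‖ ^ j := by
  have h1 : ‖iteratedFDeriv ℝ j ψ 0 (fun _ => y)‖ ≤ ‖iteratedFDeriv ℝ j ψ 0‖ * ‖y‖ ^ j := by
    simpa using (iteratedFDeriv ℝ j ψ 0).le_opNorm (fun _ => y)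
  rw [taylorPart, norm_smul, norm_inv, Real.norm_natCast]
  refine le_trans (mul_le_of_le_one_left (norm_nonneg _) ?_) h1
  exact inv_le_one_of_one_le₀ (by exact_mod_cast Nat.factorial_pos j)

lemma taylorPart_add {ψ φ : Euc n → E} (hψ : ContDiff ℝ ∞ ψ) (hφ : ContDiff ℝ ∞ φ) (j : ℕ)
    (y : Euc n) : taylorPart (ψ + φ) j y = taylorPart ψ j y + taylorPart φ j y := by
  rw [taylorPart, taylorPart, taylorPart, iteratedFDeriv_add_apply
    (hψ.of_le (mod_cast le_top)).contDiffAt (hφ.of_le (mod_cast le_top)).contDiffAt, ← smul_add]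
  rfl

lemma taylorPart_const_smul {ψ : Euc n → E} (hψ : ContDiff ℝ ∞ ψ) (c : ℂ) (j : ℕ)
    (y : Euc n) : taylorPart (c • ψ) j y = c • taylorPart ψ j y := by
  rw [taylorPart, taylorPart, iteratedFDeriv_const_smul_apply
    (hψ.of_le (mod_cast le_top)).contDiffAt, smul_comm c]
  rfl

lemma taylorPart_comp_smul {ψ : Euc n → E} (hψ : ContDiff ℝ ∞ ψ) (ε : ℝ) (j : ℕ)
    (y : Euc n) : taylorPart (fun z => ψ (ε • z)) j y = (ε ^ j) • taylorPart ψ j y := by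
  rw [← taylorPart_smul_arg, taylorPart, taylorPart]
  have h := (ε • ContinuousLinearMap.id ℝ (Euc n)).iteratedFDeriv_comp_right
    (f := ψ) (hψ.of_le (m := (j : ℕ∞)) (mod_cast le_top)) 0 (i := j) le_rfl
  have h' : iteratedFDeriv ℝ j (fun z => ψ (ε • z)) 0 = _ := h
  rw [h']
  simp

lemma iteratedDeriv_comp_smul_const {ψ : Euc n → E} (hψ : ContDiff ℝ ∞ ψ) (y : Euc n) (k : ℕ)
    (t : ℝ) :
    iteratedDeriv k (fun t : ℝ => ψ (t • y)) t = iteratedFDeriv ℝ k ψ (t • y) (fun _ => y) := by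
  have h := (ContinuousLinearMap.toSpanSingleton ℝ y).iteratedFDeriv_comp_right
    (f := ψ) (hψ.of_le (m := (k : ℕ∞)) (mod_cast le_top)) t (i := k) le_rfl
  have h' : iteratedFDeriv ℝ k (fun t : ℝ => ψ (t • y)) t = _ := h
  rw [iteratedDeriv_eq_iteratedFDeriv, h']
  simp

/-- Taylor's theorem along rays, with a bound uniform on the unit ball. -/
lemma norm_sub_taylorPart_le {ψ : Euc n → E} (hψ : ContDiff ℝ ∞ ψ) (N : ℕ) {A : ℝ}
    (hA : ∀ z : Euc n, ‖z‖ ≤ 1 → ‖iteratedFDeriv ℝ N ψ z‖ ≤ A) {y : Euc n} (hy : ‖y‖ ≤ 1) :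
    ‖ψ y - ∑ j ∈ Finset.range N, taylorPart ψ j y‖ ≤ A * ‖y‖ ^ N := by
  -- The one-variable remainder bound with index m controls the error after m+1 terms, so N = 0 is
  -- separate. The bound is applied to t ↦ ψ(ty) on [0,1]; the factorial is discarded.
  rcases N with _ | m
  · simpa using hA y hy
  have hA0 : 0 ≤ A := (norm_nonneg _).trans (hA 0 (by simp))
  set φ : ℝ → E := fun t => ψ (t • y) with hφ
  have hφs : ContDiff ℝ ∞ φ := by fun_prop
  have hW : ∀ k, ∀ t ∈ Icc (0 : ℝ) 1, iteratedDerivWithin k φ (Icc 0 1) t =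
      iteratedFDeriv ℝ k ψ (t • y) (fun _ => y) := by
    intro k t ht
    rw [iteratedDerivWithin_eq_iteratedDeriv (uniqueDiffOn_Icc zero_lt_one)
      (hφs.of_le (mod_cast le_top)).contDiffAt ht, iteratedDeriv_comp_smul_const hψ]
  have key := taylor_mean_remainder_bound (f := φ) (a := 0) (b := 1) (C := A * ‖y‖ ^ (m + 1))
    (x := 1) (n := m) zero_le_one (hφs.of_le (mod_cast le_top)).contDiffOn (by simp) (by
      intro t ht
      rw [hW _ t ht]
      refine ((iteratedFDeriv ℝ (m + 1) ψ (t • y)).le_opNorm (fun _ => y)).trans ?_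
      simp only [Finset.prod_const, Finset.card_univ, Fintype.card_fin]
      gcongr
      refine hA _ ?_
      rw [norm_smul, Real.norm_of_nonneg ht.1]
      exact mul_le_one₀ ht.2 (norm_nonneg _) hy)
  have hT : taylorWithinEval φ m (Icc 0 1) 0 1 = ∑ j ∈ Finset.range (m + 1), taylorPart ψ j y := by
    rw [taylor_within_apply]
    refine Finset.sum_congr rfl fun k _ => ?_
    rw [hW k 0 (by simp), taylorPart]
    simp
  rw [hT] at key
  refine (by simpa [hφ] using key : _ ≤ A * ‖y‖ ^ (m + 1) / (m.factorial : ℝ)).trans ?_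
  exact div_le_self (by positivity) (by exact_mod_cast Nat.factorial_pos m)

/-- Directional derivatives commute with iterated derivatives. -/
lemma fderiv_iteratedFDeriv_apply {F : Type*} [NormedAddCommGroup F] [NormedSpace ℝ F]
    {f : Euc n → F} (hf : ContDiff ℝ ∞ f) (h : Euc n) (j : ℕ) (x : Euc n) :
    fderiv ℝ (iteratedFDeriv ℝ j f) x h = iteratedFDeriv ℝ j (fun y => fderiv ℝ f y h) x := by
  induction j generalizing x with
  | zero =>
    ext m
    have h0 : iteratedFDeriv ℝ 0 f = fun x => (continuousMultilinearCurryFin0 ℝ (Euc n) F).symm (f x) := by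
      ext x; simp
    rw [h0]
    have := ((continuousMultilinearCurryFin0 ℝ (Euc n) F).symm.toContinuousLinearEquiv.comp_fderiv
      (f := f) (x := x))
    have h2 : fderiv ℝ (fun x => (continuousMultilinearCurryFin0 ℝ (Euc n) F).symm (f x)) x = _ := this
    rw [h2]
    simp
  | succ j ih =>
    have hjf : ∀ j : ℕ, ContDiff ℝ ∞ (iteratedFDeriv ℝ j f) := fun j =>
      hf.iteratedFDeriv_right (mod_cast le_top)
    have hg : ContDiff ℝ ∞ (fun y => fderiv ℝ f y h) :=
      (hf.fderiv_right (m := ∞) (mod_cast le_top)).clm_apply contDiff_const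
    ext m
    rw [← fderiv_continuousMultilinear_apply_const_apply
      ((hjf (j + 1)).differentiable (by simp)).differentiableAt]
    simp only [iteratedFDeriv_succ_apply_left]
    have e1 : (iteratedFDeriv ℝ j fun y => fderiv ℝ f y h) =
        fun x => fderiv ℝ (iteratedFDeriv ℝ j f) x h := by
      ext1 x; exact (ih x).symm
    rw [e1]
    set G := iteratedFDeriv ℝ j f
    have hG' : Differentiable ℝ (fderiv ℝ G) :=
      ((hjf j).fderiv_right (m := ∞) (mod_cast le_top)).differentiable (by simp)
    have hsymm : IsSymmSndFDerivAt ℝ G x :=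
      -- The new direction and h are exchanged by the symmetry of the second derivative of the j-th
      -- iterated derivative.
      (hjf j).contDiffAt.isSymmSndFDerivAt (by
      simp only [minSmoothness_of_isRCLikeNormedField]
      exact WithTop.coe_le_coe.2 (le_top : (2 : ℕ∞) ≤ ⊤))
    have e2 : fderiv ℝ (fun x => fderiv ℝ G x h) x (m 0) = fderiv ℝ (fderiv ℝ G) x (m 0) h := by
      rw [fderiv_clm_apply hG'.differentiableAt (differentiableAt_const _)]
      simp
    have e3 : fderiv ℝ (fun x => fderiv ℝ G x (m 0)) x h = fderiv ℝ (fderiv ℝ G) x h (m 0) := by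
      rw [fderiv_clm_apply hG'.differentiableAt (differentiableAt_const _)]
      simp
    rw [e2, fderiv_continuousMultilinear_apply_const_apply, e3, hsymm.eq]
    exact (hG'.differentiableAt.clm_apply (differentiableAt_const _))

end

/-! ### The regularized pairing: bounds, linearity, independence of the number of Taylor terms -/

noncomputable section

variable {n : ℕ} {E : Type*} [NormedAddCommGroup E] [NormedSpace ℂ E]

/-- The regularized pairing of the kernel `|y|^{μ-2} ∑ yᵢ yⱼ qᵢⱼ` with `ψ`, removing `N` Taylor
terms at the origin. -/
def regPairing (q : Fin n → Fin n → E →L[ℂ] E) (N : ℕ) (μ : ℂ) (ψ : Euc n → E) : E :=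
  (∫ y in (closedBall (0 : Euc n) 1)ᶜ, homKernel q μ y (ψ y)) +
  (∫ y in closedBall (0 : Euc n) 1,
    homKernel q μ y (ψ y - ∑ j ∈ Finset.range N, taylorPart ψ j y)) +
  ∑ j ∈ Finset.range N, (((n : ℂ) + j) / (μ + n + j)) •
      ∫ y in closedBall (0 : Euc n) 1, homKernel q 0 y (taylorPart ψ j y)

/-- Smoothness of `ψ` together with absolute convergence of its kernel integral at infinity. -/
def PairingAdmissible (q : Fin n → Fin n → E →L[ℂ] E) (μ : ℂ) (ψ : Euc n → E) : Prop :=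
  ContDiff ℝ ∞ ψ ∧
    IntegrableOn (fun y => homKernel q μ y (ψ y)) (closedBall (0 : Euc n) 1)ᶜ

variable (q : Fin n → Fin n → E →L[ℂ] E)

lemma exists_norm_iteratedFDeriv_le_unitBall {ψ : Euc n → E} (hψ : ContDiff ℝ ∞ ψ) (N : ℕ) :
    ∃ A : ℝ, 0 ≤ A ∧ ∀ j ≤ N, ∀ z : Euc n, ‖z‖ ≤ 1 → ‖iteratedFDeriv ℝ j ψ z‖ ≤ A := by
  have h : ∀ j : ℕ, ∃ A : ℝ, ∀ z ∈ closedBall (0 : Euc n) 1, ‖iteratedFDeriv ℝ j ψ z‖ ≤ A := fun j =>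
    (isCompact_closedBall (0 : Euc n) 1).exists_bound_of_continuousOn
      (hψ.continuous_iteratedFDeriv (mod_cast le_top)).continuousOn
  choose A hA using h
  refine ⟨∑ j ∈ Finset.range (N + 1), |A j|, Finset.sum_nonneg fun _ _ => abs_nonneg _, ?_⟩
  intro j hj z hz
  refine (hA j z (by simpa using hz)).trans ((le_abs_self _).trans ?_)
  exact Finset.single_le_sum (f := fun j => |A j|) (fun _ _ => abs_nonneg _)
    (Finset.mem_range.2 (by omega))

lemma norm_homKernel_apply_le_rpow_add {μ : ℂ} {N : ℕ} {A : ℝ} (hA : 0 ≤ A) {y : Euc n} {η : E}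
    (hη : ‖η‖ ≤ A * ‖y‖ ^ N) :
    ‖homKernel q μ y η‖ ≤ quadBound q * A * ‖y‖ ^ (μ.re + N) := by
  have hq := quadBound_nonneg q
  rcases eq_or_ne y 0 with rfl | hy
  · have : homKernel q μ 0 = 0 := by simp [homKernel, quad_zero]
    rw [this]
    simp only [_root_.zero_apply, norm_zero]
    exact mul_nonneg (by positivity) (Real.rpow_nonneg le_rfl _)
  · have h0 : 0 < ‖y‖ := norm_pos_iff.2 hy
    refine (norm_homKernel_apply_le q μ y η).trans ?_
    calc quadBound q * ‖y‖ ^ μ.re * ‖η‖ ≤ quadBound q * ‖y‖ ^ μ.re * (A * ‖y‖ ^ N) := by gcongr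
      _ = quadBound q * A * (‖y‖ ^ μ.re * ‖y‖ ^ (N : ℝ)) := by rw [Real.rpow_natCast]; ring
      _ = _ := by rw [← Real.rpow_add h0]

lemma norm_homKernel_zero_apply_le (y : Euc n) (η : E) :
    ‖homKernel q 0 y η‖ ≤ quadBound q * ‖η‖ := by
  simpa using norm_homKernel_apply_le q 0 y η

lemma integrableOn_homKernel_zero_taylorPart (ψ : Euc n → E) (j : ℕ) :
    IntegrableOn (fun y => homKernel q 0 y (taylorPart ψ j y)) (closedBall (0 : Euc n) 1) := by
  refine Integrable.mono' (g := fun y => quadBound q * ‖taylorPart ψ j y‖) ?_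
    (aestronglyMeasurable_homKernel_apply q 0 (continuous_taylorPart ψ j).aestronglyMeasurable)
    (Eventually.of_forall fun y => norm_homKernel_zero_apply_le q y _)
  exact ((continuous_const.mul (continuous_taylorPart ψ j).norm).continuousOn).integrableOn_compact
    (isCompact_closedBall _ _)

variable [NeZero n]

lemma integrableOn_homKernel_taylorPart (ψ : Euc n → E) {j : ℕ} {μ : ℂ}
    (hμ : -(n : ℝ) < μ.re + j) :
    IntegrableOn (fun y => homKernel q μ y (taylorPart ψ j y)) (closedBall (0 : Euc n) 1) :=
  Integrable.mono' ((integrableOn_norm_rpow_closedBall hμ).const_mul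
    (quadBound q * ‖iteratedFDeriv ℝ j ψ 0‖))
    (aestronglyMeasurable_homKernel_apply q μ (continuous_taylorPart ψ j).aestronglyMeasurable)
    (Eventually.of_forall fun y =>
      norm_homKernel_apply_le_rpow_add q (norm_nonneg _) (norm_taylorPart_le ψ j y))

lemma aestronglyMeasurable_sub_taylorPart {ψ : Euc n → E} (hψ : ContDiff ℝ ∞ ψ) (N : ℕ)
    {ν : Measure (Euc n)} :
    AEStronglyMeasurable (fun y => ψ y - ∑ j ∈ Finset.range N, taylorPart ψ j y) ν := by
  refine Continuous.aestronglyMeasurable ?_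
  exact hψ.continuous.sub (continuous_finsetSum _ fun j _ => continuous_taylorPart ψ j)

lemma norm_homKernel_sub_taylorPart_le {ψ : Euc n → E} (hψ : ContDiff ℝ ∞ ψ) {N : ℕ} (μ : ℂ)
    {A : ℝ} (hA : ∀ j ≤ N, ∀ z : Euc n, ‖z‖ ≤ 1 → ‖iteratedFDeriv ℝ j ψ z‖ ≤ A)
    {y : Euc n} (hy : y ∈ closedBall (0 : Euc n) 1) :
    ‖homKernel q μ y (ψ y - ∑ j ∈ Finset.range N, taylorPart ψ j y)‖ ≤
      quadBound q * A * ‖y‖ ^ (μ.re + N) := by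
  have hA0 : 0 ≤ A := (norm_nonneg _).trans (hA 0 (Nat.zero_le _) 0 (by simp))
  exact norm_homKernel_apply_le_rpow_add q hA0
    (norm_sub_taylorPart_le hψ N (hA N le_rfl) (by simpa using hy))

lemma integrableOn_homKernel_sub_taylorPart {ψ : Euc n → E} (hψ : ContDiff ℝ ∞ ψ) {N : ℕ} {μ : ℂ}
    (hμ : -(n : ℝ) < μ.re + N) :
    IntegrableOn (fun y => homKernel q μ y (ψ y - ∑ j ∈ Finset.range N, taylorPart ψ j y))
      (closedBall (0 : Euc n) 1) := by
  obtain ⟨A, hA0, hA⟩ := exists_norm_iteratedFDeriv_le_unitBall hψ N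
  refine Integrable.mono' ((integrableOn_norm_rpow_closedBall hμ).const_mul (quadBound q * A))
    (aestronglyMeasurable_homKernel_apply q μ (aestronglyMeasurable_sub_taylorPart hψ N)) ?_
  refine (ae_restrict_iff' measurableSet_closedBall).2 (Eventually.of_forall fun y hy => ?_)
  exact norm_homKernel_sub_taylorPart_le q hψ μ hA hy

/-- The regularized pairing is bounded by the kernel integral at infinity and by finitely many
derivatives on the unit ball. -/
lemma exists_norm_regPairing_le {N : ℕ} {μ : ℂ} (hμ : -(n : ℝ) < μ.re + N) :
    ∃ C : ℝ, 0 ≤ C ∧ ∀ (ψ : Euc n → E) (A : ℝ) (g : Euc n → ℝ), ContDiff ℝ ∞ ψ →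
      (∀ j ≤ N, ∀ z : Euc n, ‖z‖ ≤ 1 → ‖iteratedFDeriv ℝ j ψ z‖ ≤ A) →
      IntegrableOn g (closedBall (0 : Euc n) 1)ᶜ →
      (∀ y ∈ (closedBall (0 : Euc n) 1)ᶜ, ‖y‖ ^ μ.re * ‖ψ y‖ ≤ g y) →
      ‖regPairing q N μ ψ‖ ≤
        quadBound q * (∫ y in (closedBall (0 : Euc n) 1)ᶜ, g y) + C * A := by
  have hq := quadBound_nonneg q
  set B := closedBall (0 : Euc n) 1
  -- The Taylor remainder is O(A |y|^N), so the integral over the ball costs this constant times A;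
  -- `C2` collects the Taylor terms put back afterwards. Neither depends on ψ.
  set C1 := quadBound q * ∫ y in B, ‖y‖ ^ (μ.re + N)
  set C2 := ∑ j ∈ Finset.range N, ‖((n : ℂ) + j) / (μ + n + j)‖ *
    (quadBound q * (volume : Measure (Euc n)).real B)
  have hC1 : 0 ≤ C1 := mul_nonneg hq (integral_nonneg fun y => by positivity)
  have hC2 : 0 ≤ C2 := Finset.sum_nonneg fun _ _ => by positivity
  refine ⟨C1 + C2, by positivity, ?_⟩
  intro ψ A g hψ hA hg hgψ
  have hA0 : 0 ≤ A := (norm_nonneg _).trans (hA 0 (Nat.zero_le _) 0 (by simp))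
  have h1 : ‖∫ y in Bᶜ, homKernel q μ y (ψ y)‖ ≤ quadBound q * ∫ y in Bᶜ, g y := by
    rw [← integral_const_mul]
    refine norm_integral_le_of_norm_le (hg.const_mul _) ?_
    refine (ae_restrict_iff' measurableSet_closedBall.compl).2 (Eventually.of_forall fun y hy => ?_)
    refine (norm_homKernel_apply_le q μ y _).trans ?_
    rw [mul_assoc]
    exact mul_le_mul_of_nonneg_left (hgψ y hy) hq
  have h2 : ‖∫ y in B, homKernel q μ y (ψ y - ∑ j ∈ Finset.range N, taylorPart ψ j y)‖ ≤
      C1 * A := by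
    have : C1 * A = ∫ y in B, quadBound q * A * ‖y‖ ^ (μ.re + N) := by
      rw [integral_const_mul]; ring
    rw [this]
    refine norm_integral_le_of_norm_le ((integrableOn_norm_rpow_closedBall hμ).const_mul _) ?_
    refine (ae_restrict_iff' measurableSet_closedBall).2 (Eventually.of_forall fun y hy => ?_)
    exact norm_homKernel_sub_taylorPart_le q hψ μ hA hy
  have h3 : ‖∑ j ∈ Finset.range N, (((n : ℂ) + j) / (μ + n + j)) •
      ∫ y in B, homKernel q 0 y (taylorPart ψ j y)‖ ≤ C2 * A := by
    rw [Finset.sum_mul]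
    refine (norm_sum_le _ _).trans (Finset.sum_le_sum fun j hj => ?_)
    rw [norm_smul, mul_assoc]
    gcongr
    have := norm_setIntegral_le_of_norm_le_const (μ := volume) (s := B) (C := quadBound q * A)
      (f := fun y => homKernel q 0 y (taylorPart ψ j y)) measure_closedBall_lt_top (by
        intro y hy
        refine (norm_homKernel_zero_apply_le q y _).trans ?_
        gcongr
        refine (norm_taylorPart_le ψ j y).trans ?_
        have hy1 : ‖y‖ ≤ 1 := by simpa [B] using hy
        calc ‖iteratedFDeriv ℝ j ψ 0‖ * ‖y‖ ^ j ≤ A * 1 := by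
              gcongr
              · exact hA j (Finset.mem_range.1 hj).le 0 (by simp)
              · exact pow_le_one₀ (norm_nonneg _) hy1
          _ = A := mul_one A)
    calc _ ≤ _ := this
      _ = _ := by ring
  calc ‖regPairing q N μ ψ‖ ≤ _ + _ + _ := norm_add₃_le
    _ ≤ quadBound q * (∫ y in Bᶜ, g y) + C1 * A + C2 * A := add_le_add (add_le_add h1 h2) h3
    _ = _ := by ring

lemma regPairing_add {N : ℕ} {μ : ℂ} (hμ : -(n : ℝ) < μ.re + N) {ψ φ : Euc n → E}
    (hψ : PairingAdmissible q μ ψ) (hφ : PairingAdmissible q μ φ) :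
    regPairing q N μ (ψ + φ) = regPairing q N μ ψ + regPairing q N μ φ := by
  have e1 : ∫ y in (closedBall (0 : Euc n) 1)ᶜ, homKernel q μ y ((ψ + φ) y) =
      (∫ y in (closedBall (0 : Euc n) 1)ᶜ, homKernel q μ y (ψ y)) +
      ∫ y in (closedBall (0 : Euc n) 1)ᶜ, homKernel q μ y (φ y) := by
    rw [← integral_add hψ.2 hφ.2]
    simp
  have e2 : ∫ y in closedBall (0 : Euc n) 1,
        homKernel q μ y ((ψ + φ) y - ∑ j ∈ Finset.range N, taylorPart (ψ + φ) j y) =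
      (∫ y in closedBall (0 : Euc n) 1,
        homKernel q μ y (ψ y - ∑ j ∈ Finset.range N, taylorPart ψ j y)) +
      ∫ y in closedBall (0 : Euc n) 1,
        homKernel q μ y (φ y - ∑ j ∈ Finset.range N, taylorPart φ j y) := by
    rw [← integral_add (integrableOn_homKernel_sub_taylorPart q hψ.1 hμ)
      (integrableOn_homKernel_sub_taylorPart q hφ.1 hμ)]
    congr 1
    ext y
    simp only [taylorPart_add hψ.1 hφ.1, Finset.sum_add_distrib, Pi.add_apply, ← map_add]
    congr 1
    abel
  have e3 : ∀ j, ∫ y in closedBall (0 : Euc n) 1, homKernel q 0 y (taylorPart (ψ + φ) j y) =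
      (∫ y in closedBall (0 : Euc n) 1, homKernel q 0 y (taylorPart ψ j y)) +
      ∫ y in closedBall (0 : Euc n) 1, homKernel q 0 y (taylorPart φ j y) := fun j => by
    rw [← integral_add (integrableOn_homKernel_zero_taylorPart q ψ j)
      (integrableOn_homKernel_zero_taylorPart q φ j)]
    simp only [taylorPart_add hψ.1 hφ.1, map_add]
  simp only [regPairing, e1, e2, e3, smul_add, Finset.sum_add_distrib]
  abel

lemma regPairing_smul {N : ℕ} {μ : ℂ} (c : ℂ) {ψ : Euc n → E} (hψ : ContDiff ℝ ∞ ψ) :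
    regPairing q N μ (c • ψ) = c • regPairing q N μ ψ := by
  have e1 : ∫ y in (closedBall (0 : Euc n) 1)ᶜ, homKernel q μ y ((c • ψ) y) =
      c • ∫ y in (closedBall (0 : Euc n) 1)ᶜ, homKernel q μ y (ψ y) := by
    rw [← integral_smul]
    simp only [Pi.smul_apply, map_smul]
  have e2 : ∫ y in closedBall (0 : Euc n) 1,
      homKernel q μ y ((c • ψ) y - ∑ j ∈ Finset.range N, taylorPart (c • ψ) j y) =
      c • ∫ y in closedBall (0 : Euc n) 1,
        homKernel q μ y (ψ y - ∑ j ∈ Finset.range N, taylorPart ψ j y) := by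
    rw [← integral_smul]
    simp only [taylorPart_const_smul hψ, Pi.smul_apply, ← Finset.smul_sum, ← smul_sub, map_smul]
  have e3 : ∀ j, ∫ y in closedBall (0 : Euc n) 1, homKernel q 0 y (taylorPart (c • ψ) j y) =
      c • ∫ y in closedBall (0 : Euc n) 1, homKernel q 0 y (taylorPart ψ j y) := fun j => by
    rw [← integral_smul]
    simp only [taylorPart_const_smul hψ, map_smul]
  simp only [regPairing, e1, e2, e3, smul_add, Finset.smul_sum, smul_comm c]

/-- When Re μ + N > -n the kernel times the N-th Taylor term is already integrable on the ball. Its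
integral, subtracted by the extra regularization, is exactly the term that the extra summand adds
back. -/
lemma regPairing_succ {N : ℕ} {μ : ℂ} (hμ : -(n : ℝ) < μ.re + N) {ψ : Euc n → E}
    (hψ : ContDiff ℝ ∞ ψ) : regPairing q (N + 1) μ ψ = regPairing q N μ ψ := by
  have hμ' : -(n : ℝ) < μ.re + (N + 1 : ℕ) := by push_cast; linarith
  have e : ∫ y in closedBall (0 : Euc n) 1,
        homKernel q μ y (ψ y - ∑ j ∈ Finset.range N, taylorPart ψ j y) =
      (∫ y in closedBall (0 : Euc n) 1,
        homKernel q μ y (ψ y - ∑ j ∈ Finset.range (N + 1), taylorPart ψ j y)) +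
      (((n : ℂ) + N) / (μ + n + N)) • ∫ y in closedBall (0 : Euc n) 1,
        homKernel q 0 y (taylorPart ψ N y) := by
    rw [← integral_closedBall_homKernel q (fun r y => taylorPart_smul_arg ψ N r y)
      (by linarith), ← integral_add (integrableOn_homKernel_sub_taylorPart q hψ hμ')
      (integrableOn_homKernel_taylorPart q ψ hμ)]
    congr 1
    ext y
    rw [← map_add, Finset.sum_range_succ]
    congr 1
    abel
  rw [regPairing, regPairing, e, Finset.sum_range_succ (n := N)]
  abel

lemma neg_lt_re_add_taylorOrder (n : ℕ) (μ : ℂ) : -(n : ℝ) < μ.re + taylorOrder n μ := by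
  have := Nat.lt_floor_add_one (1 - (n : ℝ) - μ.re)
  unfold taylorOrder
  linarith

/-- This allows N to stay fixed while μ varies in a neighbourhood, although `taylorOrder` jumps with
μ; holomorphy in μ rests on it. -/
lemma regPairing_eq_taylorOrder {N : ℕ} {μ : ℂ} (hμ : -(n : ℝ) < μ.re + N) {ψ : Euc n → E}
    (hψ : ContDiff ℝ ∞ ψ) : regPairing q N μ ψ = regPairing q (taylorOrder n μ) μ ψ := by
  have hN : taylorOrder n μ ≤ N := by
    rw [← Nat.lt_succ_iff, taylorOrder, Nat.floor_lt' (Nat.succ_ne_zero N)]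
    push_cast
    linarith
  induction N, hN using Nat.le_induction with
  | base => rfl
  | succ m hm ih =>
    have hm' : -(n : ℝ) < μ.re + m := by
      have h1 := neg_lt_re_add_taylorOrder n μ
      have h2 : (taylorOrder n μ : ℝ) ≤ m := by exact_mod_cast hm
      linarith
    rw [regPairing_succ q hm' hψ, ih hm']

end

/-! ### Homogeneity of the regularized pairing under dilations -/

noncomputable section

open scoped Pointwise

variable {n : ℕ} {E : Type*} [NormedAddCommGroup E] [NormedSpace ℂ E]
variable (q : Fin n → Fin n → E →L[ℂ] E) [NeZero n]

/-- If μ+n+j = 0, then j is odd because μ is not a pole, and the integral vanishes by parity. The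
right side vanishes too, because division by zero gives 0. In all other cases the radial integral is
explicit. -/
lemma integral_annulus_homKernel_taylorPart (ψ : Euc n → E) (j : ℕ) {μ : ℂ}
    (hμ : ¬ IsRieszPole n μ) {ε : ℝ} (hε : 0 < ε) (hε1 : ε ≤ 1) :
    ∫ y in {y : Euc n | ‖y‖ ∈ Ioc ε 1}, homKernel q μ y (taylorPart ψ j y) =
      ((((n : ℂ) + j) / (μ + n + j)) * (1 - (ε : ℂ) ^ (μ + n + j))) •
        ∫ y in closedBall (0 : Euc n) 1, homKernel q 0 y (taylorPart ψ j y) := by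
  by_cases h : μ + n + j = 0
  · have hj : Odd j := by
      rw [← Nat.not_even_iff_odd]
      rintro ⟨k, rfl⟩
      refine hμ ⟨k, ?_⟩
      push_cast at h
      linear_combination h
    have hodd : ∀ (ν : ℂ) (y : Euc n),
        homKernel q ν (-y) (taylorPart ψ j (-y)) = -homKernel q ν y (taylorPart ψ j y) := by
      intro ν y
      rw [homKernel_neg, ← neg_one_smul ℝ y, taylorPart_smul_arg, hj.neg_one_pow, neg_one_smul,
        map_neg]
    rw [h, integral_radial_odd (hodd μ) measurableSet_Ioc]
    simp
  · exact integral_annulus_homKernel q (fun r y => taylorPart_smul_arg ψ j r y) h hε hε1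

lemma integrableOn_annulus_homKernel {φ : Euc n → E} (hφ : Continuous φ) (μ : ℂ) {ε : ℝ}
    (hε : 0 < ε) :
    IntegrableOn (fun y => homKernel q μ y (φ y)) {y : Euc n | ‖y‖ ∈ Ioc ε 1} := by
  have hq := quadBound_nonneg q
  have hK : IsCompact {y : Euc n | ‖y‖ ∈ Icc ε 1} := by
    refine (isCompact_closedBall (0 : Euc n) 1).of_isClosed_subset
      (isClosed_Icc.preimage continuous_norm) fun y hy => ?_
    simpa using hy.2
  have hc : ContinuousOn (fun y : Euc n => quadBound q * ‖y‖ ^ μ.re * ‖φ y‖)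
      {y : Euc n | ‖y‖ ∈ Icc ε 1} := by
    refine (continuousOn_const.mul (continuous_norm.continuousOn.rpow_const fun y hy => ?_)).mul
      hφ.norm.continuousOn
    exact Or.inl (hε.trans_le hy.1).ne'
  refine Integrable.mono' ((hc.integrableOn_compact hK).mono_set fun y hy => ⟨hy.1.le, hy.2⟩)
    (aestronglyMeasurable_homKernel_apply q μ hφ.aestronglyMeasurable)
    (Eventually.of_forall fun y => norm_homKernel_apply_le q μ y _)

/-- Homogeneity of the regularized pairing under dilations. -/
lemma regPairing_comp_smul {N : ℕ} {μ : ℂ} (hμ : ¬ IsRieszPole n μ)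
    (hN : -(n : ℝ) < μ.re + N) {ψ : Euc n → E} (hψ : PairingAdmissible q μ ψ) {ε : ℝ} (hε : 0 < ε)
    (hε1 : ε ≤ 1) :
    regPairing q N μ (fun y => ψ (ε • y)) = ((ε : ℂ) ^ (-μ - n)) • regPairing q N μ ψ := by
  have hε' : (ε : ℂ) ≠ 0 := by exact_mod_cast hε.ne'
  set B := closedBall (0 : Euc n) 1 with hB
  set Bε := closedBall (0 : Euc n) ε with hBε
  set An := {y : Euc n | ‖y‖ ∈ Ioc ε 1} with hAn
  have hAnm : MeasurableSet An := measurable_norm measurableSet_Ioc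
  set S : Euc n → E := fun y => ∑ j ∈ Finset.range N, taylorPart ψ j y with hS
  have hSc : Continuous S := continuous_finsetSum _ fun j _ => continuous_taylorPart ψ j
  have hker : ∀ y, homKernel q μ y = ((ε : ℂ) ^ (-μ)) • homKernel q μ (ε • y) := by
    intro y
    rw [homKernel_smul _ _ hε, smul_smul, ← Complex.cpow_add _ _ hε']
    simp
  have hsc : ∀ (s : Set (Euc n)) (G : Euc n → E),
      ∫ y in s, G (ε • y) = ((ε : ℂ) ^ (-(n : ℂ))) • ∫ y in ε • s, G y := by
    intro s G
    rw [Measure.setIntegral_comp_smul_of_pos _ _ _ hε, ← Complex.coe_smul]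
    congr 1
    simp [Complex.cpow_neg]
  have hpow : (ε : ℂ) ^ (-μ) * (ε : ℂ) ^ (-(n : ℂ)) = (ε : ℂ) ^ (-μ - n) := by
    rw [← Complex.cpow_add _ _ hε']; congr 1
  have hset1 : ε • B = Bε := by
    rw [hB, _root_.smul_closedBall _ _ zero_le_one]
    simp [hBε, abs_of_pos hε]
  have hset2 : ε • Bᶜ = Bεᶜ := by
    ext y
    rw [← hset1, mem_smul_set_iff_inv_smul_mem₀ hε.ne', mem_compl_iff, mem_compl_iff,
      mem_smul_set_iff_inv_smul_mem₀ hε.ne']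
  -- Rescaling moves the cut from radius 1 to radius ε. The annulus between them passes from the
  -- unregularized integral to the regularized one, and the discrepancy is the integral of the
  -- Taylor terms over the annulus.
  have hu1 : Bεᶜ = Bᶜ ∪ An := by
    ext y
    simp only [hBε, hB, hAn, mem_compl_iff, mem_closedBall, dist_zero_right, mem_union,
      mem_ofPred_eq, mem_Ioc, not_le]
    constructor
    · intro h
      rcases lt_or_ge 1 ‖y‖ with h' | h'
      · exact Or.inl h'
      · exact Or.inr ⟨h, h'⟩
    · rintro (h | h)
      · linarith
      · exact h.1
  have hu2 : B = Bε ∪ An := by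
    ext y
    simp only [hBε, hB, hAn, mem_closedBall, dist_zero_right, mem_union, mem_ofPred_eq, mem_Ioc]
    constructor
    · intro h
      rcases le_or_gt ‖y‖ ε with h' | h'
      · exact Or.inl h'
      · exact Or.inr ⟨h', h⟩
    · rintro (h | h)
      · linarith
      · exact h.2
  have hd1 : Disjoint Bᶜ An := by
    refine Set.disjoint_left.2 fun y hy hy' => hy ?_
    simpa [hB] using hy'.2
  have hd2 : Disjoint Bε An := by
    refine Set.disjoint_left.2 fun y hy hy' => ?_
    exact absurd hy'.1 (not_lt.2 (by simpa [hBε] using hy))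
  have hin : IntegrableOn (fun y => homKernel q μ y (ψ y - S y)) B :=
    integrableOn_homKernel_sub_taylorPart q hψ.1 hN
  set I : ℕ → E := fun j => ∫ y in B, homKernel q 0 y (taylorPart ψ j y) with hI
  set c : ℕ → ℂ := fun j => ((n : ℂ) + j) / (μ + n + j) with hc
  set X := ∫ y in Bᶜ, homKernel q μ y (ψ y) with hX
  set Y := ∫ y in Bε, homKernel q μ y (ψ y - S y) with hY
  set Z := ∫ y in An, homKernel q μ y (ψ y - S y) with hZ
  have hsum : ∫ y in An, homKernel q μ y (S y) =
      ∑ j ∈ Finset.range N, (c j * (1 - (ε : ℂ) ^ (μ + n + j))) • I j := by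
    simp only [hS, map_sum]
    rw [integral_finsetSum _ fun j _ =>
      integrableOn_annulus_homKernel q (continuous_taylorPart ψ j) μ hε]
    exact Finset.sum_congr rfl fun j _ => integral_annulus_homKernel_taylorPart q ψ j hμ hε hε1
  have h1 : ∫ y in Bᶜ, homKernel q μ y (ψ (ε • y)) = ((ε : ℂ) ^ (-μ - n)) •
      (X + (Z + ∑ j ∈ Finset.range N, (c j * (1 - (ε : ℂ) ^ (μ + n + j))) • I j)) := by
    have e1 : ∀ y, homKernel q μ y (ψ (ε • y)) =
        ((ε : ℂ) ^ (-μ)) • (fun z => homKernel q μ z (ψ z)) (ε • y) := fun y => by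
      rw [hker y]; rfl
    simp_rw [e1]
    rw [integral_smul]
    refine (congrArg _ (hsc Bᶜ (fun z => homKernel q μ z (ψ z)))).trans ?_
    rw [smul_smul, hpow, hset2, hu1, setIntegral_union hd1 hAnm hψ.2
      (integrableOn_annulus_homKernel q hψ.1.continuous μ hε), ← hsum, hZ,
      ← integral_add (hin.mono_set (hu2 ▸ subset_union_right))
        (integrableOn_annulus_homKernel q hSc μ hε)]
    congr 3
    ext y
    rw [← map_add, sub_add_cancel]
  have h2 : ∫ y in B, homKernel q μ y
      (ψ (ε • y) - ∑ j ∈ Finset.range N, taylorPart (fun z => ψ (ε • z)) j y) =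
      ((ε : ℂ) ^ (-μ - n)) • Y := by
    have e1 : ∀ y, homKernel q μ y
        (ψ (ε • y) - ∑ j ∈ Finset.range N, taylorPart (fun z => ψ (ε • z)) j y) =
        ((ε : ℂ) ^ (-μ)) • (fun z => homKernel q μ z (ψ z - S z)) (ε • y) := fun y => by
      rw [hker y]
      simp only [hS, taylorPart_comp_smul hψ.1, taylorPart_smul_arg]
      rfl
    simp_rw [e1]
    rw [integral_smul]
    refine (congrArg _ (hsc B (fun z => homKernel q μ z (ψ z - S z)))).trans ?_
    rw [smul_smul, hpow, hset1]
  have h3 : ∀ j, ∫ y in B, homKernel q 0 y (taylorPart (fun z => ψ (ε • z)) j y) =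
      ((ε : ℂ) ^ j) • I j := fun j => by
    simp only [taylorPart_comp_smul hψ.1, hI]
    rw [← integral_smul]
    congr 1
    ext y
    rw [← Complex.coe_smul, map_smul, Complex.ofReal_pow]
  have h4 : ∫ y in B, homKernel q μ y (ψ y - S y) = Y + Z := by
    have hin' := hin
    rw [hu2] at hin' ⊢
    rw [setIntegral_union hd2 hAnm (hin'.mono_set subset_union_left)
      (hin'.mono_set subset_union_right)]
  have h5 : ∀ j : ℕ, (ε : ℂ) ^ (-μ - n) * (ε : ℂ) ^ (μ + n + j) = (ε : ℂ) ^ j := fun j => by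
    rw [← Complex.cpow_add _ _ hε', ← Complex.cpow_natCast]
    congr 1
    ring
  have hrhs : regPairing q N μ ψ = X + (Y + Z) + ∑ j ∈ Finset.range N, c j • I j := by
    rw [← h4]; rfl
  have hlhs : regPairing q N μ (fun y => ψ (ε • y)) = ((ε : ℂ) ^ (-μ - n)) •
      (X + (Z + ∑ j ∈ Finset.range N, (c j * (1 - (ε : ℂ) ^ (μ + n + j))) • I j)) +
      ((ε : ℂ) ^ (-μ - n)) • Y + ∑ j ∈ Finset.range N, c j • ((ε : ℂ) ^ j) • I j := by
    rw [regPairing, h1, h2]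
    congr 1
    exact Finset.sum_congr rfl fun j _ => by rw [h3]
  -- With the common factor ε^(-μ-n) taken out, the counterterms carry ε^(μ+n+j) and the annulus
  -- carries 1 - ε^(μ+n+j); these add up to the undilated counterterms.
  have h6 : ∑ j ∈ Finset.range N, c j • ((ε : ℂ) ^ j) • I j = ((ε : ℂ) ^ (-μ - n)) •
      ∑ j ∈ Finset.range N, (c j * (ε : ℂ) ^ (μ + n + j)) • I j := by
    rw [Finset.smul_sum]
    refine Finset.sum_congr rfl fun j _ => ?_
    rw [smul_smul, smul_smul, ← h5 j]
    congr 1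
    ring
  rw [hlhs, hrhs, h6, ← smul_add, ← smul_add]
  congr 1
  have h7 : ∑ j ∈ Finset.range N, c j • I j =
      ∑ j ∈ Finset.range N, (c j * (1 - (ε : ℂ) ^ (μ + n + j))) • I j +
      ∑ j ∈ Finset.range N, (c j * (ε : ℂ) ^ (μ + n + j)) • I j := by
    rw [← Finset.sum_add_distrib]
    refine Finset.sum_congr rfl fun j _ => ?_
    rw [← add_smul]
    congr 1
    ring
  rw [h7]
  abel

end

/-! ### Growth of regularized convolutions -/

noncomputable section

variable {n : ℕ} {E : Type*} [NormedAddCommGroup E] [NormedSpace ℂ E]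

/-- The derivatives of `θ` up to order `N` are bounded by `A (1 + |z|)^τ`. -/
def JetBound (θ : Euc n → E) (N : ℕ) (τ A : ℝ) : Prop :=
  ContDiff ℝ ∞ θ ∧ ∀ j ≤ N, ∀ z, ‖iteratedFDeriv ℝ j θ z‖ ≤ A * (1 + ‖z‖) ^ τ

lemma JetBound.nonneg {θ : Euc n → E} {N : ℕ} {τ A : ℝ} (h : JetBound θ N τ A) : 0 ≤ A := by
  have := (norm_nonneg _).trans (h.2 0 (Nat.zero_le _) 0)
  simpa using this

/-- Peetre's inequality. -/
lemma one_add_norm_rpow_le (a b : Euc n) (τ : ℝ) :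
    (1 + ‖a‖) ^ τ ≤ (1 + ‖b‖) ^ τ * (1 + ‖a - b‖) ^ |τ| := by
  have h1 : (1 + ‖a‖) ≤ (1 + ‖b‖) * (1 + ‖a - b‖) := by
    have := norm_le_norm_add_norm_sub' a b
    nlinarith [norm_nonneg b, norm_nonneg (a - b)]
  have h2 : (1 + ‖b‖) ≤ (1 + ‖a‖) * (1 + ‖a - b‖) := by
    have := norm_le_norm_add_norm_sub a b
    nlinarith [norm_nonneg a, norm_nonneg (a - b)]
  rcases le_total 0 τ with hτ | hτ
  · rw [abs_of_nonneg hτ, ← Real.mul_rpow (by positivity) (by positivity)]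
    exact Real.rpow_le_rpow (by positivity) h1 hτ
  · rw [abs_of_nonpos hτ]
    have h3 := Real.rpow_le_rpow (by positivity) h2 (neg_nonneg.2 hτ)
    rw [Real.mul_rpow (by positivity) (by positivity), Real.rpow_neg (by positivity),
      Real.rpow_neg (by positivity)] at h3
    have ha : 0 < (1 + ‖a‖) ^ τ := by positivity
    have hb : 0 < (1 + ‖b‖) ^ τ := by positivity
    rw [inv_mul_eq_div, inv_eq_one_div, div_le_div_iff₀ hb ha, one_mul] at h3
    linarith

lemma norm_iteratedFDeriv_comp_const_sub {F : Type*} [NormedAddCommGroup F] [NormedSpace ℝ F]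
    (θ : Euc n → F) (j : ℕ) (x y : Euc n) :
    ‖iteratedFDeriv ℝ j (fun y => θ (x - y)) y‖ = ‖iteratedFDeriv ℝ j θ (x - y)‖ := by
  have h := (LinearIsometryEquiv.neg ℝ (E := Euc n)).norm_iteratedFDeriv_comp_right
    (fun z => θ (x + z)) y j
  rw [iteratedFDeriv_comp_add_left] at h
  simpa [Function.comp_def, sub_eq_add_neg] using h

variable (q : Fin n → Fin n → E →L[ℂ] E)

/-- Convolution with the regularized kernel. -/
def regConv (N : ℕ) (μ : ℂ) (θ : Euc n → E) (x : Euc n) : E :=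
  regPairing q N μ (fun y => θ (x - y))

lemma pairingAdmissible_of_le {μ : ℂ} {ψ : Euc n → E} (hψ : ContDiff ℝ ∞ ψ) {g : Euc n → ℝ}
    (hg : IntegrableOn g (closedBall (0 : Euc n) 1)ᶜ)
    (hgψ : ∀ y ∈ (closedBall (0 : Euc n) 1)ᶜ, ‖y‖ ^ μ.re * ‖ψ y‖ ≤ g y) :
    PairingAdmissible q μ ψ := by
  refine ⟨hψ, Integrable.mono' (hg.const_mul (quadBound q))
    (aestronglyMeasurable_homKernel_apply q μ hψ.continuous.aestronglyMeasurable) ?_⟩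
  refine (ae_restrict_iff' measurableSet_closedBall.compl).2 (Eventually.of_forall fun y hy => ?_)
  refine (norm_homKernel_apply_le q μ y _).trans ?_
  rw [mul_assoc]
  exact mul_le_mul_of_nonneg_left (hgψ y hy) (quadBound_nonneg q)

lemma one_lt_norm_of_mem_compl {y : Euc n} (hy : y ∈ (closedBall (0 : Euc n) 1)ᶜ) : 1 < ‖y‖ := by
  simpa using hy

variable [NeZero n]

/-- Convolution of a rapidly decreasing function: the result is of the order of the kernel. -/
lemma exists_norm_regConv_le_of_rapid {N : ℕ} {μ : ℂ} (hμ : -(n : ℝ) < μ.re + N) {M : ℝ}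
    (hM : |μ.re| + n < M) :
    ∃ C : ℝ, 0 ≤ C ∧ ∀ (θ : Euc n → E) (A : ℝ), JetBound θ N (-M) A → ∀ x,
      PairingAdmissible q μ (fun y => θ (x - y)) ∧
      ‖regConv q N μ θ x‖ ≤ C * A * (1 + ‖x‖) ^ μ.re := by
  obtain ⟨C, hC, h⟩ := exists_norm_regPairing_le q hμ
  set K := ∫ z : Euc n, (1 + ‖z‖) ^ (|μ.re| - M) with hK
  have hq := quadBound_nonneg q
  have hKi : Integrable (fun z : Euc n => (1 + ‖z‖) ^ (|μ.re| - M)) :=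
    integrable_one_add_norm_rpow (by linarith)
  have hK0 : 0 ≤ K := integral_nonneg fun z => by positivity
  have h2 : (0 : ℝ) ≤ 2 ^ |μ.re| := by positivity
  refine ⟨quadBound q * (2 ^ |μ.re| * K) + C * 2 ^ |μ.re|, by positivity, ?_⟩
  intro θ A hθ x
  have hA := hθ.nonneg
  set g : Euc n → ℝ := fun y => 2 ^ |μ.re| * A * (1 + ‖x‖) ^ μ.re * (1 + ‖x - y‖) ^ (|μ.re| - M)
    with hg
  have hgi : Integrable g := (hKi.comp_sub_left x).const_mul _
  have hg0 : ∀ y, 0 ≤ g y := fun y => by positivity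
  have hθx : ContDiff ℝ ∞ (fun y => θ (x - y)) := hθ.1.comp (by fun_prop)
  -- Peetre's inequality trades |y|^(Re μ) for (1+|x|)^(Re μ) (1+|x-y|)^|Re μ|. The decay of order M
  -- absorbs the second factor and leaves an integrable function of x-y, since M > |Re μ| + n.
  have hbound : ∀ y ∈ (closedBall (0 : Euc n) 1)ᶜ, ‖y‖ ^ μ.re * ‖θ (x - y)‖ ≤ g y := by
    intro y hy
    have e1 := norm_rpow_le_of_one_le (one_lt_norm_of_mem_compl hy).le μ.re
    have e2 : ‖θ (x - y)‖ ≤ A * (1 + ‖x - y‖) ^ (-M) := by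
      simpa using hθ.2 0 (Nat.zero_le _) (x - y)
    have e3 := one_add_norm_rpow_le y x μ.re
    rw [norm_sub_rev y x] at e3
    calc ‖y‖ ^ μ.re * ‖θ (x - y)‖
        ≤ (2 ^ |μ.re| * ((1 + ‖x‖) ^ μ.re * (1 + ‖x - y‖) ^ |μ.re|)) *
          (A * (1 + ‖x - y‖) ^ (-M)) := by
          gcongr
          exact e1.trans (by gcongr)
      _ = 2 ^ |μ.re| * A * (1 + ‖x‖) ^ μ.re *
          ((1 + ‖x - y‖) ^ |μ.re| * (1 + ‖x - y‖) ^ (-M)) := by ring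
      _ = g y := by rw [← Real.rpow_add (by positivity), hg]; rfl
  have hjet : ∀ j ≤ N, ∀ z : Euc n, ‖z‖ ≤ 1 → ‖iteratedFDeriv ℝ j (fun y => θ (x - y)) z‖ ≤
      A * 2 ^ |μ.re| * (1 + ‖x‖) ^ μ.re := by
    intro j hj z hz
    rw [norm_iteratedFDeriv_comp_const_sub]
    refine (hθ.2 j hj _).trans ?_
    rw [mul_assoc]
    refine mul_le_mul_of_nonneg_left ?_ hA
    have e1 : (1 + ‖x - z‖) ^ (-M) ≤ (1 + ‖x - z‖) ^ (-|μ.re|) :=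
      Real.rpow_le_rpow_of_exponent_le (by linarith [norm_nonneg (x - z)])
        (by have : (0 : ℝ) ≤ n := Nat.cast_nonneg n
            linarith)
    refine e1.trans ?_
    have hz0 : 0 < (1 + ‖x - z‖) ^ |μ.re| := by positivity
    rw [Real.rpow_neg (by positivity), inv_le_iff_one_le_mul₀ hz0]
    have e2 := one_add_norm_rpow_le z x μ.re
    rw [norm_sub_rev z x] at e2
    have e3 : 1 ≤ 2 ^ |μ.re| * (1 + ‖z‖) ^ μ.re := by
      have hz1 : (1 + ‖z‖) ≤ 2 := by linarith
      have hz2 : 1 ≤ (1 + ‖z‖) := by linarith [norm_nonneg z]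
      rcases le_total 0 μ.re with hs | hs
      · exact one_le_mul_of_one_le_of_one_le (Real.one_le_rpow one_le_two (abs_nonneg _))
          (Real.one_le_rpow hz2 hs)
      · rw [abs_of_nonpos hs, Real.rpow_neg two_pos.le]
        have : (2 : ℝ) ^ μ.re ≤ (1 + ‖z‖) ^ μ.re :=
          Real.rpow_le_rpow_of_nonpos (by positivity) hz1 hs
        rw [inv_mul_eq_div, one_le_div (by positivity)]
        exact this
    calc (1 : ℝ) ≤ 2 ^ |μ.re| * (1 + ‖z‖) ^ μ.re := e3
      _ ≤ 2 ^ |μ.re| * ((1 + ‖x‖) ^ μ.re * (1 + ‖x - z‖) ^ |μ.re|) := by gcongr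
      _ = _ := by ring
  refine ⟨pairingAdmissible_of_le q hθx hgi.integrableOn hbound, ?_⟩
  refine (h _ _ g hθx hjet hgi.integrableOn hbound).trans ?_
  have hint : ∫ y in (closedBall (0 : Euc n) 1)ᶜ, g y ≤
      2 ^ |μ.re| * A * (1 + ‖x‖) ^ μ.re * K := by
    refine (setIntegral_le_integral hgi (Eventually.of_forall hg0)).trans (le_of_eq ?_)
    rw [hg, integral_const_mul, hK,
      integral_sub_left_eq_self (fun z : Euc n => (1 + ‖z‖) ^ (|μ.re| - M))]
  calc _ ≤ quadBound q * (2 ^ |μ.re| * A * (1 + ‖x‖) ^ μ.re * K) +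
        C * (A * 2 ^ |μ.re| * (1 + ‖x‖) ^ μ.re) := by gcongr
    _ = _ := by ring

/-- Convolution of a function of moderate growth. -/
lemma exists_norm_regConv_le_of_moderate {N : ℕ} {μ : ℂ} (hμ : -(n : ℝ) < μ.re + N) {τ : ℝ}
    (hτ : τ + μ.re < -(n : ℝ)) :
    ∃ C : ℝ, 0 ≤ C ∧ ∀ (φ : Euc n → E) (A : ℝ), JetBound φ N τ A → ∀ x,
      PairingAdmissible q μ (fun y => φ (x - y)) ∧
      ‖regConv q N μ φ x‖ ≤ C * A * (1 + ‖x‖) ^ |τ| := by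
  obtain ⟨C, hC, h⟩ := exists_norm_regPairing_le q hμ
  set K := ∫ z : Euc n, (1 + ‖z‖) ^ (τ + μ.re) with hK
  have hq := quadBound_nonneg q
  have hKi : Integrable (fun z : Euc n => (1 + ‖z‖) ^ (τ + μ.re)) :=
    integrable_one_add_norm_rpow hτ
  have hK0 : 0 ≤ K := integral_nonneg fun z => by positivity
  refine ⟨quadBound q * (2 ^ |μ.re| * K) + C * 2 ^ |τ|, by positivity, ?_⟩
  intro φ A hφ x
  have hA := hφ.nonneg
  set g : Euc n → ℝ := fun y => 2 ^ |μ.re| * A * (1 + ‖x‖) ^ |τ| * (1 + ‖y‖) ^ (τ + μ.re)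
    with hg
  have hgi : Integrable g := hKi.const_mul _
  have hg0 : ∀ y, 0 ≤ g y := fun y => by positivity
  have hφx : ContDiff ℝ ∞ (fun y => φ (x - y)) := hφ.1.comp (by fun_prop)
  -- Here the weight moves onto y instead: φ may grow, and integrability at infinity comes from the
  -- combined exponent τ + Re μ < -n.
  have hpeetre : ∀ y, (1 + ‖x - y‖) ^ τ ≤ (1 + ‖y‖) ^ τ * (1 + ‖x‖) ^ |τ| := fun y => by
    have := one_add_norm_rpow_le (x - y) (-y) τ
    simpa using this
  have hbound : ∀ y ∈ (closedBall (0 : Euc n) 1)ᶜ, ‖y‖ ^ μ.re * ‖φ (x - y)‖ ≤ g y := by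
    intro y hy
    have e1 := norm_rpow_le_of_one_le (one_lt_norm_of_mem_compl hy).le μ.re
    have e2 : ‖φ (x - y)‖ ≤ A * (1 + ‖x - y‖) ^ τ := by
      simpa using hφ.2 0 (Nat.zero_le _) (x - y)
    calc ‖y‖ ^ μ.re * ‖φ (x - y)‖
        ≤ (2 ^ |μ.re| * (1 + ‖y‖) ^ μ.re) * (A * ((1 + ‖y‖) ^ τ * (1 + ‖x‖) ^ |τ|)) := by
          gcongr
          exact e2.trans (by gcongr; exact hpeetre y)
      _ = 2 ^ |μ.re| * A * (1 + ‖x‖) ^ |τ| * ((1 + ‖y‖) ^ τ * (1 + ‖y‖) ^ μ.re) := by ring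
      _ = g y := by rw [← Real.rpow_add (by positivity)]
  have hjet : ∀ j ≤ N, ∀ z : Euc n, ‖z‖ ≤ 1 → ‖iteratedFDeriv ℝ j (fun y => φ (x - y)) z‖ ≤
      A * 2 ^ |τ| * (1 + ‖x‖) ^ |τ| := by
    intro j hj z hz
    rw [norm_iteratedFDeriv_comp_const_sub]
    refine (hφ.2 j hj _).trans ?_
    rw [mul_assoc]
    refine mul_le_mul_of_nonneg_left ((hpeetre z).trans ?_) hA
    gcongr
    calc (1 + ‖z‖) ^ τ ≤ (1 + ‖z‖) ^ |τ| :=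
          Real.rpow_le_rpow_of_exponent_le (by linarith [norm_nonneg z]) (le_abs_self τ)
      _ ≤ 2 ^ |τ| := Real.rpow_le_rpow (by positivity) (by linarith) (abs_nonneg τ)
  refine ⟨pairingAdmissible_of_le q hφx hgi.integrableOn hbound, ?_⟩
  refine (h _ _ g hφx hjet hgi.integrableOn hbound).trans ?_
  have hint : ∫ y in (closedBall (0 : Euc n) 1)ᶜ, g y ≤
      2 ^ |μ.re| * A * (1 + ‖x‖) ^ |τ| * K := by
    refine (setIntegral_le_integral hgi (Eventually.of_forall hg0)).trans (le_of_eq ?_)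
    rw [hg, integral_const_mul, hK]
  calc _ ≤ quadBound q * (2 ^ |μ.re| * A * (1 + ‖x‖) ^ |τ| * K) +
        C * (A * 2 ^ |τ| * (1 + ‖x‖) ^ |τ|) := by gcongr
    _ = _ := by ring

/-- Schwartz functions have rapidly decreasing jets, controlled by a continuous seminorm. -/
lemma exists_seminorm_jetBound (n : ℕ) (E : Type*) [NormedAddCommGroup E] [NormedSpace ℂ E]
    (N M : ℕ) : ∃ p : Seminorm ℂ 𝓢(Euc n, E), Continuous p ∧
      ∀ θ : 𝓢(Euc n, E), JetBound θ N (-(M : ℝ)) (p θ) := by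
  refine ⟨((2 : NNReal) ^ M) • (Finset.Iic (M, N)).sup (schwartzSeminormFamily ℂ (Euc n) E), ?_, ?_⟩
  · have h1 : Continuous ((Finset.Iic (M, N)).sup (schwartzSeminormFamily ℂ (Euc n) E) :
        Seminorm ℂ 𝓢(Euc n, E)) :=
      Seminorm.continuous_finsetSup fun i _ =>
        (schwartz_withSeminorms ℂ (Euc n) E).continuous_seminorm i
    exact h1.const_smul ((2 : NNReal) ^ M)
  · intro θ
    refine ⟨θ.smooth ⊤, fun j hj z => ?_⟩
    have h := SchwartzMap.one_add_le_sup_seminorm_apply (𝕜 := ℂ) (m := (M, N)) (k := M) (n := j)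
      le_rfl hj θ z
    rw [Real.rpow_neg (by positivity), Real.rpow_natCast, ← div_eq_mul_inv, le_div_iff₀ (by positivity),
      mul_comm]
    refine h.trans (le_of_eq ?_)
    simp [schwartzSeminormFamily, NNReal.smul_def]
    rfl

end

/-! ### Smoothness of the convolution of a Schwartz function -/

noncomputable section

variable {n : ℕ} {E : Type*} [NormedAddCommGroup E] [NormedSpace ℂ E]

/-- Second order Taylor estimate for iterated derivatives. -/
lemma norm_iteratedFDeriv_add_sub_sub_le {θ : Euc n → E} (hθ : ContDiff ℝ ∞ θ) (j : ℕ)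
    (z h : Euc n) {K : ℝ} (hK : ∀ w ∈ closedBall z ‖h‖, ‖iteratedFDeriv ℝ (j + 2) θ w‖ ≤ K) :
    ‖iteratedFDeriv ℝ j θ (z + h) - iteratedFDeriv ℝ j θ z - fderiv ℝ (iteratedFDeriv ℝ j θ) z h‖ ≤
      K * ‖h‖ ^ 2 := by
  have hK0 : 0 ≤ K := (norm_nonneg _).trans (hK z (mem_closedBall_self (norm_nonneg _)))
  have hd : ∀ k : ℕ, Differentiable ℝ (iteratedFDeriv ℝ k θ) := fun k =>
    (hθ.iteratedFDeriv_right (i := k) (m := ∞) (mod_cast le_top)).differentiable (by simp)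
  have hz : z ∈ closedBall z ‖h‖ := mem_closedBall_self (norm_nonneg _)
  have h1 : ∀ w ∈ closedBall z ‖h‖,
      ‖iteratedFDeriv ℝ (j + 1) θ w - iteratedFDeriv ℝ (j + 1) θ z‖ ≤ K * ‖h‖ := by
    intro w hw
    refine ((convex_closedBall z ‖h‖).norm_image_sub_le_of_norm_fderiv_le (𝕜 := ℝ) (C := K)
      (fun w _ => (hd (j + 1)).differentiableAt) (fun w hw => ?_) hz hw).trans ?_
    · rw [norm_fderiv_iteratedFDeriv]; exact hK w hw
    · gcongr
      simpa [dist_eq_norm] using hw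
  have h2 : ∀ w ∈ closedBall z ‖h‖,
      ‖fderiv ℝ (iteratedFDeriv ℝ j θ) w - fderiv ℝ (iteratedFDeriv ℝ j θ) z‖ ≤ K * ‖h‖ := by
    intro w hw
    rw [fderiv_iteratedFDeriv]
    set e := continuousMultilinearCurryLeftEquiv ℝ (fun _ : Fin (j + 1) => Euc n) E
    have h0 : ‖e (iteratedFDeriv ℝ (j + 1) θ w) - e (iteratedFDeriv ℝ (j + 1) θ z)‖ ≤ K * ‖h‖ := by
      rw [← LinearIsometryEquiv.map_sub, LinearIsometryEquiv.norm_map]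
      exact h1 w hw
    exact h0
  have h3 := (convex_closedBall z ‖h‖).norm_image_sub_le_of_norm_fderiv_le' (𝕜 := ℝ)
    (fun w _ => (hd j).differentiableAt) h2 hz
    (show z + h ∈ closedBall z ‖h‖ by simp)
  rw [add_sub_cancel_left] at h3
  refine h3.trans (le_of_eq ?_)
  ring

/-- The second order Taylor remainder of a Schwartz function, as a Schwartz function. -/
def translationRemainder (θ : 𝓢(Euc n, E)) (h : Euc n) : 𝓢(Euc n, E) :=
  SchwartzMap.compSubConstCLM ℂ (-h) θ - θ - ∂_{h} θ

lemma translationRemainder_apply (θ : 𝓢(Euc n, E)) (h z : Euc n) :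
    translationRemainder θ h z = θ (z + h) - θ z - fderiv ℝ θ z h := by
  simp [translationRemainder, SchwartzMap.lineDerivOp_apply_eq_fderiv]

/-- Two more derivatives of θ make the remainder quadratic in h with unchanged decay. Since |h| ≤ 1,
moving the weight from a nearby point back to z costs only 2^M. -/
lemma jetBound_translationRemainder {θ : 𝓢(Euc n, E)} {N M : ℕ} {A : ℝ}
    (hθ : JetBound θ (N + 2) (-(M : ℝ)) A) {h : Euc n} (hh : ‖h‖ ≤ 1) :
    JetBound (translationRemainder θ h) N (-(M : ℝ)) (A * 2 ^ M * ‖h‖ ^ 2) := by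
  have hA := hθ.nonneg
  refine ⟨(translationRemainder θ h).smooth ⊤, fun j hj z => ?_⟩
  have hs : ContDiff ℝ ∞ θ := hθ.1
  have e : (translationRemainder θ h : Euc n → E) =
      (fun z => θ (z + h)) - (θ : Euc n → E) - (fun z => fderiv ℝ θ z h) := by
    ext z; exact translationRemainder_apply θ h z
  have s1 : ContDiff ℝ j (fun z => θ (z + h)) := (hs.comp (by fun_prop)).of_le (mod_cast le_top)
  have s2 : ContDiff ℝ j (θ : Euc n → E) := hs.of_le (mod_cast le_top)
  have s3 : ContDiff ℝ j (fun z => fderiv ℝ θ z h) :=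
    ((hs.fderiv_right (m := ∞) (mod_cast le_top)).clm_apply contDiff_const).of_le (mod_cast le_top)
  have s12 : ContDiff ℝ j ((fun z => θ (z + h)) - (θ : Euc n → E)) := s1.sub s2
  rw [e, iteratedFDeriv_sub_apply s12.contDiffAt s3.contDiffAt,
    iteratedFDeriv_sub_apply s1.contDiffAt s2.contDiffAt, iteratedFDeriv_comp_add_right,
    ← fderiv_iteratedFDeriv_apply hs]
  refine (norm_iteratedFDeriv_add_sub_sub_le hs j z h
    (K := A * 2 ^ M * (1 + ‖z‖) ^ (-(M : ℝ))) ?_).trans (le_of_eq (by ring))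
  intro w hw
  refine (hθ.2 (j + 2) (by omega) w).trans ?_
  rw [mul_assoc]
  refine mul_le_mul_of_nonneg_left ?_ hA
  have h1 := one_add_norm_rpow_le w z (-(M : ℝ))
  have h2 : ‖w - z‖ ≤ 1 := by
    have : ‖w - z‖ ≤ ‖h‖ := by simpa [dist_eq_norm] using hw
    linarith
  refine h1.trans ?_
  rw [mul_comm]
  gcongr
  rw [abs_neg, Nat.abs_cast, Real.rpow_natCast]
  gcongr
  linarith

variable (q : Fin n → Fin n → E →L[ℂ] E) [NeZero n]

lemma exists_nat_rapid (n : ℕ) (μ : ℂ) : ∃ M : ℕ, |μ.re| + n < M :=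
  exists_nat_gt _

lemma pairingAdmissible_schwartz (μ : ℂ) (θ : 𝓢(Euc n, E)) (x : Euc n) :
    PairingAdmissible q μ (fun y => θ (x - y)) := by
  obtain ⟨M, hM⟩ := exists_nat_rapid n μ
  obtain ⟨p, -, hp⟩ := exists_seminorm_jetBound n E (taylorOrder n μ) M
  obtain ⟨C, -, hC⟩ := exists_norm_regConv_le_of_rapid q (neg_lt_re_add_taylorOrder n μ) hM
  exact (hC θ _ (hp θ) x).1

/-- Convolution with the regularized kernel, evaluated at a point, as a linear functional on
Schwartz functions. -/
def regConvLM {N : ℕ} {μ : ℂ} (hμ : -(n : ℝ) < μ.re + N) (x : Euc n) : 𝓢(Euc n, E) →ₗ[ℂ] E where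
  toFun θ := regConv q N μ θ x
  map_add' θ φ := regPairing_add q hμ (pairingAdmissible_schwartz q μ θ x)
    (pairingAdmissible_schwartz q μ φ x)
  map_smul' c θ := regPairing_smul q c (pairingAdmissible_schwartz q μ θ x).1

lemma regConvLM_apply {N : ℕ} {μ : ℂ} (hμ : -(n : ℝ) < μ.re + N) (x : Euc n) (θ : 𝓢(Euc n, E)) :
    regConvLM q hμ x θ = regConv q N μ θ x := rfl

lemma exists_seminorm_norm_regConv_le {N : ℕ} {μ : ℂ} (hμ : -(n : ℝ) < μ.re + N) :
    ∃ p : Seminorm ℂ 𝓢(Euc n, E), Continuous p ∧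
      ∀ (θ : 𝓢(Euc n, E)) (x : Euc n), ‖regConv q N μ θ x‖ ≤ p θ * (1 + ‖x‖) ^ μ.re := by
  obtain ⟨M, hM⟩ := exists_nat_rapid n μ
  obtain ⟨p, hpc, hp⟩ := exists_seminorm_jetBound n E N M
  obtain ⟨C, hC0, hC⟩ := exists_norm_regConv_le_of_rapid q hμ hM
  refine ⟨C.toNNReal • p, hpc.const_smul C.toNNReal, fun θ x => ?_⟩
  refine ((hC θ _ (hp θ) x).2).trans (le_of_eq ?_)
  rw [_root_.smul_apply, NNReal.smul_def, Real.coe_toNNReal _ hC0, smul_eq_mul]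

/-- The derivative of the convolution. -/
def regConvDeriv {N : ℕ} {μ : ℂ} (hμ : -(n : ℝ) < μ.re + N) (θ : 𝓢(Euc n, E)) (x : Euc n) :
    Euc n →L[ℝ] E :=
  LinearMap.toContinuousLinearMap
    { toFun := fun h => regConv q N μ (∂_{h} θ : 𝓢(Euc n, E)) x
      map_add' := fun h k => by
        rw [← regConvLM_apply q hμ, LineDeriv.lineDerivOp_left_add, map_add]; rfl
      map_smul' := fun c h => by
        rw [← regConvLM_apply q hμ, LineDeriv.lineDerivOp_left_smul, ← Complex.coe_smul c,
          map_smul, Complex.coe_smul]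
        rfl }

lemma regConvDeriv_apply {N : ℕ} {μ : ℂ} (hμ : -(n : ℝ) < μ.re + N) (θ : 𝓢(Euc n, E)) (x h : Euc n) :
    regConvDeriv q hμ θ x h = regConv q N μ (∂_{h} θ : 𝓢(Euc n, E)) x := rfl

lemma regConv_translationRemainder {N : ℕ} {μ : ℂ} (hμ : -(n : ℝ) < μ.re + N) (θ : 𝓢(Euc n, E))
    (x h : Euc n) : regConv q N μ (translationRemainder θ h) x =
      regConv q N μ θ (x + h) - regConv q N μ θ x - regConvDeriv q hμ θ x h := by
  rw [← regConvLM_apply q hμ, translationRemainder, map_sub, map_sub, regConvDeriv_apply]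
  congr 2
  rw [regConvLM_apply]
  simp only [regConv, SchwartzMap.compSubConstCLM_apply]
  congr 1
  ext y
  congr 1
  abel

/-- Convolution is linear and commutes with translation, so the error of the linear approximation is
the convolution of the Taylor remainder of θ. That remainder is O(|h|²) in the norms controlling the
convolution, so the integrals need not be differentiated. -/
lemma hasFDerivAt_regConv {N : ℕ} {μ : ℂ} (hμ : -(n : ℝ) < μ.re + N) (θ : 𝓢(Euc n, E)) (x : Euc n) :
    HasFDerivAt (regConv q N μ θ) (regConvDeriv q hμ θ x) x := by
  obtain ⟨M, hM⟩ := exists_nat_rapid n μ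
  obtain ⟨p, -, hp⟩ := exists_seminorm_jetBound n E (N + 2) M
  obtain ⟨C, hC0, hC⟩ := exists_norm_regConv_le_of_rapid q hμ hM
  rw [hasFDerivAt_iff_isLittleO_nhds_zero]
  have hbig : (fun h : Euc n => regConv q N μ θ (x + h) - regConv q N μ θ x -
      regConvDeriv q hμ θ x h) =O[𝓝 0] fun h => ‖h‖ ^ 2 := by
    refine Asymptotics.IsBigO.of_bound (C * (p θ * 2 ^ M) * (1 + ‖x‖) ^ μ.re) ?_
    filter_upwards [closedBall_mem_nhds (0 : Euc n) one_pos] with h hh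
    have hh1 : ‖h‖ ≤ 1 := by simpa using hh
    rw [← regConv_translationRemainder]
    refine ((hC _ _ (jetBound_translationRemainder (hp θ) hh1) x).2).trans (le_of_eq ?_)
    rw [Real.norm_of_nonneg (by positivity)]
    ring
  refine hbig.trans_isLittleO ?_
  exact Asymptotics.IsLittleO.of_norm_right (Asymptotics.isLittleO_norm_pow_id one_lt_two).norm_right

/-- Expansion of the derivative along the coordinate directions. -/
lemma fderiv_regConv {N : ℕ} {μ : ℂ} (hμ : -(n : ℝ) < μ.re + N) (θ : 𝓢(Euc n, E)) :
    fderiv ℝ (regConv q N μ θ) = fun x => ∑ k : Fin n,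
      ContinuousLinearMap.smulRightL ℝ (Euc n) E (EuclideanSpace.proj k)
        (regConv q N μ (∂_{(EuclideanSpace.single k (1 : ℝ) : Euc n)} θ : 𝓢(Euc n, E)) x) := by
  ext1 x
  rw [(hasFDerivAt_regConv q hμ θ x).fderiv]
  ext h
  have hsum : h = ∑ k : Fin n, h k • (EuclideanSpace.single k (1 : ℝ) : Euc n) := by
    ext i
    simp [Finset.sum_apply, Pi.single_apply]
  conv_lhs => rw [hsum]
  rw [map_sum]
  simp only [map_smul, regConvDeriv_apply]
  simp

/-- The derivative is a finite combination of convolutions of the Schwartz functions ∂_k θ, so the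
induction must run over all θ at once. -/
lemma contDiff_regConv {N : ℕ} {μ : ℂ} (hμ : -(n : ℝ) < μ.re + N) (θ : 𝓢(Euc n, E)) :
    ContDiff ℝ ∞ (regConv q N μ θ) := by
  rw [contDiff_infty]
  intro m
  induction m generalizing θ with
  | zero =>
    exact contDiff_zero.2 (continuous_iff_continuousAt.2 fun x =>
      (hasFDerivAt_regConv q hμ θ x).continuousAt)
  | succ m ih =>
    have hd : Differentiable ℝ (regConv q N μ θ) := fun x =>
      (hasFDerivAt_regConv q hμ θ x).differentiableAt
    rw [show ((m + 1 : ℕ) : WithTop ℕ∞) = (m : WithTop ℕ∞) + 1 by push_cast; rfl,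
      contDiff_succ_iff_fderiv]
    refine ⟨hd, by simp, ?_⟩
    rw [fderiv_regConv q hμ]
    exact ContDiff.sum fun k _ => (ContinuousLinearMap.contDiff _).comp (ih _)

lemma exists_seminorm_norm_iteratedFDeriv_regConv_le {N : ℕ} {μ : ℂ} (hμ : -(n : ℝ) < μ.re + N)
    (j : ℕ) : ∃ p : Seminorm ℂ 𝓢(Euc n, E), Continuous p ∧ ∀ (θ : 𝓢(Euc n, E)) (x : Euc n),
      ‖iteratedFDeriv ℝ j (regConv q N μ θ) x‖ ≤ p θ * (1 + ‖x‖) ^ μ.re := by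
  induction j with
  | zero =>
    obtain ⟨p, hpc, hp⟩ := exists_seminorm_norm_regConv_le q hμ
    exact ⟨p, hpc, fun θ x => by simpa using hp θ x⟩
  | succ j ih =>
    obtain ⟨p, hpc, hp⟩ := ih
    let T : Fin n → (E →L[ℝ] Euc n →L[ℝ] E) := fun k =>
      ContinuousLinearMap.smulRightL ℝ (Euc n) E (EuclideanSpace.proj k)
    let D : Fin n → (𝓢(Euc n, E) →L[ℂ] 𝓢(Euc n, E)) := fun k =>
      LineDeriv.lineDerivOpCLM ℂ 𝓢(Euc n, E) (EuclideanSpace.single k (1 : ℝ) : Euc n)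
    let P : Seminorm ℂ 𝓢(Euc n, E) := ∑ k : Fin n, ‖T k‖₊ • p.comp (D k).toLinearMap
    have hPa : ∀ θ, P θ = ∑ k : Fin n, ‖T k‖ * p (D k θ) := fun θ => by
      simp [P, NNReal.smul_def]
    refine ⟨P, ?_, fun θ x => ?_⟩
    · have : (P : 𝓢(Euc n, E) → ℝ) = fun θ => ∑ k : Fin n, ‖T k‖ * p (D k θ) := funext hPa
      rw [this]
      exact continuous_finsetSum _ fun k _ => continuous_const.mul (hpc.comp (D k).continuous)
    · have hs : ∀ k, ContDiff ℝ ∞ (regConv q N μ (D k θ)) := fun k => contDiff_regConv q hμ _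
      rw [← norm_iteratedFDeriv_fderiv, fderiv_regConv q hμ]
      have e : iteratedFDeriv ℝ j (fun x => ∑ k : Fin n, T k (regConv q N μ (D k θ) x)) x =
          ∑ k : Fin n, (T k).compContinuousMultilinearMap
            (iteratedFDeriv ℝ j (regConv q N μ (D k θ)) x) := by
        have hTs : ∀ k ∈ Finset.univ, ContDiffAt ℝ j (fun x => T k (regConv q N μ (D k θ) x)) x :=
          fun k _ => (((T k).contDiff.comp (hs k)).of_le (mod_cast le_top)).contDiffAt
        rw [iteratedFDeriv_fun_sum_apply hTs]
        refine Finset.sum_congr rfl fun k _ => ?_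
        exact (T k).iteratedFDeriv_comp_left (hs k).contDiffAt (mod_cast le_top)
      have e' : iteratedFDeriv ℝ j (fun x => ∑ k : Fin n,
        ContinuousLinearMap.smulRightL ℝ (Euc n) E (EuclideanSpace.proj k)
          (regConv q N μ (∂_{(EuclideanSpace.single k (1 : ℝ) : Euc n)} θ : 𝓢(Euc n, E)) x)) x = _ := e
      rw [e', hPa, Finset.sum_mul]
      refine (norm_sum_le _ _).trans (Finset.sum_le_sum fun k _ => ?_)
      refine (ContinuousLinearMap.norm_compContinuousMultilinearMap_le _ _).trans ?_
      rw [mul_assoc]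
      gcongr
      exact hp _ x

end

/-! ### Composition of two convolutions around a coordinate multiplication -/

noncomputable section

variable {n : ℕ} {E : Type*} [NormedAddCommGroup E] [NormedSpace ℂ E]

/-- Multiplication by the `i`-th coordinate. -/
def coordMul (i : Fin n) (u : Euc n → E) (x : Euc n) : E := x i • u x

lemma norm_iteratedFDeriv_coord_le (i : Fin n) (a : ℕ) (x : Euc n) :
    ‖iteratedFDeriv ℝ a (fun x : Euc n => x i) x‖ ≤ 1 + ‖x‖ := by
  have h1 : ‖(EuclideanSpace.proj i : Euc n →L[ℝ] ℝ)‖ ≤ 1 :=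
    ContinuousLinearMap.opNorm_le_bound _ zero_le_one fun y => by
      simpa using PiLp.norm_apply_le y i
  rcases a with _ | a
  · rw [norm_iteratedFDeriv_zero]
    exact (PiLp.norm_apply_le x i).trans (by linarith)
  · have e : fderiv ℝ (fun x : Euc n => x i) = fun _ => (EuclideanSpace.proj i : Euc n →L[ℝ] ℝ) := by
      ext1 y
      exact (EuclideanSpace.proj i : Euc n →L[ℝ] ℝ).fderiv
    rw [← norm_iteratedFDeriv_fderiv, e]
    rcases a with _ | a
    · rw [norm_iteratedFDeriv_zero]
      linarith [norm_nonneg x]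
    · rw [iteratedFDeriv_const_of_ne (Nat.succ_ne_zero a)]
      simp only [Pi.zero_apply, norm_zero]
      positivity

lemma contDiff_coord (i : Fin n) : ContDiff ℝ ∞ (fun x : Euc n => x i) :=
  (EuclideanSpace.proj i : Euc n →L[ℝ] ℝ).contDiff

lemma JetBound.coordMul {u : Euc n → E} {N : ℕ} {σ A : ℝ} (hu : JetBound u N σ A) (i : Fin n) :
    JetBound (coordMul i u) N (σ + 1) (2 ^ N * A) := by
  have hA := hu.nonneg
  refine ⟨(contDiff_coord i).smul hu.1, fun j hj x => ?_⟩
  have h := norm_iteratedFDeriv_smul_le (𝕜 := ℝ) (contDiff_coord i) hu.1 x (n := j)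
    (mod_cast le_top)
  refine h.trans ?_
  calc _ ≤ ∑ a ∈ Finset.range (j + 1), (j.choose a : ℝ) * (1 + ‖x‖) * (A * (1 + ‖x‖) ^ σ) := by
        refine Finset.sum_le_sum fun a _ => ?_
        gcongr
        · exact norm_iteratedFDeriv_coord_le i a x
        · exact hu.2 _ (by omega) x
    _ = (2 : ℝ) ^ j * A * ((1 + ‖x‖) ^ σ * (1 + ‖x‖) ^ (1 : ℝ)) := by
        rw [← Finset.sum_mul, ← Finset.sum_mul]
        have : ∑ a ∈ Finset.range (j + 1), (j.choose a : ℝ) = 2 ^ j := by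
          exact_mod_cast Nat.sum_range_choose j
        rw [this, Real.rpow_one]
        ring
    _ ≤ _ := by
        rw [← Real.rpow_add (by positivity)]
        gcongr
        exact one_le_two

variable (q : Fin n → Fin n → E →L[ℂ] E) [NeZero n]

lemma exists_seminorm_jetBound_regConv {N : ℕ} {μ : ℂ} (hμ : -(n : ℝ) < μ.re + N) (N' : ℕ) :
    ∃ p : Seminorm ℂ 𝓢(Euc n, E), Continuous p ∧ ∀ θ : 𝓢(Euc n, E),
      JetBound (regConv q N μ θ) N' μ.re (p θ) := by
  choose p hpc hp using fun j => exists_seminorm_norm_iteratedFDeriv_regConv_le q hμ j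
  have hsum : ∀ θ, (∑ j ∈ Finset.range (N' + 1), p j) θ = ∑ j ∈ Finset.range (N' + 1), p j θ :=
    fun θ => by simp
  refine ⟨∑ j ∈ Finset.range (N' + 1), p j, ?_, fun θ => ⟨contDiff_regConv q hμ θ, fun j hj x => ?_⟩⟩
  · have : ((∑ j ∈ Finset.range (N' + 1), p j : Seminorm ℂ 𝓢(Euc n, E)) : 𝓢(Euc n, E) → ℝ) =
        fun θ => ∑ j ∈ Finset.range (N' + 1), p j θ := funext hsum
    rw [this]
    exact continuous_finsetSum _ fun j _ => hpc j
  · refine (hp j θ x).trans ?_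
    gcongr
    rw [hsum]
    exact Finset.single_le_sum (f := fun j => p j θ) (fun _ _ => apply_nonneg _ _)
      (Finset.mem_range.2 (by omega))

/-- The composition of two convolutions with a coordinate multiplication in between. -/
def regComp (N₁ N₂ : ℕ) (μ₁ μ₂ : ℂ) (i : Fin n) (θ : Euc n → E) : Euc n → E :=
  regConv q N₂ μ₂ (coordMul i (regConv q N₁ μ₁ θ))

variable {N₁ N₂ : ℕ} {μ₁ μ₂ : ℂ}

/-- The inner convolution and its derivatives are O((1+|x|)^(Re μ₁)), and the coordinate adds one
power. The decay hypothesis is then what the outer convolution needs at infinity. Continuity of the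
seminorm later gives uniform control along bounded families of Schwartz functions. -/
lemma exists_seminorm_regComp (h₁ : -(n : ℝ) < μ₁.re + N₁) (h₂ : -(n : ℝ) < μ₂.re + N₂)
    (hdecay : μ₁.re + 1 + μ₂.re < -(n : ℝ)) (i : Fin n) :
    ∃ p : Seminorm ℂ 𝓢(Euc n, E), Continuous p ∧ ∀ (θ : 𝓢(Euc n, E)) (x : Euc n),
      PairingAdmissible q μ₂ (fun y => coordMul i (regConv q N₁ μ₁ θ) (x - y)) ∧
      ‖regComp q N₁ N₂ μ₁ μ₂ i θ x‖ ≤ p θ * (1 + ‖x‖) ^ |μ₁.re + 1| := by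
  obtain ⟨p, hpc, hp⟩ := exists_seminorm_jetBound_regConv q h₁ N₂
  obtain ⟨C, hC0, hC⟩ := exists_norm_regConv_le_of_moderate q h₂ hdecay
  refine ⟨(C * 2 ^ N₂).toNNReal • p, hpc.const_smul (C * 2 ^ N₂).toNNReal, fun θ x => ?_⟩
  obtain ⟨ha, hb⟩ := hC _ _ ((hp θ).coordMul i) x
  refine ⟨ha, hb.trans (le_of_eq ?_)⟩
  rw [_root_.smul_apply, NNReal.smul_def, Real.coe_toNNReal _ (by positivity), smul_eq_mul]
  ring

lemma regConv_add_schwartz {N : ℕ} {μ : ℂ} (hμ : -(n : ℝ) < μ.re + N) (θ φ : 𝓢(Euc n, E)) :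
    regConv q N μ (θ + φ : 𝓢(Euc n, E)) = regConv q N μ θ + regConv q N μ φ := by
  ext x
  exact map_add (regConvLM q hμ x) θ φ

lemma regComp_add (h₁ : -(n : ℝ) < μ₁.re + N₁) (h₂ : -(n : ℝ) < μ₂.re + N₂)
    (hdecay : μ₁.re + 1 + μ₂.re < -(n : ℝ)) (i : Fin n) (θ φ : 𝓢(Euc n, E)) (x : Euc n) :
    regComp q N₁ N₂ μ₁ μ₂ i (θ + φ : 𝓢(Euc n, E)) x =
      regComp q N₁ N₂ μ₁ μ₂ i θ x + regComp q N₁ N₂ μ₁ μ₂ i φ x := by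
  obtain ⟨p, -, hp⟩ := exists_seminorm_regComp q h₁ h₂ hdecay i
  rw [regComp, regComp, regComp, regConv, regConv_add_schwartz q h₁, regConv, regConv,
    ← regPairing_add q h₂ (hp θ x).1 (hp φ x).1]
  congr 1
  ext y
  simp [coordMul]

lemma regConv_comp_smul {N : ℕ} {μ : ℂ} (hμ : ¬ IsRieszPole n μ) (hN : -(n : ℝ) < μ.re + N)
    {θ : Euc n → E} {ε : ℝ} (hε : 0 < ε) (hε1 : ε ≤ 1) (x : Euc n)
    (hθ : PairingAdmissible q μ (fun y => θ (ε • x - y))) :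
    regConv q N μ (fun z => θ (ε • z)) x = ((ε : ℂ) ^ (-μ - n)) • regConv q N μ θ (ε • x) := by
  rw [regConv, regConv, ← regPairing_comp_smul q hμ hN hθ hε hε1]
  simp only [smul_sub]

/-- Homogeneity of the composition under dilations. -/
lemma regComp_comp_smul (hμ₁ : ¬ IsRieszPole n μ₁) (hμ₂ : ¬ IsRieszPole n μ₂)
    (h₁ : -(n : ℝ) < μ₁.re + N₁) (h₂ : -(n : ℝ) < μ₂.re + N₂)
    (hsum : μ₁ + μ₂ = -2 * n - 2) (i : Fin n) (θ : 𝓢(Euc n, E)) {ε : ℝ} (hε : 0 < ε)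
    (hε1 : ε ≤ 1) (x : Euc n) :
    regComp q N₁ N₂ μ₁ μ₂ i (fun z => θ (ε • z)) x = ε • regComp q N₁ N₂ μ₁ μ₂ i θ (ε • x) := by
  have hε' : (ε : ℂ) ≠ 0 := by exact_mod_cast hε.ne'
  have hdecay : μ₁.re + 1 + μ₂.re < -(n : ℝ) := by
    have h := congrArg Complex.re hsum
    simp at h
    have : (0 : ℝ) ≤ n := Nat.cast_nonneg n
    linarith
  obtain ⟨p, -, hp⟩ := exists_seminorm_regComp q h₁ h₂ hdecay i
  have e1 : coordMul i (regConv q N₁ μ₁ (fun z => θ (ε • z))) =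
      ((ε : ℂ) ^ (-μ₁ - n - 1)) • fun z => coordMul i (regConv q N₁ μ₁ θ) (ε • z) := by
    ext z
    simp only [coordMul, Pi.smul_apply]
    rw [regConv_comp_smul q hμ₁ h₁ hε hε1 z (pairingAdmissible_schwartz q μ₁ θ _),
      ← Complex.coe_smul, ← Complex.coe_smul, smul_smul, smul_smul]
    congr 1
    have hpow : (ε : ℂ) ^ (-μ₁ - n) = (ε : ℂ) ^ (-μ₁ - n - 1) * ε := by
      rw [Complex.cpow_sub (-μ₁ - n) 1 hε', Complex.cpow_one, div_mul_cancel₀ _ hε']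
    rw [hpow, PiLp.smul_apply, smul_eq_mul, Complex.ofReal_mul]
    ring
  have hφ : ContDiff ℝ ∞ (fun z => coordMul i (regConv q N₁ μ₁ θ) (ε • z)) :=
    ((contDiff_coord i).smul (contDiff_regConv q h₁ θ)).comp (by fun_prop)
  rw [regComp, e1]
  have e2 : regConv q N₂ μ₂ (((ε : ℂ) ^ (-μ₁ - n - 1)) •
      fun z => coordMul i (regConv q N₁ μ₁ θ) (ε • z)) x = ((ε : ℂ) ^ (-μ₁ - n - 1)) •
      regConv q N₂ μ₂ (fun z => coordMul i (regConv q N₁ μ₁ θ) (ε • z)) x :=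
    regPairing_smul q _ (hφ.comp (contDiff_const.sub contDiff_id))
  -- Each convolution contributes ε^(-μ-n) and the coordinate contributes ε^(-1); the sum condition
  -- on the exponents leaves ε to the first power. A positive power is what the final limit needs.
  rw [e2, regConv_comp_smul q hμ₂ h₂ hε hε1 x (hp θ _).1, smul_smul, ← Complex.cpow_add _ _ hε',
    show -μ₁ - n - 1 + (-μ₂ - n) = 1 by linear_combination -hsum, Complex.cpow_one,
    Complex.coe_smul]
  rfl

end

/-! ### Complex powers of the norm away from the origin and integration by parts -/

noncomputable section

variable {n : ℕ} {E : Type*} [NormedAddCommGroup E] [NormedSpace ℂ E]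

lemma contDiffAt_ofReal_cpow {x : ℝ} (hx : 0 < x) (s : ℂ) :
    ContDiffAt ℝ ∞ (fun t : ℝ => (t : ℂ) ^ s) x := by
  have h : (fun t : ℝ => Complex.exp (Real.log t * s)) =ᶠ[𝓝 x] fun t : ℝ => (t : ℂ) ^ s := by
    filter_upwards [eventually_gt_nhds hx] with t ht
    rw [Complex.cpow_def_of_ne_zero (by exact_mod_cast ht.ne'), Complex.ofReal_log ht.le]
  refine ContDiffAt.congr_of_eventuallyEq ?_ h.symm
  have h1 : ContDiffAt ℝ ∞ (fun t : ℝ => (Real.log t : ℂ)) x :=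
    Complex.ofRealCLM.contDiff.contDiffAt.comp x (Real.contDiffAt_log.2 hx.ne')
  exact (h1.mul contDiffAt_const).cexp

lemma hasDerivAt_ofReal_cpow_of_pos {x : ℝ} (hx : 0 < x) (s : ℂ) :
    HasDerivAt (fun t : ℝ => (t : ℂ) ^ s) (s * (x : ℂ) ^ (s - 1)) x := by
  have := (hasDerivAt_id (x : ℂ)).cpow_const (c := s) (Or.inl (by simpa using hx))
  simpa using this.comp_ofReal

lemma exists_iteratedFDerivWithin_cpow_le {c : ℝ} (hc : 0 < c) (k : ℕ) : ∀ s : ℂ,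
    ∃ (m : ℕ) (C : ℝ), 0 ≤ C ∧ ∀ x ∈ Ioi c,
      ‖iteratedFDerivWithin ℝ k (fun t : ℝ => (t : ℂ) ^ s) (Ioi c) x‖ ≤ C * (1 + ‖x‖) ^ m := by
  simp only [norm_iteratedFDerivWithin_eq_norm_iteratedDerivWithin]
  induction k with
  | zero =>
    intro s
    obtain ⟨m, hm⟩ := exists_nat_ge s.re
    refine ⟨m, 1 + c ^ s.re, by positivity, fun x hx => ?_⟩
    have hx' : c < x := hx
    have hx0 : 0 < x := hc.trans hx'
    rw [iteratedDerivWithin_zero, Complex.norm_cpow_eq_rpow_re_of_pos hx0, Real.norm_of_nonneg hx0.le]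
    have h1 : (1 : ℝ) ≤ (1 + x) ^ m := one_le_pow₀ (by linarith)
    rcases le_total 0 s.re with hs | hs
    · calc x ^ s.re ≤ (1 + x) ^ s.re := Real.rpow_le_rpow hx0.le (by linarith) hs
        _ ≤ (1 + x) ^ (m : ℝ) := Real.rpow_le_rpow_of_exponent_le (by linarith) hm
        _ = 1 * (1 + x) ^ m := by rw [Real.rpow_natCast, one_mul]
        _ ≤ _ := by gcongr; linarith [Real.rpow_pos_of_pos hc s.re]
    · calc x ^ s.re ≤ c ^ s.re := Real.rpow_le_rpow_of_nonpos hc hx'.le hs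
        _ ≤ 1 + c ^ s.re := by linarith
        _ ≤ _ := le_mul_of_one_le_right (by positivity) h1
  | succ k ih =>
    intro s
    obtain ⟨m, C, hC, h⟩ := ih (s - 1)
    refine ⟨m, ‖s‖ * C, by positivity, fun x hx => ?_⟩
    have e : EqOn (derivWithin (fun t : ℝ => (t : ℂ) ^ s) (Ioi c))
        (fun t : ℝ => s • (t : ℂ) ^ (s - 1)) (Ioi c) := fun t ht => by
      rw [derivWithin_of_isOpen isOpen_Ioi ht]
      exact (hasDerivAt_ofReal_cpow_of_pos (hc.trans ht) s).deriv
    rw [iteratedDerivWithin_succ', iteratedDerivWithin_congr e hx,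
      iteratedDerivWithin_fun_const_smul hx isOpen_Ioi.uniqueDiffOn s
        (((contDiffAt_ofReal_cpow (hc.trans hx) (s - 1)).of_le
          (mod_cast le_top)).contDiffWithinAt), norm_smul, mul_assoc]
    gcongr
    exact h x hx

/-- `|ξ|²` modified near the origin so as to be bounded away from zero. -/
lemma exists_norm_sq_cutoff (n : ℕ) {r : ℝ} (hr : 0 < r) : ∃ (ρ : Euc n → ℝ) (c : ℝ),
    ρ.HasTemperateGrowth ∧ 0 < c ∧ (∀ ξ, c < ρ ξ) ∧ ∀ ξ, r ≤ ‖ξ‖ → ρ ξ = ‖ξ‖ ^ 2 := by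
  let b : ContDiffBump (0 : Euc n) := ⟨r / 2, r, by positivity, by linarith⟩
  -- The bump is 1 on |ξ| ≤ r/2, and |ξ|² ≥ (r/2)² outside; halving the minimum makes the lower
  -- bound strict.
  refine ⟨fun ξ => ‖ξ‖ ^ 2 + b ξ, min 1 ((r / 2) ^ 2) / 2, ?_, by positivity, fun ξ => ?_,
    fun ξ hξ => ?_⟩
  · have hb : (fun ξ : Euc n => b ξ).HasTemperateGrowth :=
      b.hasCompactSupport.hasTemperateGrowth b.contDiff
    exact (Function.hasTemperateGrowth_norm_sq (Euc n)).add hb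
  · have hpos : 0 < min 1 ((r / 2) ^ 2) := by positivity
    have hb : 0 ≤ b ξ := b.nonneg
    rcases le_total ‖ξ‖ (r / 2) with h | h
    · have : b ξ = 1 := b.one_of_mem_closedBall (by simpa using h)
      have := min_le_left 1 ((r / 2) ^ 2)
      have := sq_nonneg ‖ξ‖
      linarith
    · have := min_le_right 1 ((r / 2) ^ 2)
      have : (r / 2) ^ 2 ≤ ‖ξ‖ ^ 2 := by gcongr
      linarith
  · have : b ξ = 0 := b.zero_of_le_dist (by simpa using hξ)
    simp [this]

/-- The power t^(s/2) has polynomially bounded derivatives on a half-line (c, ∞) with c > 0, so it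
may be composed with |ξ|² once that is kept away from 0 by a bump. -/
lemma exists_temperate_norm_cpow (n : ℕ) (s : ℂ) {r : ℝ} (hr : 0 < r) : ∃ g : Euc n → ℂ,
    g.HasTemperateGrowth ∧ ∀ ξ, r ≤ ‖ξ‖ → g ξ = (‖ξ‖ : ℂ) ^ s := by
  obtain ⟨ρ, c, hρ, hc, hcρ, hρr⟩ := exists_norm_sq_cutoff n hr
  refine ⟨(fun t : ℝ => (t : ℂ) ^ (s / 2)) ∘ ρ, ?_, fun ξ hξ => ?_⟩
  · refine Function.HasTemperateGrowth.comp' (t := Ioi c) ?_ isOpen_Ioi.uniqueDiffOn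
      (fun x hx => (contDiffAt_ofReal_cpow (hc.trans hx) _).contDiffWithinAt) (fun N => ?_) hρ
    · rintro _ ⟨ξ, rfl⟩
      exact hcρ ξ
    · choose m C hC h using fun k => exists_iteratedFDerivWithin_cpow_le hc k (s / 2)
      refine ⟨∑ k ∈ Finset.range (N + 1), m k, ∑ k ∈ Finset.range (N + 1), C k,
        Finset.sum_nonneg fun k _ => hC k, fun k hk x hx => (h k x hx).trans ?_⟩
      have hk' : k ∈ Finset.range (N + 1) := Finset.mem_range.2 (by omega)
      have h1 : C k ≤ ∑ k ∈ Finset.range (N + 1), C k :=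
        Finset.single_le_sum (fun k _ => hC k) hk'
      have h2 : m k ≤ ∑ k ∈ Finset.range (N + 1), m k :=
        Finset.single_le_sum (fun k _ => Nat.zero_le _) hk'
      have := Finset.sum_nonneg (s := Finset.range (N + 1)) fun k _ => hC k
      gcongr
      linarith [norm_nonneg x]
  · have h0 : 0 < ‖ξ‖ := hr.trans_le hξ
    have h0' : (‖ξ‖ : ℂ) ≠ 0 := by exact_mod_cast h0.ne'
    rw [Function.comp_apply, hρr ξ hξ, Complex.ofReal_pow, ← Complex.cpow_nat_mul' (x := (‖ξ‖ : ℂ))]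
    · congr 1
      push_cast
      ring
    · rw [Complex.arg_ofReal_of_nonneg h0.le]
      simp [Real.pi_pos]
    · rw [Complex.arg_ofReal_of_nonneg h0.le]
      simp [Real.pi_pos.le]

/-- Vanishing on a ball around the origin. -/
def VanishesNear (r : ℝ) (h : Euc n → E) : Prop := ∀ ξ, ‖ξ‖ < r → h ξ = 0

/-- This is why the symbol calculus is carried out on functions vanishing near 0: every homogeneous
symbol maps them to Schwartz functions, and integrability is automatic. -/
lemma exists_schwartz_norm_cpow_smul (s : ℂ) {r : ℝ} (hr : 0 < r) {h : 𝓢(Euc n, E)}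
    (hh : VanishesNear r h) : ∃ F : 𝓢(Euc n, E), ∀ ξ, F ξ = ((‖ξ‖ : ℂ) ^ s) • h ξ := by
  obtain ⟨g, hg, hgr⟩ := exists_temperate_norm_cpow n s hr
  refine ⟨SchwartzMap.smulLeftCLM E g h, fun ξ => ?_⟩
  rw [SchwartzMap.smulLeftCLM_apply_apply hg]
  rcases lt_or_ge ‖ξ‖ r with h' | h'
  · simp [hh ξ h']
  · rw [hgr ξ h']

lemma VanishesNear.eventuallyEq {r : ℝ} {h : Euc n → E} (hh : VanishesNear r h) {ξ : Euc n}
    (hξ : ‖ξ‖ < r) : h =ᶠ[𝓝 ξ] fun _ => 0 := by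
  filter_upwards [(isOpen_lt continuous_norm continuous_const).mem_nhds hξ] with y hy
  exact hh y hy

lemma VanishesNear.lineDeriv {r : ℝ} {h : 𝓢(Euc n, E)} (hh : VanishesNear r h) (v : Euc n) :
    VanishesNear r (∂_{v} h : 𝓢(Euc n, E)) := fun ξ hξ => by
  rw [SchwartzMap.lineDerivOp_apply_eq_fderiv, (hh.eventuallyEq hξ).fderiv_eq]
  simp

lemma hasFDerivAt_norm_cpow {ξ : Euc n} (hξ : ξ ≠ 0) (s : ℂ) :
    HasFDerivAt (fun ξ : Euc n => (‖ξ‖ : ℂ) ^ s)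
      ((innerSL ℝ ξ).smulRight (s * (‖ξ‖ : ℂ) ^ (s - 2))) ξ := by
  have h0 : 0 < ‖ξ‖ := norm_pos_iff.2 hξ
  have h0' : (‖ξ‖ : ℂ) ≠ 0 := by exact_mod_cast h0.ne'
  have h1 : HasFDerivAt (fun ξ : Euc n => ‖ξ‖ ^ 2) (2 • innerSL ℝ ξ) ξ :=
    (hasStrictFDerivAt_norm_sq ξ).hasFDerivAt
  have key : ∀ (t : ℂ) (y : Euc n), y ≠ 0 →
      (((‖y‖ ^ 2 : ℝ) : ℂ)) ^ t = (‖y‖ : ℂ) ^ (2 * t) := fun t y hy => by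
    have hy0 : 0 < ‖y‖ := norm_pos_iff.2 hy
    rw [Complex.ofReal_pow, ← Complex.cpow_nat_mul' (x := (‖y‖ : ℂ))]
    · push_cast
      ring_nf
    · rw [Complex.arg_ofReal_of_nonneg hy0.le]
      simp [Real.pi_pos]
    · rw [Complex.arg_ofReal_of_nonneg hy0.le]
      simp [Real.pi_pos.le]
  have h2 := (hasDerivAt_ofReal_cpow_of_pos (pow_pos h0 2) (s / 2)).hasFDerivAt.comp ξ h1
  have h3 : (fun ξ : Euc n => (‖ξ‖ : ℂ) ^ s) =ᶠ[𝓝 ξ]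
      (fun t : ℝ => (t : ℂ) ^ (s / 2)) ∘ fun ξ => ‖ξ‖ ^ 2 := by
    filter_upwards [isOpen_ne.mem_nhds hξ] with y hy
    rw [Function.comp_apply, key _ y hy]
    ring_nf
  refine (h2.congr_of_eventuallyEq h3).congr_fderiv ?_
  rw [key _ _ hξ]
  ext v
  simp only [ContinuousLinearMap.smulRight_apply, innerSL_apply_apply, Complex.real_smul,
    ContinuousLinearMap.comp_apply, _root_.smul_apply, ContinuousLinearMap.toSpanSingleton_apply,
    nsmul_eq_mul]
  rw [show 2 * (s / 2 - 1) = s - 2 by ring]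
  push_cast
  ring

lemma lineDeriv_of_eq_norm_cpow_smul {s : ℂ} {r : ℝ} (hr : 0 < r) {h F : 𝓢(Euc n, E)}
    (hh : VanishesNear r h) (hF : ∀ ξ, F ξ = ((‖ξ‖ : ℂ) ^ s) • h ξ) (v ξ : Euc n) :
    (∂_{v} F : 𝓢(Euc n, E)) ξ = (s * (‖ξ‖ : ℂ) ^ (s - 2) * (inner ℝ ξ v : ℝ)) • h ξ +
      ((‖ξ‖ : ℂ) ^ s) • (∂_{v} h : 𝓢(Euc n, E)) ξ := by
  rcases lt_or_ge ‖ξ‖ r with h' | h'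
  · have hF' : VanishesNear r F := fun y hy => by rw [hF, hh y hy, smul_zero]
    rw [hF'.lineDeriv v ξ h', hh.lineDeriv v ξ h', hh ξ h']
    simp
  · have hξ : ξ ≠ 0 := norm_pos_iff.1 (hr.trans_le h')
    rw [SchwartzMap.lineDerivOp_apply_eq_fderiv, SchwartzMap.lineDerivOp_apply_eq_fderiv]
    have e : (F : Euc n → E) = fun ξ => ((‖ξ‖ : ℂ) ^ s) • h ξ := funext hF
    have := (hasFDerivAt_norm_cpow hξ s).smul (h.hasFDerivAt ξ)
    rw [e]
    change fderiv ℝ ((fun ξ : Euc n => (‖ξ‖ : ℂ) ^ s) • (h : Euc n → E)) ξ v = _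
    rw [this.fderiv]
    simp only [_root_.add_apply, _root_.smul_apply, ContinuousLinearMap.smulRight_apply,
      innerSL_apply_apply, Complex.real_smul]
    rw [add_comm, mul_comm ((inner ℝ ξ v : ℝ) : ℂ)]

variable [CompleteSpace E]

/-- The integral is the value at 0 of the Fourier transform, where the factor ⟨ξ, v⟩ produced by the
derivative vanishes. -/
lemma integral_lineDeriv_schwartz (F : 𝓢(Euc n, E)) (v : Euc n) :
    ∫ ξ, (∂_{v} F : 𝓢(Euc n, E)) ξ = 0 := by
  have h1 : ∀ G : 𝓢(Euc n, E), (𝓕 G) 0 = ∫ ξ, G ξ := fun G => by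
    rw [SchwartzMap.fourier_coe, Real.fourier_eq]
    simp
  have ht : (inner ℝ · v : Euc n → ℝ).HasTemperateGrowth := by fun_prop
  rw [← h1, SchwartzMap.fourier_lineDerivOp_eq, _root_.smul_apply,
    SchwartzMap.smulLeftCLM_apply_apply ht]
  simp

lemma integral_norm_cpow_smul_lineDeriv (s : ℂ) {r : ℝ} (hr : 0 < r) {h : 𝓢(Euc n, E)}
    (hh : VanishesNear r h) (v : Euc n) :
    ∫ ξ, ((‖ξ‖ : ℂ) ^ s) • (∂_{v} h : 𝓢(Euc n, E)) ξ =
      -s • ∫ ξ, ((‖ξ‖ : ℂ) ^ (s - 2)) • ((inner ℝ ξ v : ℝ) • h ξ) := by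
  obtain ⟨F, hF⟩ := exists_schwartz_norm_cpow_smul s hr hh
  obtain ⟨G, hG⟩ := exists_schwartz_norm_cpow_smul s hr (hh.lineDeriv v)
  have h0 := integral_lineDeriv_schwartz F v
  have e : ∀ ξ, (∂_{v} F : 𝓢(Euc n, E)) ξ - G ξ =
      s • (((‖ξ‖ : ℂ) ^ (s - 2)) • ((inner ℝ ξ v : ℝ) • h ξ)) := fun ξ => by
    rw [lineDeriv_of_eq_norm_cpow_smul hr hh hF, hG, add_sub_cancel_right, ← Complex.coe_smul,
      smul_smul, smul_smul]
    try ring_nf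
  have h2 : ∫ ξ, ((∂_{v} F : 𝓢(Euc n, E)) ξ - G ξ) = -∫ ξ, G ξ := by
    rw [integral_sub (SchwartzMap.integrable _) (SchwartzMap.integrable _), h0, zero_sub]
  simp only [e] at h2
  rw [integral_smul] at h2
  simp only [← hG]
  rw [neg_smul, h2, neg_neg]

lemma lineDeriv_inner_smul (h : 𝓢(Euc n, E)) (v w ξ : Euc n) :
    (∂_{w} (SchwartzMap.smulLeftCLM E (inner ℝ · v : Euc n → ℝ) h) : 𝓢(Euc n, E)) ξ =
      (inner ℝ w v : ℝ) • h ξ + (inner ℝ ξ v : ℝ) • (∂_{w} h : 𝓢(Euc n, E)) ξ := by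
  have ht : (inner ℝ · v : Euc n → ℝ).HasTemperateGrowth := by fun_prop
  rw [SchwartzMap.lineDerivOp_apply_eq_fderiv, SchwartzMap.lineDerivOp_apply_eq_fderiv,
    SchwartzMap.smulLeftCLM_apply ht]
  have := (((innerSL ℝ).flip v).hasFDerivAt (x := ξ)).smul (h.hasFDerivAt ξ)
  simp only [ContinuousLinearMap.flip_apply, innerSL_apply_apply] at this
  change fderiv ℝ (⇑((innerSL ℝ).flip v) • (h : Euc n → E)) ξ w = _
  rw [this.fderiv, add_comm]
  rfl

/-- Integration by parts, moving two derivatives onto a power of the norm. -/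
lemma integral_norm_cpow_smul_lineDeriv_lineDeriv (s : ℂ) {r : ℝ} (hr : 0 < r) {h : 𝓢(Euc n, E)}
    (hh : VanishesNear r h) (v w : Euc n) :
    ∫ ξ, ((‖ξ‖ : ℂ) ^ s) • (∂_{v} (∂_{w} h) : 𝓢(Euc n, E)) ξ =
      s • ∫ ξ, (((‖ξ‖ : ℂ) ^ (s - 2)) • ((inner ℝ w v : ℝ) • h ξ) +
        (s - 2) • ((‖ξ‖ : ℂ) ^ (s - 4)) • ((inner ℝ ξ v * inner ℝ ξ w : ℝ) • h ξ)) := by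
  have ht : ∀ v : Euc n, (inner ℝ · v : Euc n → ℝ).HasTemperateGrowth := fun v => by fun_prop
  let k : 𝓢(Euc n, E) := SchwartzMap.smulLeftCLM E (inner ℝ · v : Euc n → ℝ) h
  have hk : VanishesNear r k := fun ξ hξ => by
    simp [k, SchwartzMap.smulLeftCLM_apply_apply (ht v), hh ξ hξ]
  have hkk : VanishesNear r (SchwartzMap.smulLeftCLM E (inner ℝ · w : Euc n → ℝ) k) := fun ξ hξ => by
    rw [SchwartzMap.smulLeftCLM_apply_apply (ht w), hk ξ hξ, smul_zero]
  obtain ⟨F1, hF1⟩ := exists_schwartz_norm_cpow_smul (s - 2) hr hh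
  obtain ⟨F2, hF2⟩ := exists_schwartz_norm_cpow_smul (s - 4) hr hkk
  obtain ⟨F3, hF3⟩ := exists_schwartz_norm_cpow_smul (s - 2) hr (hk.lineDeriv w)
  have h1 := integral_norm_cpow_smul_lineDeriv s hr (hh.lineDeriv w) v
  have h2 := integral_norm_cpow_smul_lineDeriv (s - 2) hr hk w
  rw [h1, neg_smul, ← smul_neg, ← integral_neg]
  congr 1
  have e1 : ∀ ξ, -(((‖ξ‖ : ℂ) ^ (s - 2)) • ((inner ℝ ξ v : ℝ) • (∂_{w} h : 𝓢(Euc n, E)) ξ)) =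
      (inner ℝ w v : ℝ) • F1 ξ - F3 ξ := fun ξ => by
    rw [hF3, hF1, lineDeriv_inner_smul, smul_add, smul_comm ((‖ξ‖ : ℂ) ^ (s - 2)) (inner ℝ w v : ℝ)]
    abel
  have e2 : ∀ ξ, (((‖ξ‖ : ℂ) ^ (s - 2)) • ((inner ℝ w v : ℝ) • h ξ) +
        (s - 2) • ((‖ξ‖ : ℂ) ^ (s - 4)) • ((inner ℝ ξ v * inner ℝ ξ w : ℝ) • h ξ)) =
      (inner ℝ w v : ℝ) • F1 ξ + (s - 2) • F2 ξ := fun ξ => by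
    rw [hF2, hF1, SchwartzMap.smulLeftCLM_apply_apply (ht w),
      SchwartzMap.smulLeftCLM_apply_apply (ht v), smul_smul (inner ℝ ξ w : ℝ),
      smul_comm ((‖ξ‖ : ℂ) ^ (s - 2)) (inner ℝ w v : ℝ), mul_comm (inner ℝ ξ w : ℝ)]
  simp only [e1, e2]
  have i1 : Integrable fun ξ => (inner ℝ w v : ℝ) • F1 ξ := F1.integrable.smul _
  have i2 : Integrable fun ξ => (s - 2) • F2 ξ := F2.integrable.smul _
  rw [integral_sub i1 F3.integrable, integral_add i1 i2, integral_smul (s - 2)]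
  simp only [← hF3] at h2
  rw [h2, neg_smul, sub_neg_eq_add]
  simp only [hF2, SchwartzMap.smulLeftCLM_apply_apply (ht w), show s - 2 - 2 = s - 4 by ring, k]

end

/-! ### Fourier transform of powers of the norm by Mellin transforms of Gaussians -/

noncomputable section

variable {n : ℕ} {E : Type*} [NormedAddCommGroup E] [NormedSpace ℂ E]

lemma integrable_norm_rpow_mul_schwartz [NeZero n] {s : ℝ} (hs : -(n : ℝ) < s) (f : 𝓢(Euc n, E)) :
    Integrable fun y : Euc n => ‖y‖ ^ s * ‖f y‖ := by
  have hm : AEStronglyMeasurable (fun y : Euc n => ‖y‖ ^ s * ‖f y‖) volume := by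
    have h1 : Measurable fun y : Euc n => ‖y‖ ^ s := by fun_prop
    exact h1.aestronglyMeasurable.mul f.continuous.norm.aestronglyMeasurable
  rw [← integrableOn_univ, ← union_compl_self (closedBall (0 : Euc n) 1), integrableOn_union]
  constructor
  · obtain ⟨C, hC⟩ := (isCompact_closedBall (0 : Euc n) 1).exists_bound_of_continuousOn
      f.continuous.continuousOn
    refine Integrable.mono' ((integrableOn_norm_rpow_closedBall hs).mul_const C) hm.restrict ?_
    filter_upwards [ae_restrict_mem measurableSet_closedBall] with y hy
    rw [Real.norm_of_nonneg (by positivity)]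
    gcongr
    exact hC y hy
  · obtain ⟨k, hk⟩ := exists_nat_ge s
    refine Integrable.mono' (f.integrable_pow_mul volume k).integrableOn hm.restrict ?_
    filter_upwards [ae_restrict_mem measurableSet_closedBall.compl] with y hy
    have hy1 : 1 ≤ ‖y‖ := by
      have : ¬ ‖y‖ ≤ 1 := by simpa using hy
      linarith
    rw [Real.norm_of_nonneg (by positivity), ← Real.rpow_natCast]
    gcongr

/-- The pairing with a Gaussian. -/
def gaussPairing (f : Euc n → E) (t : ℝ) : E :=
  ∫ y, Complex.exp (-((Real.pi * ‖y‖ ^ 2 : ℝ) * t)) • f y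

lemma norm_cpow_mul_gauss (a : ℂ) {t : ℝ} (ht : 0 < t) (y : Euc n) :
    ‖(t : ℂ) ^ (a - 1) * Complex.exp (-((Real.pi * ‖y‖ ^ 2 : ℝ) * t))‖ =
      t ^ (a.re - 1) * Real.exp (-((Real.pi * ‖y‖ ^ 2) * t)) := by
  rw [norm_mul, Complex.norm_cpow_eq_rpow_re_of_pos ht, Complex.norm_exp]
  norm_cast

lemma inv_mul_norm_sq_rpow {c : ℝ} (hc : 0 < c) (a : ℝ) (y : Euc n) :
    (1 / (c * ‖y‖ ^ 2)) ^ a = c ^ (-a) * ‖y‖ ^ (-2 * a) := by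
  rw [one_div, ← Real.rpow_neg_eq_inv_rpow, Real.mul_rpow hc.le (by positivity),
    ← Real.rpow_natCast, ← Real.rpow_mul (norm_nonneg _)]
  push_cast
  ring_nf

/-- Integrating the absolute value in t first gives a constant times |y|^(-2 Re a) |f(y)|. The
condition Re a > 0 makes the t-integral finite, and 2 Re a < n makes the singularity at y = 0
integrable. -/
lemma integrable_cpow_mul_gauss [NeZero n] {a : ℂ} (ha : 0 < a.re) (han : 2 * a.re < n)
    (f : 𝓢(Euc n, E)) :
    Integrable (fun z : ℝ × Euc n => ((z.1 : ℂ) ^ (a - 1) *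
      Complex.exp (-((Real.pi * ‖z.2‖ ^ 2 : ℝ) * z.1))) • f z.2)
      ((volume.restrict (Ioi 0)).prod volume) := by
  have hm : AEStronglyMeasurable (fun z : ℝ × Euc n => ((z.1 : ℂ) ^ (a - 1) *
      Complex.exp (-((Real.pi * ‖z.2‖ ^ 2 : ℝ) * z.1))) • f z.2)
      ((volume.restrict (Ioi 0)).prod volume) := by
    refine AEStronglyMeasurable.smul ?_ (f.continuous.comp continuous_snd).aestronglyMeasurable
    have : Measurable fun z : ℝ × Euc n => ((z.1 : ℂ) ^ (a - 1) *
      Complex.exp (-((Real.pi * ‖z.2‖ ^ 2 : ℝ) * z.1))) := by fun_prop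
    exact this.aestronglyMeasurable
  have hne : ∀ᵐ y : Euc n, y ≠ 0 := by simp [ae_iff]
  have hval : ∀ y : Euc n, y ≠ 0 → (∀ᵐ t : ℝ ∂(volume.restrict (Ioi (0 : ℝ))), ‖((t : ℂ) ^ (a - 1) *
      Complex.exp (-((Real.pi * ‖y‖ ^ 2 : ℝ) * t))) • f y‖ =
        (t ^ (a.re - 1) * Real.exp (-((Real.pi * ‖y‖ ^ 2) * t))) * ‖f y‖) := fun y hy => by
    filter_upwards [ae_restrict_mem measurableSet_Ioi] with t ht
    rw [norm_smul, norm_cpow_mul_gauss a ht]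
  have hpos : ∀ y : Euc n, y ≠ 0 → 0 < Real.pi * ‖y‖ ^ 2 := fun y hy => by
    have := norm_pos_iff.2 hy
    positivity
  refine (integrable_prod_iff' hm).2 ⟨?_, ?_⟩
  · filter_upwards [hne] with y hy
    have h1 := integrableOn_rpow_mul_exp_neg_mul_rpow (s := a.re - 1) (by linarith) one_pos (hpos y hy)
    simp only [Real.rpow_one] at h1
    refine Integrable.mono' (g := fun t : ℝ => (t ^ (a.re - 1) *
      Real.exp (-((Real.pi * ‖y‖ ^ 2) * t))) * ‖f y‖) ?_ ?_ ?_
    · refine Integrable.mul_const ?_ _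
      simpa [IntegrableOn, neg_mul] using h1
    · refine AEStronglyMeasurable.smul ?_ aestronglyMeasurable_const
      have : Measurable fun t : ℝ => ((t : ℂ) ^ (a - 1) *
        Complex.exp (-((Real.pi * ‖y‖ ^ 2 : ℝ) * t))) := by fun_prop
      exact this.aestronglyMeasurable
    · filter_upwards [hval y hy] with t ht using ht.le
  · have h2 := (integrable_norm_rpow_mul_schwartz (s := -2 * a.re) (by linarith) f).const_mul
      (Real.pi ^ (-a.re) * Real.Gamma a.re)
    refine h2.congr ?_
    filter_upwards [hne] with y hy
    rw [integral_congr_ae (hval y hy), integral_mul_const,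
      Real.integral_rpow_mul_exp_neg_mul_Ioi ha (hpos y hy), inv_mul_norm_sq_rpow Real.pi_pos]
    ring

variable [CompleteSpace E]

/-- By Fubini, from ∫ t^(a-1) exp(-π|y|²t) dt = π^(-a) Γ(a) |y|^(-2a). -/
lemma mellin_gaussPairing [NeZero n] {a : ℂ} (ha : 0 < a.re) (han : 2 * a.re < n)
    (f : 𝓢(Euc n, E)) :
    mellin (gaussPairing f) a =
      ((Real.pi : ℂ) ^ (-a) * Complex.Gamma a) • ∫ y, ((‖y‖ : ℂ) ^ (-2 * a)) • f y := by
  have h1 : mellin (gaussPairing f) a = ∫ t in Ioi (0 : ℝ), ∫ y : Euc n, ((t : ℂ) ^ (a - 1) *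
      Complex.exp (-((Real.pi * ‖y‖ ^ 2 : ℝ) * t))) • f y := by
    simp only [mellin, gaussPairing, mul_smul, integral_smul]
  rw [h1, integral_integral_swap (integrable_cpow_mul_gauss ha han f), ← integral_smul]
  have hne : ∀ᵐ y : Euc n, y ≠ 0 := by simp [ae_iff]
  refine integral_congr_ae ?_
  filter_upwards [hne] with y hy
  have h0 := norm_pos_iff.2 hy
  have hpos : 0 < Real.pi * ‖y‖ ^ 2 := by positivity
  rw [integral_smul_const, Complex.integral_cpow_mul_exp_neg_mul_Ioi ha hpos, smul_smul]
  congr 1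
  have e : (1 / ((Real.pi * ‖y‖ ^ 2 : ℝ) : ℂ)) ^ a = (Real.pi : ℂ) ^ (-a) * (‖y‖ : ℂ) ^ (-2 * a) := by
    rw [one_div, ← Complex.ofReal_inv, mul_inv, Complex.ofReal_mul,
      Complex.mul_cpow_ofReal_nonneg (by positivity) (by positivity)]
    have h2 : ∀ {x : ℝ}, 0 < x → ∀ b : ℂ, (((x⁻¹ : ℝ)) : ℂ) ^ b = (x : ℂ) ^ (-b) := fun {x} hx b => by
      have hx' : (x : ℂ) ≠ 0 := by exact_mod_cast hx.ne'
      rw [Complex.cpow_def_of_ne_zero (by exact_mod_cast (inv_pos.2 hx).ne'),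
        Complex.cpow_def_of_ne_zero hx', ← Complex.ofReal_log (inv_pos.2 hx).le,
        ← Complex.ofReal_log hx.le, Real.log_inv]
      push_cast
      ring_nf
    rw [h2 Real.pi_pos, h2 (by positivity)]
    congr 1
    rw [Complex.cpow_def_of_ne_zero (by exact_mod_cast (pow_pos h0 2).ne'),
      Complex.cpow_def_of_ne_zero (by exact_mod_cast h0.ne'), ← Complex.ofReal_log (by positivity),
      ← Complex.ofReal_log h0.le, Real.log_pow]
    push_cast
    ring_nf
  rw [e]
  ring

lemma integrable_gauss (n : ℕ) {b : ℝ} (hb : 0 < b) :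
    Integrable fun v : Euc n => Complex.exp (-(b : ℂ) * ‖v‖ ^ 2) := by
  simpa using GaussianFourier.integrable_cexp_neg_mul_sq_norm_add (V := Euc n) (b := (b : ℂ))
    (by simpa using hb) 0 0

/-- The Fourier transform of exp(-π|v|²/t) is t^(n/2) exp(-πt|y|²); moving the transform across the
integral exchanges f and its transform. On Mellin transforms this is the reflection a ↦ n/2 - a. -/
lemma gaussPairing_eq_fourier (f : 𝓢(Euc n, E)) {t : ℝ} (ht : 0 < t) :
    gaussPairing f t = ((t : ℂ) ^ (-(n : ℂ) / 2)) • gaussPairing (𝓕 f : 𝓢(Euc n, E)) t⁻¹ := by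
  have hb : 0 < Real.pi / t := by positivity
  have ht' : (t : ℂ) ≠ 0 := by exact_mod_cast ht.ne'
  have hpi : (Real.pi : ℂ) ≠ 0 := by exact_mod_cast Real.pi_ne_zero
  have hflip := VectorFourier.integral_fourierIntegral_smul_eq_flip (L := innerₗ (Euc n))
    Real.continuous_fourierChar continuous_inner (integrable_gauss n hb)
    (f.integrable (μ := volume))
  have e1 : ∀ y : Euc n, 𝓕 (fun v : Euc n => Complex.exp (-((Real.pi / t : ℝ) : ℂ) * ‖v‖ ^ 2)) y =
      (t : ℂ) ^ ((n : ℂ) / 2) * Complex.exp (-((Real.pi * ‖y‖ ^ 2 : ℝ) * t)) := fun y => by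
    rw [fourier_gaussian_innerProductSpace (by simpa using hb)]
    push_cast
    rw [finrank_euclideanSpace_fin, show (Real.pi : ℂ) / (Real.pi / t) = t by field_simp]
    congr 2
    field_simp
  have e2 : ∫ y, ((t : ℂ) ^ ((n : ℂ) / 2) * Complex.exp (-((Real.pi * ‖y‖ ^ 2 : ℝ) * t))) • f y =
      ∫ y, Complex.exp (-((Real.pi / t : ℝ) : ℂ) * ‖y‖ ^ 2) • (𝓕 f : 𝓢(Euc n, E)) y := by
    simp only [← e1]
    simpa using! hflip
  rw [gaussPairing, gaussPairing]
  simp only [mul_smul, integral_smul] at e2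
  have e3 : ∀ y : Euc n, Complex.exp (-((Real.pi * ‖y‖ ^ 2 : ℝ) * (t⁻¹ : ℝ))) =
      Complex.exp (-((Real.pi / t : ℝ) : ℂ) * ‖y‖ ^ 2) := fun y => by
    congr 1
    push_cast
    ring
  simp only [e3]
  rw [← e2, smul_smul, ← Complex.cpow_add _ _ ht', neg_div, neg_add_cancel, Complex.cpow_zero,
    one_smul]

/-- The Fourier transform of a power of the norm, tested against a Schwartz function. -/
lemma integral_norm_cpow_smul_schwartz [NeZero n] {a : ℂ} (ha : 0 < a.re) (han : 2 * a.re < n)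
    (f : 𝓢(Euc n, E)) :
    ((Real.pi : ℂ) ^ (-a) * Complex.Gamma a) • ∫ y, ((‖y‖ : ℂ) ^ (-2 * a)) • f y =
      ((Real.pi : ℂ) ^ (a - (n : ℂ) / 2) * Complex.Gamma ((n : ℂ) / 2 - a)) •
        ∫ ξ, ((‖ξ‖ : ℂ) ^ (2 * a - n)) • (𝓕 f : 𝓢(Euc n, E)) ξ := by
  have h1 := mellin_gaussPairing ha han f
  have h2 := mellin_gaussPairing (a := (n : ℂ) / 2 - a) (by simp; linarith) (by simp; linarith)
    (𝓕 f : 𝓢(Euc n, E))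
  have h3 : mellin (gaussPairing f) a =
      mellin (fun t => ((t : ℂ) ^ (-(n : ℂ) / 2)) • gaussPairing (𝓕 f : 𝓢(Euc n, E)) t⁻¹) a :=
    setIntegral_congr_fun measurableSet_Ioi fun t ht => by
      simp only [gaussPairing_eq_fourier f ht]
  rw [← h1, h3, mellin_cpow_smul, mellin_comp_inv (gaussPairing (𝓕 f : 𝓢(Euc n, E))),
    show -(a + -(n : ℂ) / 2) = (n : ℂ) / 2 - a by ring, h2]
  ring_nf

end

/-! ### Holomorphic dependence on the exponent -/

noncomputable section

variable {n : ℕ} {E : Type*} [NormedAddCommGroup E] [NormedSpace ℂ E]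

/-- A logarithm costs an arbitrarily small power, upwards for r ≥ 1 and downwards for r ≤ 1. This
dominates the s-derivative of r^s uniformly in s. -/
lemma abs_log_mul_rpow_le {r σ a b δ : ℝ} (hr : 0 < r) (hδ : 0 < δ) (ha : a ≤ σ - δ)
    (hb : σ + δ ≤ b) : |Real.log r| * r ^ σ ≤ δ⁻¹ * (r ^ a + r ^ b) := by
  have pa := Real.rpow_pos_of_pos hr a
  have pb := Real.rpow_pos_of_pos hr b
  have pσ := Real.rpow_pos_of_pos hr σ
  rcases le_total 1 r with h | h
  · rw [abs_of_nonneg (Real.log_nonneg h)]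
    calc Real.log r * r ^ σ ≤ (r ^ δ / δ) * r ^ σ := by
          gcongr; exact Real.log_le_rpow_div hr.le hδ
      _ = δ⁻¹ * r ^ (σ + δ) := by rw [Real.rpow_add hr]; ring
      _ ≤ δ⁻¹ * (r ^ a + r ^ b) := by
          have := Real.rpow_le_rpow_of_exponent_le h hb
          gcongr
          linarith
  · rw [abs_of_nonpos (Real.log_nonpos hr.le h), ← Real.log_inv]
    calc Real.log r⁻¹ * r ^ σ ≤ ((r⁻¹) ^ δ / δ) * r ^ σ := by
          gcongr; exact Real.log_le_rpow_div (by positivity) hδ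
      _ = δ⁻¹ * r ^ (σ - δ) := by
          rw [Real.rpow_sub hr, Real.inv_rpow hr.le]
          field_simp
      _ ≤ δ⁻¹ * (r ^ a + r ^ b) := by
          have := Real.rpow_le_rpow_of_exponent_ge hr h ha
          gcongr
          linarith

/-- Dominated differentiation between two exponents for which the integral converges. The condition
G 0 = 0 removes the base 0, where s ↦ 0^s is not continuous. -/
lemma differentiableAt_integral_norm_cpow {ν : Measure (Euc n)} {G : Euc n → E} (hG0 : G 0 = 0)
    (hGm : AEStronglyMeasurable G ν) {a b : ℝ}
    (ha : Integrable (fun y => ‖y‖ ^ a * ‖G y‖) ν) (hb : Integrable (fun y => ‖y‖ ^ b * ‖G y‖) ν)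
    {s : ℂ} (has : a < s.re) (hsb : s.re < b) :
    DifferentiableAt ℂ (fun s : ℂ => ∫ y, ((‖y‖ : ℂ) ^ s) • G y ∂ν) s := by
  obtain ⟨δ, hδ, h1, h2⟩ : ∃ δ : ℝ, 0 < δ ∧ a ≤ s.re - 2 * δ ∧ s.re + 2 * δ ≤ b := by
    refine ⟨min (s.re - a) (b - s.re) / 2, ?_, ?_, ?_⟩
    · have : 0 < min (s.re - a) (b - s.re) := lt_min (by linarith) (by linarith)
      positivity
    · have := min_le_left (s.re - a) (b - s.re)
      linarith
    · have := min_le_right (s.re - a) (b - s.re)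
      linarith
  have hball : ∀ z ∈ ball s δ, a ≤ z.re - δ ∧ z.re + δ ≤ b := fun z hz => by
    have h3 : |(z - s).re| < δ := (Complex.abs_re_le_norm _).trans_lt (by
      rw [← dist_eq_norm]; exact hz)
    rw [Complex.sub_re, abs_lt] at h3
    constructor <;> linarith
  have hm : ∀ z : ℂ, AEStronglyMeasurable (fun y => ((‖y‖ : ℂ) ^ z) • G y) ν := fun z => by
    have : Measurable (fun y : Euc n => ((‖y‖ : ℂ) ^ z)) := by fun_prop
    exact this.aestronglyMeasurable.smul hGm
  refine (hasDerivAt_integral_of_dominated_loc_of_deriv_le (μ := ν) (s := ball s δ)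
    (F := fun (s : ℂ) y => ((‖y‖ : ℂ) ^ s) • G y)
    (F' := fun (s : ℂ) y => ((‖y‖ : ℂ) ^ s * Complex.log ‖y‖) • G y)
    (bound := fun y => δ⁻¹ * (‖y‖ ^ a * ‖G y‖ + ‖y‖ ^ b * ‖G y‖))
    (ball_mem_nhds s hδ) (Eventually.of_forall hm) ?_ ?_ ?_ ((ha.add hb).const_mul _)
    ?_).2.differentiableAt
  · refine Integrable.mono' (ha.add hb) (hm s) (Eventually.of_forall fun y => ?_)
    rcases eq_or_ne y 0 with rfl | hy
    · simp [hG0]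
    · have h0 := norm_pos_iff.2 hy
      simp only [Pi.add_apply]
      rw [norm_smul, Complex.norm_cpow_eq_rpow_re_of_pos h0, ← add_mul]
      gcongr
      rcases le_total 1 ‖y‖ with h | h
      · have := Real.rpow_le_rpow_of_exponent_le h hsb.le
        have := Real.rpow_pos_of_pos h0 a
        linarith
      · have := Real.rpow_le_rpow_of_exponent_ge h0 h has.le
        have := Real.rpow_pos_of_pos h0 b
        linarith
  · have : Measurable (fun y : Euc n => ((‖y‖ : ℂ) ^ s * Complex.log ‖y‖)) := by fun_prop
    exact this.aestronglyMeasurable.smul hGm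
  · refine Eventually.of_forall fun y z hz => ?_
    rcases eq_or_ne y 0 with rfl | hy
    · simp [hG0]
    · have h0 := norm_pos_iff.2 hy
      rw [norm_smul, norm_mul, Complex.norm_cpow_eq_rpow_re_of_pos h0, ← Complex.ofReal_log h0.le,
        Complex.norm_real, Real.norm_eq_abs, ← add_mul, ← mul_assoc, mul_comm (‖y‖ ^ z.re)]
      exact mul_le_mul_of_nonneg_right
        (abs_log_mul_rpow_le h0 hδ (hball z hz).1 (hball z hz).2) (norm_nonneg _)
  · refine Eventually.of_forall fun y z hz => ?_
    rcases eq_or_ne y 0 with rfl | hy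
    · simpa [hG0] using hasDerivAt_const z (0 : E)
    · have h0 : (‖y‖ : ℂ) ≠ 0 := by exact_mod_cast (norm_pos_iff.2 hy).ne'
      have := ((hasDerivAt_id z).const_cpow (c := (‖y‖ : ℂ)) (Or.inl h0)).smul_const (G y)
      simpa using this

variable (q : Fin n → Fin n → E →L[ℂ] E)

lemma differentiableAt_integral_homKernel {ν : Measure (Euc n)} {φ : Euc n → E}
    (hφ : AEStronglyMeasurable φ ν) {a b : ℝ}
    (ha : Integrable (fun y => homKernel q a y (φ y)) ν)
    (hb : Integrable (fun y => homKernel q b y (φ y)) ν)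
    {μ : ℂ} (haμ : a < μ.re) (hμb : μ.re < b) :
    DifferentiableAt ℂ (fun μ : ℂ => ∫ y, homKernel q μ y (φ y) ∂ν) μ := by
  have hG0 : (fun y => quad q y (φ y)) 0 = 0 := by simp [quad_zero]
  have hGm : AEStronglyMeasurable (fun y => quad q y (φ y)) ν :=
    isBoundedBilinearMap_apply.continuous.comp_aestronglyMeasurable₂
      (continuous_quad q).aestronglyMeasurable hφ
  have hc : ∀ c : ℝ, Integrable (fun y => homKernel q c y (φ y)) ν →
      Integrable (fun y => ‖y‖ ^ (c - 2) * ‖quad q y (φ y)‖) ν := fun c h => by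
    refine h.norm.congr (Eventually.of_forall fun y => ?_)
    rcases eq_or_ne y 0 with rfl | hy
    · simp [homKernel, quad_zero]
    · simp only [homKernel, _root_.smul_apply, norm_smul]
      rw [Complex.norm_cpow_eq_rpow_re_of_pos (norm_pos_iff.2 hy)]
      simp
  have h := differentiableAt_integral_norm_cpow hG0 hGm (hc a ha) (hc b hb) (s := μ - 2)
    (by simpa using haμ) (by simpa using hμb)
  exact h.comp (f := fun μ : ℂ => μ - 2) μ (by fun_prop)

lemma pairingAdmissible_of_schwartz [NeZero n] (μ : ℂ) (ψ : 𝓢(Euc n, E)) :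
    PairingAdmissible q μ ψ := by
  have := pairingAdmissible_schwartz q μ
    (SchwartzMap.compCLMOfContinuousLinearEquiv ℂ (ContinuousLinearEquiv.neg ℝ) ψ) 0
  simpa using this

lemma integral_closedBall_homKernel_taylorPart_of_odd [NeZero n] (ψ : Euc n → E) {j : ℕ} (hj : Odd j) :
    ∫ y in closedBall (0 : Euc n) 1, homKernel q 0 y (taylorPart ψ j y) = 0 := by
  have hset : closedBall (0 : Euc n) 1 = {y : Euc n | ‖y‖ ∈ Iic (1 : ℝ)} := by
    ext y; simp
  rw [hset]
  refine integral_radial_odd (fun y => ?_) measurableSet_Iic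
  rw [homKernel_neg, ← neg_one_smul ℝ y, taylorPart_smul_arg, hj.neg_one_pow, neg_one_smul, map_neg]

/-- With N fixed, the two integrals are differentiable by domination. The rational coefficients can
only be singular where μ+n+j = 0; there j is odd, and the integral they multiply vanishes by parity.
-/
lemma differentiableAt_regPairing [NeZero n] {N : ℕ} {μ : ℂ} (hμ : ¬ IsRieszPole n μ)
    (hN : -(n : ℝ) < μ.re + N) (ψ : 𝓢(Euc n, E)) :
    DifferentiableAt ℂ (fun μ => regPairing q N μ ψ) μ := by
  unfold regPairing
  refine DifferentiableAt.add (DifferentiableAt.add ?_ ?_) ?_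
  · exact differentiableAt_integral_homKernel q (a := μ.re - 1) (b := μ.re + 1)
      ψ.continuous.aestronglyMeasurable (pairingAdmissible_of_schwartz q _ ψ).2
      (pairingAdmissible_of_schwartz q _ ψ).2 (by linarith) (by linarith)
  · obtain ⟨a, ha1, ha2⟩ := exists_between (show -(n : ℝ) - N < μ.re by linarith)
    refine differentiableAt_integral_homKernel q (a := a) (b := μ.re + 1)
      (aestronglyMeasurable_sub_taylorPart (ψ.smooth ⊤) N)
      (integrableOn_homKernel_sub_taylorPart q (ψ.smooth ⊤) ?_)
      (integrableOn_homKernel_sub_taylorPart q (ψ.smooth ⊤) ?_) ha2 (by linarith)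
    · simp; linarith
    · simp; linarith
  · refine DifferentiableAt.fun_sum fun j _ => ?_
    by_cases hj : μ + n + j = 0
    · have hodd : Odd j := by
        by_contra h
        obtain ⟨k, rfl⟩ := Nat.not_odd_iff_even.1 h
        exact hμ ⟨k, by push_cast at hj; linear_combination hj⟩
      simp [integral_closedBall_homKernel_taylorPart_of_odd q ψ hodd]
    · have h1 : DifferentiableAt ℂ (fun μ : ℂ => ((n : ℂ) + j) / (μ + n + j)) μ :=
        (differentiableAt_const _).div ((differentiableAt_id.add_const _).add_const _) hj
      exact h1.smul_const _

/-- The poles are the zeros of an entire function, so they form a closed set. -/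
lemma isRieszPole_iff (n : ℕ) (μ : ℂ) :
    IsRieszPole n μ ↔ (Complex.Gamma ((μ + n) / 2))⁻¹ = 0 := by
  rw [inv_eq_zero, Complex.Gamma_eq_zero_iff]
  refine exists_congr fun k => ⟨fun h => ?_, fun h => ?_⟩
  · rw [h]; ring
  · linear_combination 2 * h

lemma isOpen_not_isRieszPole (n : ℕ) : IsOpen {μ : ℂ | ¬ IsRieszPole n μ} := by
  simp only [isRieszPole_iff]
  have hc : Continuous fun μ : ℂ => (Complex.Gamma ((μ + n) / 2))⁻¹ :=
    Complex.differentiable_one_div_Gamma.continuous.comp (by fun_prop)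
  exact isOpen_ne_fun hc continuous_const

lemma isPreconnected_not_isRieszPole (n : ℕ) : IsPreconnected {μ : ℂ | ¬ IsRieszPole n μ} := by
  have hc : {μ : ℂ | IsRieszPole n μ}.Countable := by
    have : {μ : ℂ | IsRieszPole n μ} = range fun k : ℕ => -(n : ℂ) - 2 * (k : ℂ) := by
      ext μ
      simp [IsRieszPole, eq_comm]
    rw [this]
    exact countable_range _
  have h : 1 < Module.rank ℝ ℂ := by simp
  exact (hc.isPathConnected_compl_of_one_lt_rank h).isConnected.isPreconnected

lemma differentiableOn_regPairing_taylorOrder [NeZero n] (ψ : 𝓢(Euc n, E)) :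
    DifferentiableOn ℂ (fun μ => regPairing q (taylorOrder n μ) μ ψ)
      {μ : ℂ | ¬ IsRieszPole n μ} := fun μ hμ => by
  have hN := neg_lt_re_add_taylorOrder n μ
  refine (DifferentiableAt.congr_of_eventuallyEq (differentiableAt_regPairing q hμ hN ψ)
    ?_).differentiableWithinAt
  -- The number of Taylor terms is frozen at its value at μ, which remains sufficient nearby.
  have : ∀ᶠ z : ℂ in 𝓝 μ, -(n : ℝ) < z.re + taylorOrder n μ :=
    (isOpen_lt continuous_const (by fun_prop)).mem_nhds hN
  filter_upwards [this] with z hz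
  exact (regPairing_eq_taylorOrder q hz (ψ.smooth ⊤)).symm

lemma integrable_homKernel_of_vanishesNear (μ : ℂ) {r : ℝ} (hr : 0 < r) {h : 𝓢(Euc n, E)}
    (hh : VanishesNear r h) : Integrable fun ξ => homKernel q μ ξ (h ξ) := by
  obtain ⟨F, hF⟩ := exists_schwartz_norm_cpow_smul μ hr hh
  refine Integrable.mono' (F.integrable.norm.const_mul (quadBound q))
    (aestronglyMeasurable_homKernel_apply q μ h.continuous.aestronglyMeasurable)
    (Eventually.of_forall fun ξ => ?_)
  rcases eq_or_ne ξ 0 with rfl | hξ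
  · simp only [homKernel, quad_zero, smul_zero, _root_.zero_apply, norm_zero]
    exact mul_nonneg (quadBound_nonneg q) (norm_nonneg _)
  · rw [hF, norm_smul, Complex.norm_cpow_eq_rpow_re_of_pos (norm_pos_iff.2 hξ), ← mul_assoc]
    exact norm_homKernel_apply_le q μ ξ _

/-- The coefficient of the Fourier transform of the kernel. -/
def fourierCoef (n : ℕ) (μ : ℂ) : ℂ :=
  (1 / 2) * (Real.pi : ℂ) ^ (-μ - (n : ℂ) / 2) * Complex.Gamma ((μ + n) / 2) *
    (Complex.Gamma (1 - μ / 2))⁻¹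

/-- The coefficients of the quadratic form `|y|² tr q`. -/
def traceCoeff (i j : Fin n) : E →L[ℂ] E := if i = j then ∑ k, q k k else 0

/-- The Fourier transform of the kernel, away from the origin. -/
def fourierSymbol (μ : ℂ) (ξ : Euc n) : E →L[ℂ] E :=
  fourierCoef n μ • (homKernel (traceCoeff q) (-μ - n) ξ - (μ + n) • homKernel q (-μ - n) ξ)

lemma quad_traceCoeff (ξ : Euc n) : quad (traceCoeff q) ξ = ((‖ξ‖ : ℂ) ^ 2) • ∑ k, q k k := by
  have h : ((‖ξ‖ : ℂ) ^ 2) = ∑ i, ((ξ i * ξ i : ℝ) : ℂ) := by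
    rw [← Complex.ofReal_pow, EuclideanSpace.norm_sq_eq, Complex.ofReal_sum]
    simp [sq]
  rw [h, Finset.sum_smul]
  simp [quad, traceCoeff]

lemma differentiableAt_fourierCoef {μ : ℂ} (hμ : ¬ IsRieszPole n μ) :
    DifferentiableAt ℂ (fourierCoef n) μ := by
  have hpi : (Real.pi : ℂ) ≠ 0 := by exact_mod_cast Real.pi_ne_zero
  have h1 : DifferentiableAt ℂ (fun μ : ℂ => (Real.pi : ℂ) ^ (-μ - (n : ℂ) / 2)) μ :=
    DifferentiableAt.const_cpow (by fun_prop) (Or.inl hpi)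
  have h2 : DifferentiableAt ℂ (fun μ : ℂ => Complex.Gamma ((μ + n) / 2)) μ := by
    refine DifferentiableAt.comp μ (Complex.differentiableAt_Gamma _ fun m hm => hμ ⟨m, ?_⟩)
      (by fun_prop)
    linear_combination 2 * hm
  have h3 : DifferentiableAt ℂ (fun μ : ℂ => (Complex.Gamma (1 - μ / 2))⁻¹) μ :=
    (Complex.differentiable_one_div_Gamma _).comp (f := fun μ : ℂ => 1 - μ / 2) μ (by fun_prop)
  unfold fourierCoef
  exact ((h1.const_mul _).mul h2).mul h3

lemma fourierSymbol_apply (μ : ℂ) (ξ : Euc n) (η : E) :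
    fourierSymbol q μ ξ η = fourierCoef n μ • (homKernel (traceCoeff q) (-μ - n) ξ η -
      (μ + n) • homKernel q (-μ - n) ξ η) := by
  simp [fourierSymbol]

lemma integral_fourierSymbol (μ : ℂ) {r : ℝ} (hr : 0 < r) {h : 𝓢(Euc n, E)}
    (hh : VanishesNear r h) : ∫ ξ, fourierSymbol q μ ξ (h ξ) =
      fourierCoef n μ • ((∫ ξ, homKernel (traceCoeff q) (-μ - n) ξ (h ξ)) -
        (μ + n) • ∫ ξ, homKernel q (-μ - n) ξ (h ξ)) := by
  simp only [fourierSymbol_apply]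
  have i2 : Integrable fun ξ => (μ + n) • homKernel q (-μ - n) ξ (h ξ) :=
    (integrable_homKernel_of_vanishesNear q _ hr hh).smul _
  rw [integral_smul, integral_sub (integrable_homKernel_of_vanishesNear _ _ hr hh) i2,
    integral_smul]

lemma differentiableAt_integral_fourierSymbol {μ : ℂ} (hμ : ¬ IsRieszPole n μ) {r : ℝ} (hr : 0 < r)
    {h : 𝓢(Euc n, E)} (hh : VanishesNear r h) :
    DifferentiableAt ℂ (fun μ => ∫ ξ, fourierSymbol q μ ξ (h ξ)) μ := by
  simp only [integral_fourierSymbol q _ hr hh]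
  have key : ∀ q : Fin n → Fin n → E →L[ℂ] E,
      DifferentiableAt ℂ (fun μ : ℂ => ∫ ξ, homKernel q (-μ - n) ξ (h ξ)) μ := fun q => by
    have h1 := differentiableAt_integral_homKernel q (a := (-μ - n).re - 1) (b := (-μ - n).re + 1)
      (μ := -μ - n) (ν := volume) h.continuous.aestronglyMeasurable
      (integrable_homKernel_of_vanishesNear q _ hr hh)
      (integrable_homKernel_of_vanishesNear q _ hr hh) (by linarith) (by linarith)
    exact h1.comp (f := fun μ : ℂ => -μ - n) μ (by fun_prop)
  exact (differentiableAt_fourierCoef hμ).smul ((key _).sub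
    (DifferentiableAt.smul (by fun_prop) (key _)))

end

/-! ### Fourier transform of the regularized kernel -/

noncomputable section

variable {n : ℕ} {E : Type*} [NormedAddCommGroup E] [NormedSpace ℂ E]

lemma inner_single_one_right (x : Euc n) (i : Fin n) :
    inner ℝ x (EuclideanSpace.single i (1 : ℝ)) = x i := by
  simpa using EuclideanSpace.inner_single_right i (1 : ℝ) x

/-- Multiplication of a Schwartz function by the `i`-th coordinate. -/
def coordMulCLM (i : Fin n) : 𝓢(Euc n, E) →L[ℂ] 𝓢(Euc n, E) :=
  SchwartzMap.smulLeftCLM E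
    (fun x : Euc n => ((inner ℝ x (EuclideanSpace.single i (1 : ℝ)) : ℝ) : ℂ))

lemma coordMulCLM_apply (i : Fin n) (f : 𝓢(Euc n, E)) (x : Euc n) :
    coordMulCLM i f x = x i • f x := by
  have ht : (fun x : Euc n =>
      ((inner ℝ x (EuclideanSpace.single i (1 : ℝ)) : ℝ) : ℂ)).HasTemperateGrowth := by
    fun_prop
  rw [coordMulCLM, SchwartzMap.smulLeftCLM_apply_apply ht, inner_single_one_right, Complex.coe_smul]

variable [CompleteSpace E]

lemma fourier_coordMulCLM (i : Fin n) (f : 𝓢(Euc n, E)) :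
    (∂_{(EuclideanSpace.single i (1 : ℝ) : Euc n)} (𝓕 f) : 𝓢(Euc n, E)) =
      (-(2 * Real.pi * Complex.I)) • 𝓕 (coordMulCLM i f) := by
  have ht : (fun x : Euc n => inner ℝ x (EuclideanSpace.single i (1 : ℝ))).HasTemperateGrowth := by
    fun_prop
  rw [SchwartzMap.lineDerivOp_fourier_eq, FourierTransform.fourier_smul]
  congr 2
  ext x
  rw [coordMulCLM_apply, SchwartzMap.smulLeftCLM_apply_apply ht, inner_single_one_right]

lemma fourier_coordMulCLM_coordMulCLM (i j : Fin n) (f : 𝓢(Euc n, E)) :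
    𝓕 (coordMulCLM i (coordMulCLM j f)) = (-(1 / (4 * Real.pi ^ 2)) : ℂ) •
      (∂_{(EuclideanSpace.single i (1 : ℝ) : Euc n)}
        (∂_{(EuclideanSpace.single j (1 : ℝ) : Euc n)} (𝓕 f)) : 𝓢(Euc n, E)) := by
  have hpi : (Real.pi : ℂ) ≠ 0 := by exact_mod_cast Real.pi_ne_zero
  rw [fourier_coordMulCLM, ← FourierTransform.fourier_smul, fourier_coordMulCLM, map_smul,
    FourierTransform.fourier_smul, smul_smul, smul_smul]
  have : (-(1 / (4 * Real.pi ^ 2)) : ℂ) * (-(2 * Real.pi * Complex.I) * -(2 * Real.pi * Complex.I))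
      = 1 := by
    field_simp
    rw [Complex.I_sq]
    ring
  rw [mul_assoc, this, one_smul]

variable [NeZero n]

/-- The formula for |y|^(-2a) with a = 1 - μ/2 is applied to y_i y_j ψ; the strip is 0 < 2 Re a < n.
The coordinates become second derivatives of the transform, which are moved onto |ξ|^(2-μ-n). This
is legitimate because the transform vanishes near 0. -/
lemma integral_norm_cpow_smul_coord_coord {μ : ℂ} (h1 : 2 - (n : ℝ) < μ.re) (h2 : μ.re < 2)
    (ψ : 𝓢(Euc n, E)) {r : ℝ} (hr : 0 < r) (hψ : VanishesNear r (𝓕 ψ : 𝓢(Euc n, E)))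
    (i j : Fin n) :
    ∫ y, ((‖y‖ : ℂ) ^ (μ - 2)) • ((y i * y j) • ψ y) =
      fourierCoef n μ • ∫ ξ, ((‖ξ‖ : ℂ) ^ (-μ - n - 2)) •
        ((((if i = j then (‖ξ‖ : ℂ) ^ 2 else 0) - (μ + n) * (ξ i * ξ j : ℝ)) •
          (𝓕 ψ : 𝓢(Euc n, E)) ξ)) := by
  have hpi : (Real.pi : ℂ) ≠ 0 := by exact_mod_cast Real.pi_ne_zero
  have hR := integral_norm_cpow_smul_schwartz (a := 1 - μ / 2) (by simp; linarith)
    (by simp; linarith) (coordMulCLM i (coordMulCLM j ψ))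
  rw [fourier_coordMulCLM_coordMulCLM] at hR
  simp only [coordMulCLM_apply, _root_.smul_apply, show -2 * (1 - μ / 2) = μ - 2 by ring] at hR
  have hI := integral_norm_cpow_smul_lineDeriv_lineDeriv (2 * (1 - μ / 2) - n) hr hψ
    (EuclideanSpace.single i (1 : ℝ)) (EuclideanSpace.single j (1 : ℝ))
  simp only [smul_comm _ (-(1 / (4 * Real.pi ^ 2)) : ℂ)] at hR
  rw [integral_smul, hI, smul_smul, smul_smul] at hR
  have hS : ∀ ξ : Euc n, (((‖ξ‖ : ℂ) ^ (2 * (1 - μ / 2) - n - 2)) •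
        ((inner ℝ (EuclideanSpace.single j (1 : ℝ)) (EuclideanSpace.single i (1 : ℝ) : Euc n) : ℝ) •
          (𝓕 ψ : 𝓢(Euc n, E)) ξ) +
        (2 * (1 - μ / 2) - n - 2) • ((‖ξ‖ : ℂ) ^ (2 * (1 - μ / 2) - n - 4)) •
          ((inner ℝ ξ (EuclideanSpace.single i (1 : ℝ)) * inner ℝ ξ (EuclideanSpace.single j (1 : ℝ))
            : ℝ) • (𝓕 ψ : 𝓢(Euc n, E)) ξ)) =
      ((‖ξ‖ : ℂ) ^ (-μ - n - 2)) •
        ((((if i = j then (‖ξ‖ : ℂ) ^ 2 else 0) - (μ + n) * (ξ i * ξ j : ℝ)) •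
          (𝓕 ψ : 𝓢(Euc n, E)) ξ)) := fun ξ => by
    rcases eq_or_ne ξ 0 with rfl | hξ
    · simp [hψ 0 (by simpa using hr)]
    have h0 : (‖ξ‖ : ℂ) ≠ 0 := by exact_mod_cast (norm_pos_iff.2 hξ).ne'
    have e1 : (‖ξ‖ : ℂ) ^ (2 * (1 - μ / 2) - n - 2) = (‖ξ‖ : ℂ) ^ (-μ - n - 2) * (‖ξ‖ : ℂ) ^ 2 := by
      rw [← Complex.cpow_ofNat, ← Complex.cpow_add _ _ h0]
      ring_nf
    rw [e1, show 2 * (1 - μ / 2) - n - 4 = -μ - n - 2 by ring, ← Complex.coe_smul,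
      ← Complex.coe_smul, smul_smul, smul_smul, smul_smul, smul_smul, ← add_smul]
    congr 1
    simp only [inner_single_one_right]
    by_cases hij : i = j
    · subst hij
      simp
      ring
    · simp [hij]
      ring
  simp only [hS] at hR
  clear hS hI
  have hG : Complex.Gamma (1 - μ / 2) ≠ 0 := Complex.Gamma_ne_zero_of_re_pos (by simp; linarith)
  -- The factor 2-μ-n from the first integration by parts is absorbed into the Gamma function by its
  -- functional equation.
  have hG2 : Complex.Gamma ((μ + n) / 2) =
      ((n : ℂ) / 2 - (1 - μ / 2)) * Complex.Gamma ((n : ℂ) / 2 - (1 - μ / 2)) := by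
    rw [← Complex.Gamma_add_one]
    · ring_nf
    · intro h
      have := congrArg Complex.re h
      simp at this
      linarith
  have hpa : (Real.pi : ℂ) ^ (-(1 - μ / 2)) ≠ 0 := by simp [Complex.cpow_eq_zero_iff, hpi]
  have hpp : (Real.pi : ℂ) ^ (1 - μ / 2 - (n : ℂ) / 2) =
      (Real.pi : ℂ) ^ (-μ - (n : ℂ) / 2) * Real.pi ^ 2 * (Real.pi : ℂ) ^ (-(1 - μ / 2)) := by
    rw [← Complex.cpow_ofNat, ← Complex.cpow_add _ _ hpi, ← Complex.cpow_add _ _ hpi]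
    ring_nf
  refine smul_right_injective E (mul_ne_zero hpa hG) ?_
  simp only at hR ⊢
  simp only [smul_smul (_ : ℝ) (_ : ℝ)] at hR
  rw [hR, smul_smul]
  congr 1
  rw [fourierCoef, hpp, hG2]
  generalize Complex.Gamma ((n : ℂ) / 2 - (1 - μ / 2)) = G1
  generalize Complex.Gamma (1 - μ / 2) = G2 at hG ⊢
  field_simp
  ring

variable (q : Fin n → Fin n → E →L[ℂ] E)

lemma quad_traceCoeff_sub_apply (μ : ℂ) (ξ : Euc n) (η : E) :
    quad (traceCoeff q) ξ η - (μ + n) • quad q ξ η =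
      ∑ i, ∑ j, q i j (((if i = j then (‖ξ‖ : ℂ) ^ 2 else 0) - (μ + n) * (ξ i * ξ j : ℝ)) • η) := by
  rw [quad_traceCoeff, quad_apply]
  have h : ∀ i j : Fin n, q i j (((if i = j then (‖ξ‖ : ℂ) ^ 2 else 0) -
      (μ + n) * (ξ i * ξ j : ℝ)) • η) = (if i = j then ((‖ξ‖ : ℂ) ^ 2) • q i j η else 0) -
        ((μ + n) * (ξ i * ξ j : ℝ)) • q i j η := fun i j => by
    rw [map_smul, sub_smul, ite_smul, zero_smul]
  simp only [h, Finset.sum_sub_distrib, Finset.smul_sum, smul_smul,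
    Finset.sum_ite_eq, Finset.mem_univ, if_true, _root_.smul_apply, sum_apply]

lemma regPairing_zero_eq_integral {μ : ℂ} (hμ : -(n : ℝ) < μ.re) (ψ : 𝓢(Euc n, E)) :
    regPairing q 0 μ ψ = ∫ y, homKernel q μ y (ψ y) := by
  have h1 : IntegrableOn (fun y => homKernel q μ y (ψ y)) (closedBall (0 : Euc n) 1) := by
    simpa using integrableOn_homKernel_sub_taylorPart q (ψ.smooth ⊤) (N := 0) (μ := μ)
      (by simpa using hμ)
  have h2 := (pairingAdmissible_of_schwartz q μ ψ).2
  have h := integral_add_compl (μ := volume) (f := fun y => homKernel q μ y (ψ y))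
    (s := closedBall (0 : Euc n) 1) measurableSet_closedBall
  rw [regPairing]
  simp only [Finset.range_zero, Finset.sum_empty, sub_zero, add_zero]
  rw [add_comm, h]
  rw [← integrableOn_univ, ← union_compl_self (closedBall (0 : Euc n) 1)]
  exact h1.union h2

/-- In this strip no regularization is needed at either end, so the kernel can be expanded into its
coefficients and the scalar identity used entry by entry. -/
lemma regPairing_zero_eq_integral_fourierSymbol {μ : ℂ} (h1 : 2 - (n : ℝ) < μ.re) (h2 : μ.re < 2)
    (ψ : 𝓢(Euc n, E)) {r : ℝ} (hr : 0 < r) (hψ : VanishesNear r (𝓕 ψ : 𝓢(Euc n, E))) :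
    regPairing q 0 μ ψ = ∫ ξ, fourierSymbol q μ ξ ((𝓕 ψ : 𝓢(Euc n, E)) ξ) := by
  rw [regPairing_zero_eq_integral q (by linarith)]
  have i1 : ∀ i j : Fin n, Integrable fun y : Euc n => ((‖y‖ : ℂ) ^ (μ - 2)) • ((y i * y j) • ψ y) :=
    fun i j => by
      let f := coordMulCLM i (coordMulCLM j ψ)
      have hf : ∀ y, f y = (y i * y j) • ψ y := fun y => by
        simp only [f, coordMulCLM_apply, smul_smul]
      simp only [← hf]
      refine Integrable.mono' (integrable_norm_rpow_mul_schwartz (s := μ.re - 2) (by linarith) f)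
        ?_ ?_
      · have : Measurable fun y : Euc n => ((‖y‖ : ℂ) ^ (μ - 2)) := by fun_prop
        exact this.aestronglyMeasurable.smul f.continuous.aestronglyMeasurable
      · have hne : ∀ᵐ y : Euc n, y ≠ 0 := by simp [ae_iff]
        filter_upwards [hne] with y hy
        rw [norm_smul, Complex.norm_cpow_eq_rpow_re_of_pos (norm_pos_iff.2 hy)]
        simp
  have hk : ∀ i j : Fin n, VanishesNear r
      (coordMulCLM i (coordMulCLM j (𝓕 ψ : 𝓢(Euc n, E)))) := fun i j ξ hξ => by
    simp [coordMulCLM_apply, hψ ξ hξ]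
  have i2 : ∀ i j : Fin n, Integrable fun ξ : Euc n => ((‖ξ‖ : ℂ) ^ (-μ - n - 2)) •
        ((((if i = j then (‖ξ‖ : ℂ) ^ 2 else 0) - (μ + n) * (ξ i * ξ j : ℝ)) •
          (𝓕 ψ : 𝓢(Euc n, E)) ξ)) := fun i j => by
    obtain ⟨F, hF⟩ := exists_schwartz_norm_cpow_smul (-μ - n - 2) hr (hk i j)
    obtain ⟨G, hG⟩ := exists_schwartz_norm_cpow_smul (-μ - n) hr hψ
    have i3 : Integrable fun ξ => (if i = j then G ξ else 0) - (μ + n) • F ξ := by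
      refine Integrable.sub ?_ (F.integrable.smul _)
      split_ifs
      · exact G.integrable
      · exact integrable_zero _ _ _
    refine i3.congr (Eventually.of_forall fun ξ => ?_)
    simp only
    rw [hF, hG]
    rcases eq_or_ne ξ 0 with rfl | hξ
    · simp [coordMulCLM_apply, hψ 0 (by simpa using hr)]
    have h0 : (‖ξ‖ : ℂ) ≠ 0 := by exact_mod_cast (norm_pos_iff.2 hξ).ne'
    have e1 : (‖ξ‖ : ℂ) ^ (-μ - n) = (‖ξ‖ : ℂ) ^ (-μ - n - 2) * (‖ξ‖ : ℂ) ^ 2 := by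
      rw [← Complex.cpow_ofNat, ← Complex.cpow_add _ _ h0]
      ring_nf
    simp only [coordMulCLM_apply]
    rw [sub_smul, smul_sub, e1, ← Complex.coe_smul, ← Complex.coe_smul]
    split_ifs
    · simp only [smul_smul]
      push_cast
      congr 2
      ring
    · simp only [smul_smul, zero_smul, smul_zero]
      push_cast
      congr 2
      ring
  have e1 : ∀ y, homKernel q μ y (ψ y) =
      ∑ i, ∑ j, q i j (((‖y‖ : ℂ) ^ (μ - 2)) • ((y i * y j) • ψ y)) := fun y => by
    rw [homKernel, _root_.smul_apply, quad_apply, Finset.smul_sum]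
    simp only [Finset.smul_sum, map_smul, ← Complex.coe_smul]
  have e2 : ∀ ξ, fourierSymbol q μ ξ ((𝓕 ψ : 𝓢(Euc n, E)) ξ) = fourierCoef n μ •
      ∑ i, ∑ j, q i j (((‖ξ‖ : ℂ) ^ (-μ - n - 2)) •
        ((((if i = j then (‖ξ‖ : ℂ) ^ 2 else 0) - (μ + n) * (ξ i * ξ j : ℝ)) •
          (𝓕 ψ : 𝓢(Euc n, E)) ξ))) := fun ξ => by
    rw [fourierSymbol_apply, homKernel, homKernel, _root_.smul_apply, _root_.smul_apply,
      smul_comm (μ + n), ← smul_sub, quad_traceCoeff_sub_apply]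
    simp only [Finset.smul_sum, map_smul]
  simp only [e1, e2]
  rw [integral_smul, integral_finsetSum _ fun i _ => integrable_finsetSum _ fun j _ =>
    (q i j).integrable_comp (i1 i j), integral_finsetSum _ fun i _ => integrable_finsetSum _
    fun j _ => (q i j).integrable_comp (i2 i j), Finset.smul_sum]
  refine Finset.sum_congr rfl fun i _ => ?_
  rw [integral_finsetSum _ fun j _ => (q i j).integrable_comp (i1 i j),
    integral_finsetSum _ fun j _ => (q i j).integrable_comp (i2 i j), Finset.smul_sum]
  refine Finset.sum_congr rfl fun j _ => ?_
  rw [(q i j).integral_comp_comm (i1 i j), (q i j).integral_comp_comm (i2 i j),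
    integral_norm_cpow_smul_coord_coord h1 h2 ψ hr hψ, map_smul]

/-- The Fourier transform of the regularized kernel, away from the origin. -/
theorem regPairing_eq_integral_fourierSymbol {μ : ℂ} (hμ : ¬ IsRieszPole n μ)
    (ψ : 𝓢(Euc n, E)) {r : ℝ} (hr : 0 < r) (hψ : VanishesNear r (𝓕 ψ : 𝓢(Euc n, E))) :
    regPairing q (taylorOrder n μ) μ ψ = ∫ ξ, fourierSymbol q μ ξ ((𝓕 ψ : 𝓢(Euc n, E)) ξ) := by
  have hn : (1 : ℝ) ≤ n := by exact_mod_cast Nat.one_le_iff_ne_zero.2 (NeZero.ne n)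
  have ha := (differentiableOn_regPairing_taylorOrder q ψ).analyticOnNhd (isOpen_not_isRieszPole n)
  have hb : DifferentiableOn ℂ (fun μ => ∫ ξ, fourierSymbol q μ ξ ((𝓕 ψ : 𝓢(Euc n, E)) ξ))
      {μ : ℂ | ¬ IsRieszPole n μ} := fun μ hμ =>
    (differentiableAt_integral_fourierSymbol q hμ hr hψ).differentiableWithinAt
  -- The strip 1 < Re μ < 2 lies in 2-n < Re μ < 2 for every n ≥ 1, and the poles have negative real
  -- part. Both sides are holomorphic on the connected set of non-poles, so agreement near 3/2 is
  -- enough.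
  have h0 : ((3 / 2 : ℝ) : ℂ) ∈ {μ : ℂ | ¬ IsRieszPole n μ} := by
    rintro ⟨k, hk⟩
    have h := congrArg Complex.re hk
    simp at h
    have : (0 : ℝ) ≤ k := Nat.cast_nonneg k
    linarith
  refine ha.eqOn_of_preconnected_of_eventuallyEq
    (hb.analyticOnNhd (isOpen_not_isRieszPole n)) (isPreconnected_not_isRieszPole n) h0 ?_ hμ
  have ho : IsOpen {μ : ℂ | 1 < μ.re ∧ μ.re < 2} :=
    (isOpen_lt continuous_const Complex.continuous_re).inter
      (isOpen_lt Complex.continuous_re continuous_const)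
  filter_upwards [ho.mem_nhds (show ((3 / 2 : ℝ) : ℂ) ∈ {μ : ℂ | 1 < μ.re ∧ μ.re < 2} by
    constructor <;> norm_num)] with z hz
  rw [← regPairing_eq_taylorOrder q (N := 0) (by simp; linarith [hz.1]) (ψ.smooth ⊤)]
  exact regPairing_zero_eq_integral_fourierSymbol q (by linarith [hz.1]) hz.2 ψ hr hψ

end

/-! ### Convolutions as Fourier multipliers away from zero frequency -/

noncomputable section

variable {n : ℕ} {E : Type*} [NormedAddCommGroup E] [NormedSpace ℂ E] [CompleteSpace E]
variable (q : Fin n → Fin n → E →L[ℂ] E)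

lemma exists_schwartz_homKernel (μ : ℂ) {r : ℝ} (hr : 0 < r) {h : 𝓢(Euc n, E)}
    (hh : VanishesNear r h) :
    ∃ F : 𝓢(Euc n, E), ∀ ξ, F ξ = homKernel q μ ξ (h ξ) := by
  obtain ⟨F, hF⟩ := exists_schwartz_norm_cpow_smul (μ - 2) hr hh
  refine ⟨∑ i, ∑ j, SchwartzMap.postcompCLM (q i j) (coordMulCLM i (coordMulCLM j F)), fun ξ => ?_⟩
  simp only [sum_apply, SchwartzMap.postcompCLM_apply, coordMulCLM_apply, hF,
    homKernel, _root_.smul_apply, quad_apply, Finset.smul_sum]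
  refine Finset.sum_congr rfl fun i _ => Finset.sum_congr rfl fun j _ => ?_
  rw [← Complex.coe_smul, ← Complex.coe_smul, map_smul, map_smul, map_smul, smul_smul, smul_smul,
    smul_smul]
  push_cast
  congr 1
  ring

lemma exists_schwartz_fourierSymbol (μ : ℂ) {r : ℝ} (hr : 0 < r) {h : 𝓢(Euc n, E)}
    (hh : VanishesNear r h) :
    ∃ F : 𝓢(Euc n, E), ∀ ξ, F ξ = fourierSymbol q μ ξ (h ξ) := by
  obtain ⟨F, hF⟩ := exists_schwartz_homKernel q (-μ - n) hr hh
  obtain ⟨G, hG⟩ := exists_schwartz_homKernel (traceCoeff q) (-μ - n) hr hh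
  refine ⟨fourierCoef n μ • (G - (μ + n) • F), fun ξ => ?_⟩
  rw [fourierSymbol_apply, ← hF, ← hG]
  rfl

/-- The partial derivative of the quadratic form. -/
def quadDeriv (i : Fin n) (ξ : Euc n) : E →L[ℂ] E := ∑ k, (ξ k : ℂ) • (q i k + q k i)

/-- The partial derivative of the homogeneous kernel. -/
def homKernelDeriv (μ : ℂ) (i : Fin n) (ξ : Euc n) : E →L[ℂ] E :=
  ((μ - 2) * (ξ i : ℂ) * (‖ξ‖ : ℂ) ^ (μ - 4)) • quad q ξ +
    ((‖ξ‖ : ℂ) ^ (μ - 2)) • quadDeriv q i ξ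

lemma hasFDerivAt_quad (ξ : Euc n) : HasFDerivAt (quad q)
    (∑ i, ∑ j, ((ξ i • (EuclideanSpace.proj j : Euc n →L[ℝ] ℝ) +
      ξ j • (EuclideanSpace.proj i : Euc n →L[ℝ] ℝ)).smulRight (q i j))) ξ := by
  have h : ∀ i : Fin n, HasFDerivAt (fun ξ : Euc n => ξ i) (EuclideanSpace.proj i : Euc n →L[ℝ] ℝ) ξ :=
    fun i => (EuclideanSpace.proj i : Euc n →L[ℝ] ℝ).hasFDerivAt
  have e : quad q = fun ξ : Euc n => ∑ i, ∑ j, (ξ i * ξ j) • q i j := by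
    ext1 ξ
    simp only [quad, Complex.coe_smul]
  rw [e]
  exact HasFDerivAt.fun_sum fun i _ => HasFDerivAt.fun_sum fun j _ =>
    ((h i).mul (h j)).smul_const (q i j)

lemma quadDeriv_eq (i : Fin n) (ξ : Euc n) :
    (∑ k, ∑ j, ((ξ k • (EuclideanSpace.proj j : Euc n →L[ℝ] ℝ) +
      ξ j • (EuclideanSpace.proj k : Euc n →L[ℝ] ℝ)).smulRight (q k j)))
      (EuclideanSpace.single i (1 : ℝ)) = quadDeriv q i ξ := by
  have hp : ∀ j : Fin n, (EuclideanSpace.proj j : Euc n →L[ℝ] ℝ) (EuclideanSpace.single i (1 : ℝ)) =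
      if j = i then 1 else 0 := fun j => by simp
  simp only [sum_apply, ContinuousLinearMap.smulRight_apply, _root_.add_apply, _root_.smul_apply,
    hp, smul_eq_mul, mul_ite, mul_one, mul_zero,
    add_smul, ite_smul, zero_smul, Finset.sum_add_distrib, Finset.sum_ite_eq', Finset.mem_univ,
    if_true, quadDeriv, smul_add]
  rw [add_comm]
  congr 1
  · rw [Finset.sum_comm]
    simp only [Finset.sum_ite_eq', Finset.mem_univ, if_true, Complex.coe_smul]

lemma lineDeriv_of_eq_homKernel {μ : ℂ} {r : ℝ} (hr : 0 < r) {h F : 𝓢(Euc n, E)}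
    (hh : VanishesNear r h) (hF : ∀ ξ, F ξ = homKernel q μ ξ (h ξ)) (i : Fin n) (ξ : Euc n) :
    (∂_{(EuclideanSpace.single i (1 : ℝ) : Euc n)} F : 𝓢(Euc n, E)) ξ =
      homKernelDeriv q μ i ξ (h ξ) +
        homKernel q μ ξ ((∂_{(EuclideanSpace.single i (1 : ℝ) : Euc n)} h : 𝓢(Euc n, E)) ξ) := by
  -- On the ball both sides vanish identically, so the product rule is only needed where the power
  -- of the norm is smooth.
  rcases lt_or_ge ‖ξ‖ r with h' | h'
  · have hF' : VanishesNear r F := fun y hy => by rw [hF, hh y hy, map_zero]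
    rw [hF'.lineDeriv _ ξ h', hh.lineDeriv _ ξ h', hh ξ h', map_zero, map_zero, add_zero]
  · have hξ : ξ ≠ 0 := norm_pos_iff.1 (hr.trans_le h')
    rw [SchwartzMap.lineDerivOp_apply_eq_fderiv, SchwartzMap.lineDerivOp_apply_eq_fderiv]
    have e : (F : Euc n → E) = fun ξ => ((‖ξ‖ : ℂ) ^ (μ - 2)) • quad q ξ (h ξ) := funext hF
    have h1 : HasFDerivAt (fun ξ => quad q ξ (h ξ)) _ ξ :=
      ((ContinuousLinearMap.restrictScalarsL ℂ E E ℝ ℝ).hasFDerivAt.comp ξ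
        (hasFDerivAt_quad q ξ)).clm_apply (h.hasFDerivAt ξ)
    have h2 := (hasFDerivAt_norm_cpow hξ (μ - 2)).smul h1
    rw [e]
    change fderiv ℝ ((fun ξ : Euc n => (‖ξ‖ : ℂ) ^ (μ - 2)) • fun ξ => quad q ξ (h ξ)) ξ _ = _
    have hres : ∀ (T : E →L[ℂ] E) (v : E),
        (ContinuousLinearMap.restrictScalarsL ℂ E E ℝ ℝ T) v = T v := fun _ _ => rfl
    rw [h2.fderiv]
    simp only [_root_.add_apply, _root_.smul_apply, ContinuousLinearMap.smulRight_apply,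
      ContinuousLinearMap.comp_apply, ContinuousLinearMap.flip_apply, quadDeriv_eq, Function.comp_apply,
      hres,
      innerSL_apply_apply, Complex.real_smul, inner_single_one_right, homKernelDeriv, homKernel]
    rw [show μ - 2 - 2 = μ - 4 by ring, smul_add]
    module

/-- The partial derivative of the symbol. -/
def fourierSymbolDeriv (μ : ℂ) (i : Fin n) (ξ : Euc n) : E →L[ℂ] E :=
  fourierCoef n μ • (homKernelDeriv (traceCoeff q) (-μ - n) i ξ -
    (μ + n) • homKernelDeriv q (-μ - n) i ξ)

lemma lineDeriv_of_eq_fourierSymbol {μ : ℂ} {r : ℝ} (hr : 0 < r) {h F : 𝓢(Euc n, E)}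
    (hh : VanishesNear r h) (hF : ∀ ξ, F ξ = fourierSymbol q μ ξ (h ξ)) (i : Fin n) (ξ : Euc n) :
    (∂_{(EuclideanSpace.single i (1 : ℝ) : Euc n)} F : 𝓢(Euc n, E)) ξ =
      fourierSymbolDeriv q μ i ξ (h ξ) +
        fourierSymbol q μ ξ ((∂_{(EuclideanSpace.single i (1 : ℝ) : Euc n)} h : 𝓢(Euc n, E)) ξ) := by
  obtain ⟨G, hG⟩ := exists_schwartz_homKernel q (-μ - n) hr hh
  obtain ⟨K, hK⟩ := exists_schwartz_homKernel (traceCoeff q) (-μ - n) hr hh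
  have e : F = fourierCoef n μ • (K - (μ + n) • G) := by
    ext ξ
    rw [hF, fourierSymbol_apply, ← hG, ← hK]
    rfl
  rw [e, ← LineDeriv.lineDerivOpCLM_apply (R := ℂ), map_smul, map_sub, map_smul]
  simp only [_root_.smul_apply, _root_.sub_apply, LineDeriv.lineDerivOpCLM_apply]
  rw [lineDeriv_of_eq_homKernel q hr hh hG, lineDeriv_of_eq_homKernel (traceCoeff q) hr hh hK,
    fourierSymbol_apply]
  simp only [fourierSymbolDeriv, _root_.smul_apply, _root_.sub_apply]
  module

/-- Reflection and translation of a Schwartz function. -/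
def reflectTranslate (x : Euc n) (θ : 𝓢(Euc n, E)) : 𝓢(Euc n, E) :=
  SchwartzMap.compCLMOfContinuousLinearEquiv ℂ (ContinuousLinearEquiv.neg ℝ)
    (SchwartzMap.compSubConstCLM ℂ (-x) θ)

lemma reflectTranslate_apply (x y : Euc n) (θ : 𝓢(Euc n, E)) :
    reflectTranslate x θ y = θ (x - y) := by
  simp [reflectTranslate, sub_eq_add_neg, add_comm]

lemma fourier_reflectTranslate (x ξ : Euc n) (θ : 𝓢(Euc n, E)) :
    (𝓕 (reflectTranslate x θ) : 𝓢(Euc n, E)) ξ =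
      Complex.exp (((-2 * Real.pi * inner ℝ x ξ : ℝ) : ℂ) * Complex.I) •
        (𝓕 θ : 𝓢(Euc n, E)) (-ξ) := by
  rw [SchwartzMap.fourier_coe, SchwartzMap.fourier_coe, Real.fourier_eq', Real.fourier_eq',
    ← integral_smul, ← integral_sub_left_eq_self _ volume x]
  congr 1
  ext y
  rw [reflectTranslate_apply, sub_sub_cancel, smul_smul, ← Complex.exp_add]
  congr 2
  simp only [inner_sub_left, inner_neg_right]
  push_cast
  ring

lemma fourierSymbol_neg (μ : ℂ) (ξ : Euc n) : fourierSymbol q μ (-ξ) = fourierSymbol q μ ξ := by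
  simp only [fourierSymbol, homKernel_neg]

variable [NeZero n]

/-- Away from the zero frequency the regularized convolution is a Fourier multiplier. -/
theorem regConv_eq_fourierInv {μ : ℂ} (hμ : ¬ IsRieszPole n μ) {r : ℝ} (hr : 0 < r)
    {θ F : 𝓢(Euc n, E)} (hθ : VanishesNear r (𝓕 θ : 𝓢(Euc n, E)))
    (hF : ∀ ξ, F ξ = fourierSymbol q μ ξ ((𝓕 θ : 𝓢(Euc n, E)) ξ)) :
    regConv q (taylorOrder n μ) μ θ = (𝓕⁻ F : 𝓢(Euc n, E)) := by
  ext x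
  have hv : VanishesNear r (𝓕 (reflectTranslate x θ) : 𝓢(Euc n, E)) := fun ξ hξ => by
    rw [fourier_reflectTranslate, hθ (-ξ) (by simpa using hξ), smul_zero]
  have h := regPairing_eq_integral_fourierSymbol q hμ (reflectTranslate x θ) hr hv
  have e : (reflectTranslate x θ : Euc n → E) = fun y => θ (x - y) := by
    ext y
    rw [reflectTranslate_apply]
  rw [e] at h
  rw [regConv, h, SchwartzMap.fourierInv_coe, Real.fourierInv_eq', ← integral_neg_eq_self]
  congr 1
  ext ξ
  rw [fourier_reflectTranslate, map_smul, fourierSymbol_neg, neg_neg, hF]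
  congr 2
  rw [inner_neg_right, real_inner_comm]
  push_cast
  ring

/-- The inner convolution is again a Schwartz function with transform vanishing near 0.
Multiplication by x_i acts on the transform as (i/2π) ∂_i, which preserves that property, so the
outer convolution is also a multiplier. The two summands come from the product rule. -/
lemma regComp_eq_fourierInv {μ₁ μ₂ : ℂ} (hμ₁ : ¬ IsRieszPole n μ₁) (hμ₂ : ¬ IsRieszPole n μ₂)
    {r : ℝ} (hr : 0 < r) {θ F : 𝓢(Euc n, E)} (hθ : VanishesNear r (𝓕 θ : 𝓢(Euc n, E))) (i : Fin n)
    (hF : ∀ ξ, F ξ = (Complex.I / (2 * Real.pi)) • fourierSymbol q μ₂ ξ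
      (fourierSymbolDeriv q μ₁ i ξ ((𝓕 θ : 𝓢(Euc n, E)) ξ) +
        fourierSymbol q μ₁ ξ ((∂_{(EuclideanSpace.single i (1 : ℝ) : Euc n)}
          (𝓕 θ : 𝓢(Euc n, E)) : 𝓢(Euc n, E)) ξ))) :
    regComp q (taylorOrder n μ₁) (taylorOrder n μ₂) μ₁ μ₂ i θ = (𝓕⁻ F : 𝓢(Euc n, E)) := by
  have hpi : (Real.pi : ℂ) ≠ 0 := by exact_mod_cast Real.pi_ne_zero
  obtain ⟨G, hG⟩ := exists_schwartz_fourierSymbol q μ₁ hr hθ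
  have hGv : VanishesNear r G := fun ξ hξ => by rw [hG, hθ ξ hξ, map_zero]
  have e1 : coordMul i (regConv q (taylorOrder n μ₁) μ₁ θ) =
      (coordMulCLM i (𝓕⁻ G : 𝓢(Euc n, E)) : 𝓢(Euc n, E)) := by
    ext x
    rw [coordMul, regConv_eq_fourierInv q hμ₁ hr hθ hG, coordMulCLM_apply]
  have e2 : 𝓕 (coordMulCLM i (𝓕⁻ G : 𝓢(Euc n, E))) = (Complex.I / (2 * Real.pi)) •
      (∂_{(EuclideanSpace.single i (1 : ℝ) : Euc n)} G : 𝓢(Euc n, E)) := by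
    have h := fourier_coordMulCLM i (𝓕⁻ G : 𝓢(Euc n, E))
    rw [FourierTransform.fourier_fourierInv_eq] at h
    rw [h, smul_smul]
    have : Complex.I / (2 * Real.pi) * -(2 * Real.pi * Complex.I) = 1 := by
      field_simp
      rw [Complex.I_sq]
      ring
    rw [this, one_smul]
  have hv : VanishesNear r (𝓕 (coordMulCLM i (𝓕⁻ G : 𝓢(Euc n, E))) : 𝓢(Euc n, E)) := fun ξ hξ => by
    rw [e2, _root_.smul_apply, hGv.lineDeriv _ ξ hξ, smul_zero]
  rw [regComp, e1]
  refine regConv_eq_fourierInv q hμ₂ hr hv fun ξ => ?_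
  rw [hF, e2, _root_.smul_apply, map_smul, lineDeriv_of_eq_fourierSymbol q hr hθ hG]

end

/-! ### Identification with a differential operator by a scaling argument -/

noncomputable section

variable {n : ℕ} {E : Type*} [NormedAddCommGroup E] [NormedSpace ℂ E]

/-- The operator `∑ Aₖ ∂ₖ + ∑ Bₖₗ ∂ₖ ∂ₗ xᵢ` on Schwartz functions. -/
def diffOp (A : Fin n → E →L[ℂ] E) (B : Fin n → Fin n → E →L[ℂ] E) (i : Fin n) :
    𝓢(Euc n, E) →L[ℂ] 𝓢(Euc n, E) :=
  (∑ k, (SchwartzMap.postcompCLM (A k)).comp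
    (LineDeriv.lineDerivOpCLM ℂ 𝓢(Euc n, E) (EuclideanSpace.single k (1 : ℝ) : Euc n))) +
  ∑ k, ∑ l, (SchwartzMap.postcompCLM (B k l)).comp
    ((LineDeriv.lineDerivOpCLM ℂ 𝓢(Euc n, E) (EuclideanSpace.single k (1 : ℝ) : Euc n)).comp
      ((LineDeriv.lineDerivOpCLM ℂ 𝓢(Euc n, E) (EuclideanSpace.single l (1 : ℝ) : Euc n)).comp
        (coordMulCLM i)))

variable (A : Fin n → E →L[ℂ] E) (B : Fin n → Fin n → E →L[ℂ] E)

lemma diffOp_eq (i : Fin n) (θ : 𝓢(Euc n, E)) : diffOp A B i θ =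
    (∑ k, SchwartzMap.postcompCLM (A k)
      (∂_{(EuclideanSpace.single k (1 : ℝ) : Euc n)} θ : 𝓢(Euc n, E))) +
    ∑ k, ∑ l, SchwartzMap.postcompCLM (B k l)
      (∂_{(EuclideanSpace.single k (1 : ℝ) : Euc n)}
        (∂_{(EuclideanSpace.single l (1 : ℝ) : Euc n)} (coordMulCLM i θ)) : 𝓢(Euc n, E)) := by
  simp [diffOp, sum_apply]

lemma diffOp_apply (i : Fin n) (θ : 𝓢(Euc n, E)) (x : Euc n) : diffOp A B i θ x =
    (∑ k, A k ((∂_{(EuclideanSpace.single k (1 : ℝ) : Euc n)} θ : 𝓢(Euc n, E)) x)) +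
    ∑ k, ∑ l, B k l ((∂_{(EuclideanSpace.single k (1 : ℝ) : Euc n)}
        (∂_{(EuclideanSpace.single l (1 : ℝ) : Euc n)} (coordMulCLM i θ)) : 𝓢(Euc n, E)) x) := by
  rw [diffOp_eq]
  simp only [_root_.add_apply, sum_apply, SchwartzMap.postcompCLM_apply]

/-- Dilation of a Schwartz function by a nonzero factor. -/
def dilate (u : ℝˣ) : 𝓢(Euc n, E) →L[ℂ] 𝓢(Euc n, E) :=
  SchwartzMap.compCLMOfContinuousLinearEquiv ℂ (ContinuousLinearEquiv.smulLeft u)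

lemma dilate_apply (u : ℝˣ) (θ : 𝓢(Euc n, E)) (x : Euc n) : dilate u θ x = θ ((u : ℝ) • x) := rfl

lemma lineDeriv_dilate (u : ℝˣ) (θ : 𝓢(Euc n, E)) (v : Euc n) :
    (∂_{v} (dilate u θ) : 𝓢(Euc n, E)) = (u : ℝ) • dilate u (∂_{v} θ : 𝓢(Euc n, E)) := by
  rw [dilate, SchwartzMap.lineDerivOp_compCLMOfContinuousLinearEquiv]
  have : (ContinuousLinearEquiv.smulLeft u : Euc n ≃L[ℝ] Euc n) v = (u : ℝ) • v := rfl
  rw [this, LineDeriv.lineDerivOp_left_smul, ← Complex.coe_smul, map_smul, Complex.coe_smul]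

lemma coordMulCLM_dilate (i : Fin n) (u : ℝˣ) (θ : 𝓢(Euc n, E)) :
    coordMulCLM i (dilate u θ) = ((u : ℝ)⁻¹) • dilate u (coordMulCLM i θ) := by
  ext x
  rw [coordMulCLM_apply, _root_.smul_apply, dilate_apply, dilate_apply, coordMulCLM_apply, smul_smul]
  simp

/-- Each derivative gives a factor u and the coordinate gives u⁻¹, so both parts of the operator
scale like u, exactly as the composition of convolutions does. -/
lemma diffOp_dilate (i : Fin n) (u : ℝˣ) (θ : 𝓢(Euc n, E)) (x : Euc n) :
    diffOp A B i (dilate u θ) x = (u : ℝ) • diffOp A B i θ ((u : ℝ) • x) := by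
  rw [diffOp_apply, diffOp_apply, coordMulCLM_dilate]
  have hs : ∀ (c : ℝ) (v : Euc n) (f : 𝓢(Euc n, E)), (∂_{v} (c • f) : 𝓢(Euc n, E)) =
      c • (∂_{v} f : 𝓢(Euc n, E)) := fun c v f => LineDeriv.lineDerivOp_smul v c f
  simp only [lineDeriv_dilate, hs, _root_.smul_apply, dilate_apply, smul_smul]
  have hA : ∀ (T : E →L[ℂ] E) (c : ℝ) (η : E), T (c • η) = c • T η := fun T c η => by
    rw [← Complex.coe_smul, map_smul, Complex.coe_smul]
  simp only [hA, smul_add, Finset.smul_sum]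
  congr 1
  refine Finset.sum_congr rfl fun k _ => Finset.sum_congr rfl fun l _ => ?_
  congr 1
  field_simp

/-- Multiplying by a cutoff after stretching gives a bounded family of Schwartz functions. -/
lemma exists_seminorm_cutoff_dilate_le (χ : 𝓢(Euc n, ℝ)) (g : 𝓢(Euc n, E))
    {p : Seminorm ℂ 𝓢(Euc n, E)} (hp : Continuous p) :
    ∃ C : ℝ, ∀ u : ℝˣ, 0 < (u : ℝ) → (u : ℝ) ≤ 1 →
      p (SchwartzMap.smulLeftCLM E χ (dilate u g)) ≤ C := by
  obtain ⟨s, C, -, hs⟩ := Seminorm.bound_of_continuous (schwartz_withSeminorms ℂ (Euc n) E) p hp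
  let b : ℕ × ℕ → ℝ := fun m => ∑ i ∈ Finset.range (m.2 + 1), (m.2.choose i : ℝ) *
    SchwartzMap.seminorm ℝ m.1 i χ * SchwartzMap.seminorm ℝ 0 (m.2 - i) g
  have hb : ∀ m, 0 ≤ b m := fun m => Finset.sum_nonneg fun i _ => by positivity
  refine ⟨C * ∑ m ∈ s, b m, fun u hu hu1 => (hs _).trans ?_⟩
  rw [_root_.smul_apply, NNReal.smul_def, smul_eq_mul]
  gcongr
  refine Seminorm.finset_sup_apply_le (Finset.sum_nonneg fun m _ => hb m) fun m hm => ?_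
  refine le_trans ?_ (Finset.single_le_sum (fun m _ => hb m) hm)
  refine SchwartzMap.seminorm_le_bound ℂ m.1 m.2 _ (hb m) fun x => ?_
  have ht : (χ : Euc n → ℝ).HasTemperateGrowth := χ.hasTemperateGrowth
  have e : (SchwartzMap.smulLeftCLM E χ (dilate u g) : Euc n → E) =
      fun x => χ x • g ((u : ℝ) • x) := by
    ext x
    rw [SchwartzMap.smulLeftCLM_apply_apply ht, dilate_apply]
  have hg : ContDiff ℝ ∞ fun x => g ((u : ℝ) • x) := (g.smooth ⊤).comp (by fun_prop)
  have h := norm_iteratedFDeriv_smul_le (n := m.2) (χ.smooth ⊤) hg x (mod_cast le_top)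
  rw [e]
  refine (mul_le_mul_of_nonneg_left h (by positivity)).trans ?_
  rw [Finset.mul_sum]
  refine Finset.sum_le_sum fun i hi => ?_
  have h1 := SchwartzMap.le_seminorm ℝ m.1 i χ x
  -- The dilates of g do not decay uniformly, but for u ≤ 1 their derivatives are uniformly bounded;
  -- the cutoff supplies the decay in the Leibniz rule.
  have h2 : ‖iteratedFDeriv ℝ (m.2 - i) (fun x => g ((u : ℝ) • x)) x‖ ≤
      SchwartzMap.seminorm ℝ 0 (m.2 - i) g := by
    have h3 := SchwartzMap.le_seminorm ℝ 0 (m.2 - i) g ((u : ℝ) • x)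
    rw [iteratedFDeriv_comp_const_smul (i := m.2 - i) _ (g.smooth _)]
    simp only [norm_smul, norm_pow, pow_zero, one_mul] at h3 ⊢
    rw [Real.norm_of_nonneg hu.le]
    exact (mul_le_of_le_one_left (norm_nonneg _) (pow_le_one₀ hu.le hu1)).trans h3
  calc ‖x‖ ^ m.1 * ((m.2.choose i : ℝ) * ‖iteratedFDeriv ℝ i χ x‖ *
        ‖iteratedFDeriv ℝ (m.2 - i) (fun x => g ((u : ℝ) • x)) x‖)
      = (m.2.choose i : ℝ) * (‖x‖ ^ m.1 * ‖iteratedFDeriv ℝ i χ x‖) *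
        ‖iteratedFDeriv ℝ (m.2 - i) (fun x => g ((u : ℝ) • x)) x‖ := by ring
    _ ≤ _ := by gcongr

variable [CompleteSpace E]

lemma fourierInv_dilate_inv (u : ℝˣ) (hu : 0 < (u : ℝ)) (H : 𝓢(Euc n, E)) :
    (𝓕⁻ (dilate u⁻¹ H) : 𝓢(Euc n, E)) =
      dilate u ((((u : ℝ) ^ n : ℝ) : ℂ) • (𝓕⁻ H : 𝓢(Euc n, E))) := by
  ext x
  rw [dilate_apply, _root_.smul_apply, SchwartzMap.fourierInv_coe, SchwartzMap.fourierInv_coe,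
    Real.fourierInv_eq', Real.fourierInv_eq']
  have h := Measure.integral_comp_smul_of_nonneg (μ := (volume : Measure (Euc n)))
    (fun ξ : Euc n => Complex.exp (((2 * Real.pi * inner ℝ ξ ((u : ℝ) • x) : ℝ) : ℂ) * Complex.I) • H ξ)
    (u : ℝ)⁻¹ (hR := by positivity)
  rw [finrank_euclideanSpace_fin, inv_pow, inv_inv] at h
  rw [Complex.coe_smul, ← h]
  congr 1
  ext ξ
  rw [dilate_apply, inner_smul_left, inner_smul_right]
  congr 4
  simp
  exact Units.val_inv_eq_inv_val u

lemma fourier_lineDeriv_single_apply (k : Fin n) (f : 𝓢(Euc n, E)) (ξ : Euc n) :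
    (𝓕 (∂_{(EuclideanSpace.single k (1 : ℝ) : Euc n)} f : 𝓢(Euc n, E)) : 𝓢(Euc n, E)) ξ =
      (2 * Real.pi * Complex.I * (ξ k : ℂ)) • (𝓕 f : 𝓢(Euc n, E)) ξ := by
  have ht : (fun x : Euc n => inner ℝ x (EuclideanSpace.single k (1 : ℝ))).HasTemperateGrowth := by
    fun_prop
  rw [SchwartzMap.fourier_lineDerivOp_eq, _root_.smul_apply, SchwartzMap.smulLeftCLM_apply_apply ht,
    inner_single_one_right,
    ← Complex.coe_smul (ξ k), smul_smul]

lemma fourier_postcompCLM (T : E →L[ℂ] E) (f : 𝓢(Euc n, E)) :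
    𝓕 (SchwartzMap.postcompCLM T f) = SchwartzMap.postcompCLM T (𝓕 f : 𝓢(Euc n, E)) := by
  ext ξ
  rw [SchwartzMap.postcompCLM_apply, SchwartzMap.fourier_coe, SchwartzMap.fourier_coe,
    Real.fourier_eq', Real.fourier_eq', ← T.integral_comp_comm]
  · simp only [map_smul, SchwartzMap.postcompCLM_apply]
  · refine Integrable.mono (f.integrable (μ := volume)) ?_ (Eventually.of_forall fun y => ?_)
    · refine (Continuous.aestronglyMeasurable ?_).smul f.continuous.aestronglyMeasurable
      fun_prop
    · rw [norm_smul, Complex.norm_exp_ofReal_mul_I, one_mul]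

lemma fourier_coordMulCLM_apply (i : Fin n) (f : 𝓢(Euc n, E)) (ξ : Euc n) :
    (𝓕 (coordMulCLM i f) : 𝓢(Euc n, E)) ξ = (Complex.I / (2 * Real.pi)) •
      (∂_{(EuclideanSpace.single i (1 : ℝ) : Euc n)} (𝓕 f : 𝓢(Euc n, E)) : 𝓢(Euc n, E)) ξ := by
  have hpi : (Real.pi : ℂ) ≠ 0 := by exact_mod_cast Real.pi_ne_zero
  rw [fourier_coordMulCLM, _root_.smul_apply, smul_smul]
  have : Complex.I / (2 * Real.pi) * -(2 * Real.pi * Complex.I) = 1 := by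
    field_simp
    rw [Complex.I_sq]
    ring
  rw [this, one_smul]

/-- The factor i/2π is extracted to match the formula for the composition: 2πi = (i/2π) 4π², and ∂_k
∂_l x_i gives -4π² ξ_k ξ_l (i/2π) ∂_i. -/
lemma fourier_diffOp_apply (i : Fin n) (θ : 𝓢(Euc n, E)) (ξ : Euc n) :
    (𝓕 (diffOp A B i θ) : 𝓢(Euc n, E)) ξ =
      (Complex.I / (2 * Real.pi)) • ((4 * Real.pi ^ 2 : ℂ) •
        (∑ k, (ξ k : ℂ) • A k ((𝓕 θ : 𝓢(Euc n, E)) ξ)) -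
      (4 * Real.pi ^ 2 : ℂ) • ∑ k, ∑ l, ((ξ k : ℂ) * (ξ l : ℂ)) •
        B k l ((∂_{(EuclideanSpace.single i (1 : ℝ) : Euc n)} (𝓕 θ : 𝓢(Euc n, E))
          : 𝓢(Euc n, E)) ξ)) := by
  have hpi : (Real.pi : ℂ) ≠ 0 := by exact_mod_cast Real.pi_ne_zero
  have hF : ∀ f : 𝓢(Euc n, E), 𝓕 f = FourierTransform.fourierCLM ℂ 𝓢(Euc n, E) f := fun f => rfl
  rw [diffOp_eq, hF]
  simp only [map_add, map_sum, FourierTransform.fourierCLM_apply, fourier_postcompCLM, _root_.add_apply,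
    sum_apply, SchwartzMap.postcompCLM_apply, fourier_lineDeriv_single_apply, map_smul,
    fourier_coordMulCLM_apply, Finset.smul_sum, smul_smul, sub_eq_add_neg, smul_add, smul_neg,
    ← Finset.sum_neg_distrib, ← neg_smul]
  congr 1
  · refine Finset.sum_congr rfl fun k _ => ?_
    congr 1
    field_simp
    ring
  · refine Finset.sum_congr rfl fun k _ => Finset.sum_congr rfl fun l _ => ?_
    congr 1
    have hI : (Complex.I : ℂ) ^ 2 = -1 := Complex.I_sq
    field_simp
    linear_combination (4 * (ξ k : ℂ) * (ξ l : ℂ)) * hI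

variable (q : Fin n → Fin n → E →L[ℂ] E) [NeZero n]

lemma regComp_eq_diffOp_of_vanishesNear {μ₁ μ₂ : ℂ} (hμ₁ : ¬ IsRieszPole n μ₁)
    (hμ₂ : ¬ IsRieszPole n μ₂) (i : Fin n)
    (hA : ∀ ξ : Euc n, ξ ≠ 0 → ∀ η : E, fourierSymbol q μ₂ ξ (fourierSymbolDeriv q μ₁ i ξ η) =
      (4 * Real.pi ^ 2 : ℂ) • ∑ k, (ξ k : ℂ) • A k η)
    (hB : ∀ ξ : Euc n, ξ ≠ 0 → ∀ η : E, fourierSymbol q μ₂ ξ (fourierSymbol q μ₁ ξ η) =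
      -((4 * Real.pi ^ 2 : ℂ) • ∑ k, ∑ l, ((ξ k : ℂ) * (ξ l : ℂ)) • B k l η))
    {r : ℝ} (hr : 0 < r) {θ : 𝓢(Euc n, E)} (hθ : VanishesNear r (𝓕 θ : 𝓢(Euc n, E))) :
    regComp q (taylorOrder n μ₁) (taylorOrder n μ₂) μ₁ μ₂ i θ = diffOp A B i θ := by
  have h := regComp_eq_fourierInv q hμ₁ hμ₂ hr hθ i (F := 𝓕 (diffOp A B i θ)) fun ξ => by
    rw [fourier_diffOp_apply]
    rcases eq_or_ne ξ 0 with rfl | hξ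
    · have h0 : ‖(0 : Euc n)‖ < r := by simpa using hr
      rw [hθ 0 h0, hθ.lineDeriv _ 0 h0]
      simp
    · rw [map_add, hA ξ hξ, hB ξ hξ, sub_eq_add_neg]
  rw [h, FourierTransform.fourierInv_fourier_eq]

/-- The composition of two regularized convolutions with a coordinate multiplication in between is a
differential operator as soon as the symbols match away from the origin. -/
theorem regComp_eq_diffOp {μ₁ μ₂ : ℂ} (hμ₁ : ¬ IsRieszPole n μ₁)
    (hμ₂ : ¬ IsRieszPole n μ₂) (hsum : μ₁ + μ₂ = -2 * n - 2) (i : Fin n)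
    (hA : ∀ ξ : Euc n, ξ ≠ 0 → ∀ η : E, fourierSymbol q μ₂ ξ (fourierSymbolDeriv q μ₁ i ξ η) =
      (4 * Real.pi ^ 2 : ℂ) • ∑ k, (ξ k : ℂ) • A k η)
    (hB : ∀ ξ : Euc n, ξ ≠ 0 → ∀ η : E, fourierSymbol q μ₂ ξ (fourierSymbol q μ₁ ξ η) =
      -((4 * Real.pi ^ 2 : ℂ) • ∑ k, ∑ l, ((ξ k : ℂ) * (ξ l : ℂ)) • B k l η))
    (θ : 𝓢(Euc n, E)) (x : Euc n) :
    regComp q (taylorOrder n μ₁) (taylorOrder n μ₂) μ₁ μ₂ i θ x = diffOp A B i θ x := by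
  have h₁ := neg_lt_re_add_taylorOrder n μ₁
  have h₂ := neg_lt_re_add_taylorOrder n μ₂
  have hdecay : μ₁.re + 1 + μ₂.re < -(n : ℝ) := by
    have h := congrArg Complex.re hsum
    simp at h
    have : (0 : ℝ) ≤ n := Nat.cast_nonneg n
    linarith
  obtain ⟨p, hpc, hp⟩ := exists_seminorm_regComp q h₁ h₂ hdecay i
  let b : ContDiffBump (0 : Euc n) := ⟨1, 2, one_pos, one_lt_two⟩
  let χ : 𝓢(Euc n, ℝ) := b.hasCompactSupport.toSchwartzMap b.contDiff
  have hχ : (χ : Euc n → ℝ).HasTemperateGrowth := χ.hasTemperateGrowth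
  have hχ1 : ∀ ξ : Euc n, ‖ξ‖ ≤ 1 → χ ξ = 1 := fun ξ hξ =>
    b.one_of_mem_closedBall (by simpa using hξ)
  let J : 𝓢(Euc n, E) →L[ℂ] 𝓢(Euc n, E) := FourierTransform.fourierInvCLM ℂ 𝓢(Euc n, E)
  obtain ⟨C₁, hC₁⟩ := exists_seminorm_cutoff_dilate_le χ (𝓕 θ : 𝓢(Euc n, E))
    (p := p.comp J.toLinearMap) (hpc.comp J.continuous)
  let s : Seminorm ℂ 𝓢(Euc n, E) := schwartzSeminormFamily ℂ (Euc n) E (0, 0)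
  have hs : Continuous s := (schwartz_withSeminorms ℂ (Euc n) E).continuous_seminorm (0, 0)
  obtain ⟨C₂, hC₂⟩ := exists_seminorm_cutoff_dilate_le χ (𝓕 θ : 𝓢(Euc n, E))
    (p := s.comp ((diffOp A B i).comp J).toLinearMap) (hs.comp ((diffOp A B i).comp J).continuous)
  have key : ∀ ε : ℝ, 0 < ε → ε ≤ 1 →
      ‖regComp q (taylorOrder n μ₁) (taylorOrder n μ₂) μ₁ μ₂ i θ x - diffOp A B i θ x‖ ≤
        ε * (C₁ * (1 + ‖x‖) ^ |μ₁.re + 1| + C₂) := by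
    intro ε hε hε1
    let u : ℝˣ := Units.mk0 ε hε.ne'
    -- H(ξ) = χ(ξ) θ̂(εξ), so stretching back gives χ(ξ/ε) θ̂(ξ), the part of θ with frequencies of
    -- order at most ε. Its inverse transform is the dilate by ε of h. As ε varies, H stays bounded
    -- in the Schwartz space.
    let H : 𝓢(Euc n, E) := SchwartzMap.smulLeftCLM E χ (dilate u (𝓕 θ : 𝓢(Euc n, E)))
    let h : 𝓢(Euc n, E) := ((((u : ℝ) ^ n : ℝ) : ℂ)) • (𝓕⁻ H : 𝓢(Euc n, E))
    have hlow : (𝓕⁻ (dilate u⁻¹ H) : 𝓢(Euc n, E)) = dilate u h := fourierInv_dilate_inv u hε H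
    have hhigh : VanishesNear ε (𝓕 (θ - dilate u h) : 𝓢(Euc n, E)) := fun ξ hξ => by
      have e : 𝓕 (θ - dilate u h) = 𝓕 θ - dilate u⁻¹ H := by
        rw [← hlow]
        have := map_sub (FourierTransform.fourierCLM ℂ 𝓢(Euc n, E)) θ (𝓕⁻ (dilate u⁻¹ H))
        simpa [FourierTransform.fourier_fourierInv_eq] using this
      have h1 : ‖((u⁻¹ : ℝˣ) : ℝ) • ξ‖ ≤ 1 := by
        rw [norm_smul, Units.val_inv_eq_inv_val, norm_inv, Units.val_mk0,
          Real.norm_of_nonneg hε.le]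
        exact (inv_mul_le_one₀ hε).2 hξ.le
      rw [e, _root_.sub_apply, dilate_apply, SchwartzMap.smulLeftCLM_apply_apply hχ, hχ1 _ h1,
        one_smul, dilate_apply, smul_smul]
      simp
    have hsplit : θ = (θ - dilate u h) + dilate u h := by abel
    -- The high-frequency part contributes equally to both sides and cancels; homogeneity extracts
    -- the factor ε from the low-frequency part.
    have e1 : regComp q (taylorOrder n μ₁) (taylorOrder n μ₂) μ₁ μ₂ i θ x - diffOp A B i θ x =
        ε • (regComp q (taylorOrder n μ₁) (taylorOrder n μ₂) μ₁ μ₂ i h (ε • x) -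
          diffOp A B i h (ε • x)) := by
      rw [hsplit, regComp_add q h₁ h₂ hdecay,
        regComp_eq_diffOp_of_vanishesNear A B q hμ₁ hμ₂ i hA hB hε hhigh, map_add,
        _root_.add_apply, add_sub_add_left_eq_sub, diffOp_dilate, smul_sub]
      congr 1
      exact regComp_comp_smul q hμ₁ hμ₂ h₁ h₂ hsum i h hε hε1 x
    have hc : ‖(((u : ℝ) ^ n : ℝ) : ℂ)‖ ≤ 1 := by
      rw [Complex.norm_real, Real.norm_of_nonneg (by positivity)]
      exact pow_le_one₀ hε.le hε1
    have b1 : p h ≤ C₁ := by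
      refine le_trans ?_ (hC₁ u hε hε1)
      rw [map_smul_eq_mul]
      exact mul_le_of_le_one_left (apply_nonneg _ _) hc
    have b2 : ‖diffOp A B i h (ε • x)‖ ≤ C₂ := by
      have h3 := SchwartzMap.le_seminorm ℂ 0 0 (diffOp A B i h) (ε • x)
      simp only [pow_zero, one_mul, norm_iteratedFDeriv_zero] at h3
      refine h3.trans (le_trans ?_ (hC₂ u hε hε1))
      change s (diffOp A B i ((((u : ℝ) ^ n : ℝ) : ℂ) • (𝓕⁻ H : 𝓢(Euc n, E)))) ≤ _
      rw [map_smul, map_smul_eq_mul]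
      exact mul_le_of_le_one_left (apply_nonneg _ _) hc
    rw [e1, norm_smul, Real.norm_of_nonneg hε.le]
    gcongr
    refine (norm_sub_le _ _).trans (add_le_add ((hp h (ε • x)).2.trans ?_) b2)
    have hx : ‖ε • x‖ ≤ ‖x‖ := by
      rw [norm_smul, Real.norm_of_nonneg hε.le]
      exact mul_le_of_le_one_left (norm_nonneg _) hε1
    have : 0 ≤ p h := apply_nonneg _ _
    have : 0 ≤ C₁ := this.trans b1
    gcongr
  have hlim : Tendsto (fun ε : ℝ => ε * (C₁ * (1 + ‖x‖) ^ |μ₁.re + 1| + C₂)) (𝓝[>] 0) (𝓝 0) := by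
    have : Tendsto (fun ε : ℝ => ε * (C₁ * (1 + ‖x‖) ^ |μ₁.re + 1| + C₂)) (𝓝 0)
        (𝓝 (0 * (C₁ * (1 + ‖x‖) ^ |μ₁.re + 1| + C₂))) := tendsto_id.mul_const _
    rw [zero_mul] at this
    exact this.mono_left nhdsWithin_le_nhds
  have hle := ge_of_tendsto hlim (by
    filter_upwards [Ioc_mem_nhdsGT one_pos] with ε hε
    exact key ε hε.1 hε.2)
  exact sub_eq_zero.1 (norm_le_zero_iff.1 hle)

end

/-! ### Algebra of exterior and interior products -/

noncomputable section

section FormAlgebra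

variable {n p : ℕ}

lemma extProd_apply (v : Euc n) (η : Form n p) (u : Fin (p + 1) → Euc n) :
    extProd v η u = ∑ i : Fin (p + 1), (-1 : ℂ) ^ (i : ℕ) * ((inner ℝ v (u i) : ℝ) * η (i.removeNth u)) := by
  simp [extProd, ContinuousAlternatingMap.alternatizeUncurryFin_apply]

lemma ins_apply (v : Euc n) (η : Form n (p + 1)) (u : Fin p → Euc n) :
    ins v η u = η (Matrix.vecCons v u) := rfl

/-- Exterior multiplication as a linear map of the covector and of the form. -/
def extProdLM : Euc n →ₗ[ℝ] Form n p →ₗ[ℂ] Form n (p + 1) where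
  toFun v :=
    { toFun := extProd v
      map_add' := fun η ζ => by
        ext u; simp [extProd_apply, mul_add, Finset.sum_add_distrib]
      map_smul' := fun c η => by
        ext u; simp [extProd_apply, Finset.mul_sum, mul_left_comm] }
  map_add' v w := by
    ext η u; simp [extProd_apply, inner_add_left, mul_add, add_mul, Finset.sum_add_distrib]
  map_smul' c v := by
    ext η u; simp [extProd_apply, inner_smul_left, Finset.mul_sum, mul_left_comm, mul_assoc]

/-- Interior multiplication as a linear map of the vector and of the form. -/
def insLM : Euc n →ₗ[ℝ] Form n (p + 1) →ₗ[ℂ] Form n p where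
  toFun v :=
    { toFun := ins v
      map_add' := fun _ _ => rfl
      map_smul' := fun _ _ => rfl }
  map_add' v w := by
    ext η : 1
    exact map_add η.curryLeft v w
  map_smul' c v := by
    ext η : 1
    exact map_smul η.curryLeft c v

lemma continuous_extProd (v : Euc n) : Continuous (extProd v : Form n p → Form n (p + 1)) :=
  (ContinuousAlternatingMap.alternatizeUncurryFinCLM ℝ (Euc n) ℂ).continuous.comp
    (ContinuousLinearMap.smulRightL ℝ (Euc n) (Form n p) (innerSL ℝ v)).continuous

lemma continuous_ins (v : Euc n) : Continuous (ins v : Form n (p + 1) → Form n p) := by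
  have h1 : Continuous fun η : Form n (p + 1) => η.curryLeft :=
    (ContinuousAlternatingMap.curryLeftLI (𝕜 := ℝ) (E := Euc n) (F := ℂ)).continuous
  exact h1.clm_apply continuous_const

/-- Exterior multiplication as a continuous linear map of the form. -/
def extProdCLM (v : Euc n) : Form n p →L[ℂ] Form n (p + 1) :=
  ⟨extProdLM v, continuous_extProd v⟩

/-- Interior multiplication as a continuous linear map of the form. -/
def insCLM (v : Euc n) : Form n (p + 1) →L[ℂ] Form n p :=
  ⟨insLM v, continuous_ins v⟩

@[simp] lemma extProdCLM_apply (v : Euc n) (η : Form n p) : extProdCLM v η = extProd v η := rfl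

@[simp] lemma insCLM_apply (v : Euc n) (η : Form n (p + 1)) : insCLM v η = ins v η := rfl

/-- `ε_v i_w` as a continuous linear map of the form. -/
def extInsCLM : {p : ℕ} → Euc n → Euc n → Form n p →L[ℂ] Form n p
  | 0, _, _ => 0
  | _ + 1, v, w => (extProdCLM v).comp (insCLM w)

@[simp] lemma extInsCLM_apply (v w : Euc n) (η : Form n p) : extInsCLM v w η = extIns v w η := by
  cases p <;> rfl

lemma extIns_add_left (v v' w : Euc n) (η : Form n p) :
    extIns (v + v') w η = extIns v w η + extIns v' w η := by
  cases p with
  | zero => exact (add_zero (0 : Form n 0)).symm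
  | succ p => exact congrArg (fun L => L (ins w η)) (map_add extProdLM v v')

lemma extIns_add_right (v w w' : Euc n) (η : Form n p) :
    extIns v (w + w') η = extIns v w η + extIns v w' η := by
  cases p with
  | zero => exact (add_zero (0 : Form n 0)).symm
  | succ p =>
    have : ins (w + w') η = ins w η + ins w' η := congrArg (fun L => L η) (map_add insLM w w')
    change extProdLM v (ins (w + w') η) = _
    rw [this, map_add]
    rfl

lemma extIns_smul_left (c : ℝ) (v w : Euc n) (η : Form n p) :
    extIns (c • v) w η = (c : ℂ) • extIns v w η := by
  cases p with
  | zero => exact (smul_zero (A := Form n 0) (c : ℂ)).symm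
  | succ p => exact congrArg (fun L => L (ins w η)) (map_smul extProdLM c v)

lemma extIns_smul_right (c : ℝ) (v w : Euc n) (η : Form n p) :
    extIns v (c • w) η = (c : ℂ) • extIns v w η := by
  cases p with
  | zero => exact (smul_zero (A := Form n 0) (c : ℂ)).symm
  | succ p =>
    have : ins (c • w) η = (c : ℂ) • ins w η := congrArg (fun L => L η) (map_smul insLM c w)
    change extProdLM v (ins (c • w) η) = _
    rw [this, map_smul]
    rfl

lemma euc_eq_sum_single (v : Euc n) : v = ∑ i, v i • EuclideanSpace.single i (1 : ℝ) := by
  ext j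
  simp [Pi.single_apply]

lemma removeNth_zero_vecCons {α : Type*} (a : α) (u : Fin p → α) :
    (0 : Fin (p + 1)).removeNth (Matrix.vecCons a u : Fin (p + 1) → α) = u := by
  ext i; simp [Fin.removeNth]

lemma removeNth_succ_vecCons {α : Type*} (a : α) (u : Fin (p + 1) → α) (i : Fin (p + 1)) :
    i.succ.removeNth (Matrix.vecCons a u : Fin (p + 2) → α) = Matrix.vecCons a (i.removeNth u) := by
  ext j
  cases j using Fin.cases <;> simp [Fin.removeNth]

/-- The anticommutation relation of interior and exterior multiplication. -/
lemma ins_extProd (v w : Euc n) (η : Form n p) :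
    ins v (extProd w η) = ((inner ℝ v w : ℝ) : ℂ) • η - extIns w v η := by
  ext u
  rw [ins_apply, extProd_apply, Fin.sum_univ_succ]
  cases p with
  | zero => simp [extIns, real_inner_comm]
  | succ p =>
    simp only [removeNth_zero_vecCons, removeNth_succ_vecCons, extIns,
      ContinuousAlternatingMap.sub_apply, ContinuousAlternatingMap.smul_apply, extProd_apply,
      ins_apply]
    rw [sub_eq_add_neg, ← Finset.sum_neg_distrib]
    congr 1
    · simp [real_inner_comm]
    · refine Finset.sum_congr rfl fun i _ => ?_
      simp [pow_succ]

lemma ins_ins_self (v : Euc n) (η : Form n (p + 2)) : ins v (ins v η) = 0 :=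
  ContinuousAlternatingMap.curryLeft_same η v

/-- The double exterior product is the double alternatization of ⟨v,x⟩⟨v,y⟩η, which is symmetric in
x and y. -/
lemma extProd_extProd_self (v : Euc n) (η : Form n p) : extProd v (extProd v η) = 0 := by
  have h := ContinuousAlternatingMap.alternatizeUncurryFin_alternatizeUncurryFinCLM_comp_of_symmetric
    (f := (innerSL ℝ v).smulRight ((innerSL ℝ v).smulRight η)) (fun x y => by
      change inner ℝ v x • inner ℝ v y • η = inner ℝ v y • inner ℝ v x • η
      exact smul_comm _ _ _)
  rw [← h, extProd]
  congr 1
  ext1 x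
  exact (ContinuousAlternatingMap.alternatizeUncurryFin_smul _ _).symm

/-- Anticommuting i_b past ε_c leaves ⟨b,c⟩ and a term containing i_b i_b = 0. The companion
relation `extIns_extIns_left` uses ε_a ε_a = 0 instead. -/
lemma extIns_extIns_right (a b c : Euc n) (η : Form n p) :
    extIns a b (extIns c b η) = ((inner ℝ b c : ℝ) : ℂ) • extIns a b η := by
  cases p with
  | zero => exact (smul_zero (A := Form n 0) ((inner ℝ b c : ℝ) : ℂ)).symm
  | succ p =>
    have h0 : extIns c b (ins b η) = 0 := by
      cases p with
      | zero => rfl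
      | succ p =>
        change extProdLM c (ins b (ins b η)) = 0
        rw [ins_ins_self, map_zero]
    change extProdLM a (ins b (extProd c (ins b η))) = _
    rw [ins_extProd, h0, sub_zero, map_smul]
    rfl

lemma extIns_extIns_left (a b d : Euc n) (η : Form n p) :
    extIns a b (extIns a d η) = ((inner ℝ a b : ℝ) : ℂ) • extIns a d η := by
  cases p with
  | zero => exact (smul_zero (A := Form n 0) ((inner ℝ a b : ℝ) : ℂ)).symm
  | succ p =>
    have h0 : extProdLM a (extIns a b (ins d η)) = 0 := by
      cases p with
      | zero => exact map_zero _
      | succ p => exact extProd_extProd_self _ _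
    change extProdLM a (ins b (extProd a (ins d η))) = _
    rw [ins_extProd, map_sub, h0, sub_zero, map_smul, real_inner_comm]
    rfl

lemma alternatizeUncurryFin_eq_sum (f : Euc n →L[ℝ] Form n p) :
    ContinuousAlternatingMap.alternatizeUncurryFin f =
      ∑ k, extProd (EuclideanSpace.single k 1) (f (EuclideanSpace.single k 1)) := by
  have h : f = ∑ k, (innerSL ℝ (EuclideanSpace.single k (1 : ℝ))).smulRight
      (f (EuclideanSpace.single k 1)) := by
    ext1 v
    conv_lhs => rw [euc_eq_sum_single v, map_sum]
    simp only [_root_.map_smul, sum_apply, ContinuousLinearMap.smulRight_apply, innerSL_apply_apply,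
      EuclideanSpace.inner_single_left, map_one, one_mul]
  conv_lhs => rw [h]
  exact map_sum (ContinuousAlternatingMap.alternatizeUncurryFinCLM ℝ (Euc n) ℂ) _ _

/-- Alternatizing the curried form of an alternating map returns it multiplied by its degree. -/
lemma sum_extIns_single (η : Form n p) :
    ∑ k, extIns (EuclideanSpace.single k (1 : ℝ)) (EuclideanSpace.single k 1) η = (p : ℂ) • η := by
  cases p with
  | zero =>
    refine Eq.trans (b := (0 : Form n 0)) Finset.sum_const_zero ?_
    rw [Nat.cast_zero]
    exact (zero_smul ℂ η).symm
  | succ p =>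
    have h := alternatizeUncurryFin_eq_sum η.curryLeft
    rw [ContinuousAlternatingMap.alternatizeUncurryFin_curryLeft] at h
    refine h.symm.trans ?_
    exact (Nat.cast_smul_eq_nsmul ℂ (p + 1) η).symm

end FormAlgebra

variable {n : ℕ} {E : Type*} [NormedAddCommGroup E] [NormedSpace ℂ E]

/-- The algebraic properties of the operators `ε_v i_w` on forms of degree `p`. -/
structure IsExtInsFamily (p : ℂ) (T : Euc n → Euc n → E →L[ℂ] E) : Prop where
  add_left : ∀ v v' w η, T (v + v') w η = T v w η + T v' w η
  smul_left : ∀ (c : ℝ) v w η, T (c • v) w η = (c : ℂ) • T v w η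
  add_right : ∀ v w w' η, T v (w + w') η = T v w η + T v w' η
  smul_right : ∀ (c : ℝ) v w η, T v (c • w) η = (c : ℂ) • T v w η
  comp_right : ∀ a b c η, T a b (T c b η) = ((inner ℝ b c : ℝ) : ℂ) • T a b η
  comp_left : ∀ a b d η, T a b (T a d η) = ((inner ℝ a b : ℝ) : ℂ) • T a d η
  trace : ∀ η, ∑ k, T (EuclideanSpace.single k 1) (EuclideanSpace.single k 1) η = p • η

lemma isExtInsFamily_extInsCLM (n p : ℕ) :
    IsExtInsFamily (p : ℂ) (extInsCLM : Euc n → Euc n → Form n p →L[ℂ] Form n p) where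
  add_left v v' w η := by simpa only [extInsCLM_apply] using extIns_add_left v v' w η
  smul_left c v w η := by simpa only [extInsCLM_apply] using extIns_smul_left c v w η
  add_right v w w' η := by simpa only [extInsCLM_apply] using extIns_add_right v w w' η
  smul_right c v w η := by simpa only [extInsCLM_apply] using extIns_smul_right c v w η
  comp_right a b c η := by simpa only [extInsCLM_apply] using extIns_extIns_right a b c η
  comp_left a b d η := by simpa only [extInsCLM_apply] using extIns_extIns_left a b d η
  trace η := by simpa only [extInsCLM_apply] using sum_extIns_single η

end

/-! ### Symbols for the form kernel and their products -/

noncomputable section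

variable {n : ℕ} {E : Type*} [NormedAddCommGroup E] [NormedSpace ℂ E]

lemma quadDeriv_traceCoeff (q : Fin n → Fin n → E →L[ℂ] E) (i : Fin n) (ξ : Euc n) :
    quadDeriv (traceCoeff q) i ξ = (2 * (ξ i : ℂ)) • ∑ k, q k k := by
  rw [quadDeriv, Finset.sum_eq_single i]
  · simp only [traceCoeff, if_true, ← two_smul ℂ (∑ k, q k k), smul_smul, mul_comm]
  · intro k _ hk
    simp [traceCoeff, hk, hk.symm]
  · simp

/-- The coefficients of the quadratic form `|y|² - 2 T y y`. -/
def reflectionCoef (T : Euc n → Euc n → E →L[ℂ] E) (i j : Fin n) : E →L[ℂ] E :=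
  (if i = j then (1 : E →L[ℂ] E) else 0) -
    (2 : ℂ) • T (EuclideanSpace.single i 1) (EuclideanSpace.single j 1)

namespace IsExtInsFamily

variable {p : ℂ} {T : Euc n → Euc n → E →L[ℂ] E}

lemma apply_eq_sum_left (hT : IsExtInsFamily p T) (v w : Euc n) (η : E) :
    T v w η = ∑ i, (v i : ℂ) • T (EuclideanSpace.single i 1) w η := by
  let L : Euc n →+ E := AddMonoidHom.mk' (fun v => T v w η) fun v v' => hT.add_left v v' w η
  have h : L v = ∑ i, L (v i • EuclideanSpace.single i (1 : ℝ)) := by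
    rw [← map_sum, ← euc_eq_sum_single]
  exact h.trans (Finset.sum_congr rfl fun i _ => hT.smul_left _ _ _ _)

lemma apply_eq_sum_right (hT : IsExtInsFamily p T) (v w : Euc n) (η : E) :
    T v w η = ∑ i, (w i : ℂ) • T v (EuclideanSpace.single i 1) η := by
  let L : Euc n →+ E := AddMonoidHom.mk' (fun w => T v w η) fun w w' => hT.add_right v w w' η
  have h : L w = ∑ i, L (w i • EuclideanSpace.single i (1 : ℝ)) := by
    rw [← map_sum, ← euc_eq_sum_single]
  exact h.trans (Finset.sum_congr rfl fun i _ => hT.smul_right _ _ _ _)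

lemma apply_eq_sum_sum (hT : IsExtInsFamily p T) (v w : Euc n) (η : E) : T v w η = ∑ i, ∑ j, ((v i : ℂ) * (w j : ℂ)) •
    T (EuclideanSpace.single i 1) (EuclideanSpace.single j 1) η := by
  rw [hT.apply_eq_sum_left]
  refine Finset.sum_congr rfl fun i _ => ?_
  rw [hT.apply_eq_sum_right, Finset.smul_sum]
  exact Finset.sum_congr rfl fun j _ => smul_smul _ _ _

lemma quad_reflectionCoef_apply (hT : IsExtInsFamily p T) (y : Euc n) (η : E) : quad (reflectionCoef T) y η =
    ((‖y‖ : ℂ) ^ 2) • η - (2 : ℂ) • T y y η := by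
  rw [hT.apply_eq_sum_sum y y]
  have hn : (‖y‖ : ℂ) ^ 2 = ∑ i, ((y i : ℂ) * (y i : ℂ)) := by
    rw [← Complex.ofReal_pow, EuclideanSpace.real_norm_sq_eq]
    push_cast
    exact Finset.sum_congr rfl fun i _ => sq _
  simp only [quad_apply, reflectionCoef, _root_.sub_apply, _root_.smul_apply, smul_sub,
    Finset.sum_sub_distrib, hn, Finset.smul_sum, Finset.sum_smul, Complex.ofReal_mul]
  congr 1
  · refine Finset.sum_congr rfl fun i _ => ?_
    rw [Finset.sum_eq_single i (fun j _ hj => by rw [if_neg hj.symm]; simp)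
      (fun h => absurd (Finset.mem_univ i) h), if_pos rfl]
    rfl
  · exact Finset.sum_congr rfl fun i _ => Finset.sum_congr rfl fun j _ => smul_comm _ _ _

lemma sum_reflectionCoef_apply (hT : IsExtInsFamily p T) (η : E) :
    (∑ k, reflectionCoef T k k) η = ((n : ℂ) - 2 * p) • η := by
  simp only [reflectionCoef, if_true, sum_apply, _root_.sub_apply, _root_.smul_apply,
    Finset.sum_sub_distrib, ← Finset.smul_sum, hT.trace, Finset.sum_const, Finset.card_univ,
    Fintype.card_fin, one_apply_eq_self, ← Nat.cast_smul_eq_nsmul ℂ]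
  module

lemma quadDeriv_reflectionCoef_apply (hT : IsExtInsFamily p T) (i : Fin n) (ξ : Euc n) (η : E) :
    quadDeriv (reflectionCoef T) i ξ η = (2 * (ξ i : ℂ)) • η -
      (2 : ℂ) • (T (EuclideanSpace.single i 1) ξ η + T ξ (EuclideanSpace.single i 1) η) := by
  rw [hT.apply_eq_sum_right _ ξ, hT.apply_eq_sum_left ξ, ← Finset.sum_add_distrib, Finset.smul_sum]
  have h : (2 * (ξ i : ℂ)) • η = ∑ k, if i = k then (2 * (ξ k : ℂ)) • η else 0 := by simp
  rw [h, ← Finset.sum_sub_distrib, quadDeriv, sum_apply]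
  refine Finset.sum_congr rfl fun k _ => ?_
  by_cases hk : i = k
  · subst hk
    simp only [reflectionCoef, if_true, _root_.smul_apply, _root_.add_apply, _root_.sub_apply,
      one_apply_eq_self]
    module
  · simp only [reflectionCoef, if_neg hk, if_neg (Ne.symm hk), _root_.smul_apply,
      _root_.add_apply, _root_.sub_apply, _root_.zero_apply]
    module

/-- The trace of the quadratic form |y|² - 2T y y is n - 2p, so the bracket becomes (n-2p)|ξ|² -
(μ+n)(|ξ|² - 2 T ξ ξ). -/
lemma fourierSymbol_reflectionCoef_apply (hT : IsExtInsFamily p T) (μ : ℂ) {ξ : Euc n} (hξ : ξ ≠ 0) (η : E) :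
    fourierSymbol (reflectionCoef T) μ ξ η = (fourierCoef n μ * (‖ξ‖ : ℂ) ^ (-μ - n)) •
      ((-(2 * p + μ)) • η + (2 * (μ + n) * ((‖ξ‖ : ℂ) ^ 2)⁻¹) • T ξ ξ η) := by
  have h0 : (‖ξ‖ : ℂ) ≠ 0 := by exact_mod_cast norm_ne_zero_iff.2 hξ
  have e : (‖ξ‖ : ℂ) ^ (-μ - n - 2) = (‖ξ‖ : ℂ) ^ (-μ - n) * ((‖ξ‖ : ℂ) ^ 2)⁻¹ := by
    rw [Complex.cpow_sub _ _ h0, div_eq_mul_inv]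
    norm_cast
  rw [fourierSymbol_apply, homKernel, homKernel, quad_traceCoeff, e]
  simp only [_root_.smul_apply, hT.sum_reflectionCoef_apply, hT.quad_reflectionCoef_apply]
  match_scalars
  · field_simp
    ring
  · field_simp

lemma fourierSymbolDeriv_reflectionCoef_apply (hT : IsExtInsFamily p T) (μ : ℂ) (i : Fin n) {ξ : Euc n} (hξ : ξ ≠ 0)
    (η : E) :
    fourierSymbolDeriv (reflectionCoef T) μ i ξ η =
      (fourierCoef n μ * (‖ξ‖ : ℂ) ^ (-μ - n) * ((‖ξ‖ : ℂ) ^ 2)⁻¹) •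
      (((2 * p + μ) * (μ + n) * (ξ i : ℂ)) • η -
        (2 * (μ + n + 2) * (μ + n) * (ξ i : ℂ) * ((‖ξ‖ : ℂ) ^ 2)⁻¹) • T ξ ξ η +
        (2 * (μ + n)) • (T (EuclideanSpace.single i 1) ξ η + T ξ (EuclideanSpace.single i 1) η)) := by
  have h0 : (‖ξ‖ : ℂ) ≠ 0 := by exact_mod_cast norm_ne_zero_iff.2 hξ
  have e : (‖ξ‖ : ℂ) ^ (-μ - n - 2) = (‖ξ‖ : ℂ) ^ (-μ - n) * ((‖ξ‖ : ℂ) ^ 2)⁻¹ := by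
    rw [Complex.cpow_sub _ _ h0, div_eq_mul_inv]
    norm_cast
  have e' : (‖ξ‖ : ℂ) ^ (-μ - n - 4) =
      (‖ξ‖ : ℂ) ^ (-μ - n) * ((‖ξ‖ : ℂ) ^ 2)⁻¹ * ((‖ξ‖ : ℂ) ^ 2)⁻¹ := by
    rw [← e, ← div_eq_mul_inv, ← Complex.cpow_natCast, ← Complex.cpow_sub _ _ h0]
    congr 1
    push_cast
    ring
  rw [fourierSymbolDeriv, homKernelDeriv, homKernelDeriv, quad_traceCoeff, quadDeriv_traceCoeff,
    e, e']
  simp only [_root_.smul_apply, _root_.add_apply, _root_.sub_apply, hT.sum_reflectionCoef_apply,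
    hT.quad_reflectionCoef_apply, hT.quadDeriv_reflectionCoef_apply]
  match_scalars <;> field_simp <;> ring

lemma apply_self_apply_self (hT : IsExtInsFamily p T) (ξ : Euc n) (η : E) :
    T ξ ξ (T ξ ξ η) = ((‖ξ‖ : ℂ) ^ 2) • T ξ ξ η := by
  rw [hT.comp_left, real_inner_self_eq_norm_sq, Complex.ofReal_pow]

/-- Since T ξ ξ / |ξ|² is a projection, eigenvalues multiply: -4(λ-p+1)(λ-n+p) on the kernel and
-4(λ-p)(λ-n+p+1) on the image. These differ by -4(n-2p), the coefficient of T ξ ξ. -/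
lemma fourierSymbol_comp_fourierSymbol_apply (hT : IsExtInsFamily p T) (lam : ℂ) {ξ : Euc n}
    (hξ : ξ ≠ 0) (η : E) :
    fourierSymbol (reflectionCoef T) (-2 * lam - 2) ξ
      (fourierSymbol (reflectionCoef T) (2 * lam - 2 * n) ξ η) =
    (-4 * (fourierCoef n (-2 * lam - 2) * fourierCoef n (2 * lam - 2 * n))) •
      (((lam - p + 1) * (lam - n + p) * (‖ξ‖ : ℂ) ^ 2) • η + (n - 2 * p) • T ξ ξ η) := by
  have h0 : (‖ξ‖ : ℂ) ≠ 0 := by exact_mod_cast norm_ne_zero_iff.2 hξ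
  have e : (‖ξ‖ : ℂ) ^ (-(-2 * lam - 2) - n) * (‖ξ‖ : ℂ) ^ (-(2 * lam - 2 * n) - n) =
      (‖ξ‖ : ℂ) ^ 2 := by
    rw [← Complex.cpow_add _ _ h0, ← Complex.cpow_natCast]
    congr 1
    push_cast
    ring
  simp only [hT.fourierSymbol_reflectionCoef_apply _ hξ, map_smul, map_add,
    hT.apply_self_apply_self]
  generalize (‖ξ‖ : ℂ) ^ (-(-2 * lam - 2) - n) = u at *
  generalize (‖ξ‖ : ℂ) ^ (-(2 * lam - 2 * n) - n) = v at *
  generalize fourierCoef n (-2 * lam - 2) = f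
  generalize fourierCoef n (2 * lam - 2 * n) = g
  match_scalars
  · field_simp
    linear_combination (-4 * f * g * (lam - p + 1) * (lam - n + p)) * e
  · field_simp
    linear_combination (-4 * f * g * (n - 2 * p)) * e

/-- The composition rules reduce every product to ξ_i, T ξ ξ, T e_i ξ and T ξ e_i. The only
non-polynomial term, ξ_i |ξ|⁻² T ξ ξ, has coefficient zero for these two exponents. -/
lemma fourierSymbol_comp_fourierSymbolDeriv_apply (hT : IsExtInsFamily p T) (lam : ℂ) (i : Fin n)
    {ξ : Euc n} (hξ : ξ ≠ 0) (η : E) :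
    fourierSymbol (reflectionCoef T) (-2 * lam - 2) ξ
      (fourierSymbolDeriv (reflectionCoef T) (2 * lam - 2 * n) i ξ η) =
    (4 * (fourierCoef n (-2 * lam - 2) * fourierCoef n (2 * lam - 2 * n))) •
      (((2 * lam - n) * (lam - p + 1) * (lam - n + p) * (ξ i : ℂ)) • η +
        ((2 * lam - n) * (lam - p + 1)) • T (EuclideanSpace.single i 1) ξ η -
        ((2 * lam - n) * (lam - n + p + 1)) • T ξ (EuclideanSpace.single i 1) η) := by
  have h0 : (‖ξ‖ : ℂ) ≠ 0 := by exact_mod_cast norm_ne_zero_iff.2 hξ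
  have e : (‖ξ‖ : ℂ) ^ (-(-2 * lam - 2) - n) * (‖ξ‖ : ℂ) ^ (-(2 * lam - 2 * n) - n) =
      (‖ξ‖ : ℂ) ^ 2 := by
    rw [← Complex.cpow_add _ _ h0, ← Complex.cpow_natCast]
    congr 1
    push_cast
    ring
  have h1 : T ξ ξ (T (EuclideanSpace.single i 1) ξ η) = (ξ i : ℂ) • T ξ ξ η := by
    rw [hT.comp_right, inner_single_one_right]
  have h2 : T ξ ξ (T ξ (EuclideanSpace.single i 1) η) =
      ((‖ξ‖ : ℂ) ^ 2) • T ξ (EuclideanSpace.single i 1) η := by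
    rw [hT.comp_left, real_inner_self_eq_norm_sq, Complex.ofReal_pow]
  simp only [hT.fourierSymbol_reflectionCoef_apply _ hξ,
    hT.fourierSymbolDeriv_reflectionCoef_apply _ i hξ, map_smul, map_add, map_sub,
    hT.apply_self_apply_self, h1, h2]
  generalize (‖ξ‖ : ℂ) ^ (-(-2 * lam - 2) - n) = u at *
  generalize (‖ξ‖ : ℂ) ^ (-(2 * lam - 2 * n) - n) = v at *
  generalize fourierCoef n (-2 * lam - 2) = f
  generalize fourierCoef n (2 * lam - 2 * n) = g
  match_scalars
  · field_simp
    linear_combination (4 * f * g * (2 * lam - n) * (lam - p + 1) * (lam - n + p) * (ξ i)) * e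
  · field_simp
    ring
  · field_simp
    linear_combination (4 * f * g * (2 * lam - n) * (lam - p + 1)) * e
  · field_simp
    linear_combination (-4 * f * g * (2 * lam - n) * (lam - n + p + 1)) * e

end IsExtInsFamily

/-- The two constants differ by powers of 2 and π owing to the 2π in the exponential of the Fourier
transform. Over the pair of exponents these combine to π², which accounts for the factor 4π² in the
symbols of derivatives. -/
lemma cBar_mul_cBar (n : ℕ) (lam : ℂ) :
    cBar n (-2 * lam - 2) * cBar n (2 * lam - 2 * n) * (Real.pi : ℂ) ^ 2 =
      fourierCoef n (-2 * lam - 2) * fourierCoef n (2 * lam - 2 * n) := by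
  have hπ : (Real.pi : ℂ) ≠ 0 := by exact_mod_cast Real.pi_ne_zero
  have h2 : (2 : ℂ) ^ (-2 * lam - 2 + n) * (2 : ℂ) ^ (2 * lam - 2 * n + n) = 1 / 4 := by
    rw [← Complex.cpow_add _ _ two_ne_zero,
      show -2 * lam - 2 + n + (2 * lam - 2 * n + n) = -((2 : ℕ) : ℂ) by push_cast; ring,
      Complex.cpow_neg, Complex.cpow_natCast]
    norm_num
  have h3 : (Real.pi : ℂ) ^ (-(-2 * lam - 2) - (n : ℂ) / 2) *
      (Real.pi : ℂ) ^ (-(2 * lam - 2 * n) - (n : ℂ) / 2) =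
      (Real.pi : ℂ) ^ ((n : ℂ) / 2) * (Real.pi : ℂ) ^ ((n : ℂ) / 2) * (Real.pi : ℂ) ^ 2 := by
    rw [← Complex.cpow_natCast, ← Complex.cpow_add _ _ hπ, ← Complex.cpow_add _ _ hπ,
      ← Complex.cpow_add _ _ hπ]
    congr 1
    push_cast
    ring
  simp only [cBar, fourierCoef, div_eq_mul_inv] at *
  generalize (Complex.Gamma (1 - (-2 * lam - 2) * 2⁻¹))⁻¹ = a
  generalize (Complex.Gamma (1 - (2 * lam - 2 * n) * 2⁻¹))⁻¹ = b
  generalize Complex.Gamma ((-2 * lam - 2 + n) * 2⁻¹) = c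
  generalize Complex.Gamma ((2 * lam - 2 * n + n) * 2⁻¹) = d
  generalize (Real.pi : ℂ) ^ (-(-2 * lam - 2) - (n : ℂ) * 2⁻¹) = u at *
  generalize (Real.pi : ℂ) ^ (-(2 * lam - 2 * n) - (n : ℂ) * 2⁻¹) = v at *
  generalize (Real.pi : ℂ) ^ ((n : ℂ) * 2⁻¹) = w at *
  generalize (2 : ℂ) ^ (-2 * lam - 2 + n) = r at *
  generalize (2 : ℂ) ^ (2 * lam - 2 * n + n) = s at *
  linear_combination (w * w * (Real.pi : ℂ) ^ 2 * a * b * c * d) * h2 -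
    (1 / 4 * a * b * c * d) * h3

variable {p : ℂ} {T : Euc n → Euc n → E →L[ℂ] E}

/-- The composition of the two regularized convolutions with kernels built from `ε_v i_w`. -/
theorem regComp_reflectionCoef [NeZero n] [CompleteSpace E] (hT : IsExtInsFamily p T) {lam : ℂ}
    (h₁ : ¬ IsRieszPole n (2 * lam - 2 * n)) (h₂ : ¬ IsRieszPole n (-2 * lam - 2)) (i : Fin n)
    (θ : 𝓢(Euc n, E)) (x : Euc n) :
    regComp (reflectionCoef T) (taylorOrder n (2 * lam - 2 * n)) (taylorOrder n (-2 * lam - 2))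
      (2 * lam - 2 * n) (-2 * lam - 2) i θ x =
    (cBar n (-2 * lam - 2) * cBar n (2 * lam - 2 * n)) •
      (((2 * lam - n) * (lam - p + 1) * (lam - n + p + 1)) •
          (∂_{(EuclideanSpace.single i (1 : ℝ) : Euc n)} θ : 𝓢(Euc n, E)) x +
        (2 * lam - n) • ((lam - p + 1) •
            (-(∂_{(EuclideanSpace.single i (1 : ℝ) : Euc n)} θ : 𝓢(Euc n, E)) x +
              ∑ k, T (EuclideanSpace.single i 1) (EuclideanSpace.single k 1)
                ((∂_{(EuclideanSpace.single k (1 : ℝ) : Euc n)} θ : 𝓢(Euc n, E)) x)) -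
          (lam - n + p + 1) • ∑ k, T (EuclideanSpace.single k 1) (EuclideanSpace.single i 1)
                ((∂_{(EuclideanSpace.single k (1 : ℝ) : Euc n)} θ : 𝓢(Euc n, E)) x)) +
        (((lam - p + 1) * (n - lam - p)) •
            (-∑ k, (∂_{(EuclideanSpace.single k (1 : ℝ) : Euc n)}
              (∂_{(EuclideanSpace.single k (1 : ℝ) : Euc n)} (coordMulCLM i θ)) : 𝓢(Euc n, E)) x +
            ∑ k, ∑ l, T (EuclideanSpace.single l 1) (EuclideanSpace.single k 1)
              ((∂_{(EuclideanSpace.single k (1 : ℝ) : Euc n)}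
              (∂_{(EuclideanSpace.single l (1 : ℝ) : Euc n)} (coordMulCLM i θ)) : 𝓢(Euc n, E)) x)) +
          ((lam - p) * (n - lam - p - 1)) •
            -∑ k, ∑ l, T (EuclideanSpace.single l 1) (EuclideanSpace.single k 1)
              ((∂_{(EuclideanSpace.single k (1 : ℝ) : Euc n)}
              (∂_{(EuclideanSpace.single l (1 : ℝ) : Euc n)} (coordMulCLM i θ)) : 𝓢(Euc n, E)) x))) := by
  set C := cBar n (-2 * lam - 2) * cBar n (2 * lam - 2 * n) with hC
  have hC' := cBar_mul_cBar n lam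
  rw [← hC] at hC'
  -- The coefficient of ∂_i is λ-n+p here and λ-n+p+1 in the goal: the difference is supplied by the
  -- term -∂_i contained in the expansion of δ(ε_{e_i} ·).
  let A : Fin n → E →L[ℂ] E := fun k =>
    C • ((((2 * lam - n) * (lam - p + 1) * (lam - n + p)) • if i = k then (1 : E →L[ℂ] E) else 0) +
      ((2 * lam - n) * (lam - p + 1)) • T (EuclideanSpace.single i 1) (EuclideanSpace.single k 1) -
      ((2 * lam - n) * (lam - n + p + 1)) •
        T (EuclideanSpace.single k 1) (EuclideanSpace.single i 1))
  let B : Fin n → Fin n → E →L[ℂ] E := fun k l =>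
    C • ((((lam - p + 1) * (lam - n + p)) • if k = l then (1 : E →L[ℂ] E) else 0) +
      (n - 2 * p) • T (EuclideanSpace.single l 1) (EuclideanSpace.single k 1))
  have hApp : ∀ k η, A k η =
      (C * ((2 * lam - n) * (lam - p + 1) * (lam - n + p))) • (if i = k then η else 0) +
      (C * ((2 * lam - n) * (lam - p + 1))) •
        T (EuclideanSpace.single i 1) (EuclideanSpace.single k 1) η -
      (C * ((2 * lam - n) * (lam - n + p + 1))) •
        T (EuclideanSpace.single k 1) (EuclideanSpace.single i 1) η := by
    intro k η
    simp only [A, _root_.smul_apply, _root_.add_apply, _root_.sub_apply]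
    split_ifs
    · rw [one_apply_eq_self]; module
    · rw [_root_.zero_apply]; module
  have hBpp : ∀ k l η, B k l η =
      (C * ((lam - p + 1) * (lam - n + p))) • (if k = l then η else 0) +
      (C * (n - 2 * p)) • T (EuclideanSpace.single l 1) (EuclideanSpace.single k 1) η := by
    intro k l η
    simp only [B, _root_.smul_apply, _root_.add_apply]
    split_ifs
    · rw [one_apply_eq_self]; module
    · rw [_root_.zero_apply]; module
  rw [regComp_eq_diffOp A B (reflectionCoef T) h₁ h₂ (by ring) i ?_ ?_ θ x, diffOp_apply]
  · simp only [hApp, hBpp, Finset.sum_add_distrib, Finset.sum_sub_distrib, ← Finset.smul_sum,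
      Finset.sum_ite_eq, Finset.mem_univ, if_true]
    module
  · intro ξ hξ η
    rw [hT.fourierSymbol_comp_fourierSymbolDeriv_apply lam i hξ, ← hC',
      hT.apply_eq_sum_right _ ξ, hT.apply_eq_sum_left ξ]
    simp only [hApp, smul_add, smul_sub, Finset.sum_add_distrib, Finset.sum_sub_distrib,
      smul_ite, smul_zero, Finset.sum_ite_eq, Finset.mem_univ, if_true, Finset.smul_sum, smul_smul]
    congr 1
    · congr 1
      · congr 1; ring
      · refine Finset.sum_congr rfl fun k _ => ?_
        congr 1; ring
    · refine Finset.sum_congr rfl fun k _ => ?_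
      congr 1; ring
  · intro ξ hξ η
    have hn : (‖ξ‖ : ℂ) ^ 2 = ∑ i, ((ξ i : ℂ) * (ξ i : ℂ)) := by
      rw [← Complex.ofReal_pow, EuclideanSpace.real_norm_sq_eq]
      push_cast
      exact Finset.sum_congr rfl fun i _ => sq _
    rw [hT.fourierSymbol_comp_fourierSymbol_apply lam hξ, ← hC', hT.apply_eq_sum_sum, hn,
      Finset.sum_comm]
    simp only [hBpp, smul_add, Finset.sum_add_distrib, Finset.mul_sum, Finset.sum_smul,
      smul_ite, smul_zero, Finset.sum_ite_eq, Finset.mem_univ, if_true, Finset.smul_sum, smul_smul,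
      neg_add, ← Finset.sum_neg_distrib, ← neg_smul]
    congr 1
    · refine Finset.sum_congr rfl fun k _ => ?_
      congr 1; ring
    · refine Finset.sum_congr rfl fun k _ => Finset.sum_congr rfl fun l _ => ?_
      congr 1; ring

end

/-! ### Translation to differential forms -/

noncomputable section

variable {n p : ℕ}

/-- The coefficients of the quadratic form `i_x ε_x - ε_x i_x` on `p`-forms. -/
abbrev rieszCoef (n p : ℕ) : Fin n → Fin n → Form n p →L[ℂ] Form n p :=
  reflectionCoef extInsCLM

/-- Anticommutation turns i_x ε_x - ε_x i_x into |x|² - 2 ε_x i_x. -/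
lemma rieszKernel_eq_homKernel (μ : ℂ) (x : Euc n) (η : Form n p) :
    rieszKernel μ x η = homKernel (rieszCoef n p) μ x η := by
  have h : ins x (extProd x η) - extIns x x η = quad (rieszCoef n p) x η := by
    rw [(isExtInsFamily_extInsCLM n p).quad_reflectionCoef_apply, ins_extProd,
      real_inner_self_eq_norm_sq, extInsCLM_apply, sub_sub, Complex.ofReal_pow]
    congr 1
    exact (two_smul ℂ (extIns x x η)).symm
  rw [rieszKernel, h]
  rfl

lemma rieszPairing_eq_regPairing (μ : ℂ) (ψ : Euc n → Form n p) :
    rieszPairing μ ψ = regPairing (rieszCoef n p) (taylorOrder n μ) μ ψ := by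
  simp only [rieszPairing, rieszKernel_eq_homKernel]
  rfl

lemma knappStein_eq_regConv (γ : ℂ) (θ : Euc n → Form n p) :
    knappStein γ θ = regConv (rieszCoef n p) (taylorOrder n (-2 * γ)) (-2 * γ) θ :=
  funext fun _ => rieszPairing_eq_regPairing _ _

lemma rieszConverges_of_pairingAdmissible [NeZero n] {μ : ℂ} (hμ : ¬ IsRieszPole n μ)
    {ψ : Euc n → Form n p} (hψ : PairingAdmissible (rieszCoef n p) μ ψ) : RieszConverges μ ψ := by
  refine ⟨hμ, hψ.1, ?_, ?_⟩
  · simp only [rieszKernel_eq_homKernel]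
    exact hψ.2
  · simp only [rieszKernel_eq_homKernel]
    exact integrableOn_homKernel_sub_taylorPart _ hψ.1 (neg_lt_re_add_taylorOrder n μ)

lemma codiff_eq_of_hasFDerivAt {α : Euc n → Form n (p + 1)} {x : Euc n}
    {α' : Euc n →L[ℝ] Form n (p + 1)} (h : HasFDerivAt α α' x) :
    codiff α x = -∑ k, ins (EuclideanSpace.single k 1) (α' (EuclideanSpace.single k 1)) := by
  rw [codiff, h.fderiv]

lemma extDeriv_eq_of_hasFDerivAt {α : Euc n → Form n p} {x : Euc n}
    {α' : Euc n →L[ℝ] Form n p} (h : HasFDerivAt α α' x) :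
    extDeriv α x = ∑ k, extProd (EuclideanSpace.single k 1) (α' (EuclideanSpace.single k 1)) := by
  rw [extDeriv, h.fderiv, alternatizeUncurryFin_eq_sum]

lemma schwartz_hasFDerivAt (θ : 𝓢(Euc n, Form n p)) (x : Euc n) :
    HasFDerivAt θ (fderiv ℝ θ x) x := θ.differentiableAt.hasFDerivAt

lemma sum_single_inner_smul (v : Euc n) (f : Fin n → Form n p) (i : Fin n)
    (hv : v = EuclideanSpace.single i 1) :
    ∑ k, ((inner ℝ (EuclideanSpace.single k (1 : ℝ)) v : ℝ) : ℂ) • f k = f i := by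
  subst hv
  rw [Finset.sum_eq_single i]
  · have h : inner ℝ (EuclideanSpace.single i (1 : ℝ)) (EuclideanSpace.single i 1) = (1 : ℝ) := by
      simp
    rw [h]
    exact one_smul ℂ (f i)
  · intro k _ hk
    have h : inner ℝ (EuclideanSpace.single k (1 : ℝ)) (EuclideanSpace.single i 1) = (0 : ℝ) := by
      rw [EuclideanSpace.inner_single_left]
      simp [hk]
    rw [h]
    exact zero_smul ℂ (f k)
  · intro h
    exact absurd (Finset.mem_univ i) h

/-- Anticommuting i_{e_k} past ε_{e_n} isolates the term k = n, which is -∂_n θ, and leaves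
operators ε i. -/
lemma codiffExt_schwartz [NeZero n] (θ : 𝓢(Euc n, Form n p)) (x : Euc n) :
    codiffExt θ x = -(∂_{eLast n} θ : 𝓢(Euc n, Form n p)) x +
      ∑ k, extIns (eLast n) (EuclideanSpace.single k 1)
        ((∂_{(EuclideanSpace.single k (1 : ℝ) : Euc n)} θ : 𝓢(Euc n, Form n p)) x) := by
  have h : HasFDerivAt (fun x => extProd (eLast n) (θ x))
      (((extProdCLM (eLast n)).restrictScalars ℝ).comp (fderiv ℝ θ x)) x :=
    ((extProdCLM (eLast n)).restrictScalars ℝ).hasFDerivAt.comp x (schwartz_hasFDerivAt θ x)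
  rw [codiffExt, codiff_eq_of_hasFDerivAt h]
  simp only [SchwartzMap.lineDerivOp_apply_eq_fderiv]
  have e : ∀ k : Fin n, ins (EuclideanSpace.single k 1)
      ((((extProdCLM (eLast n)).restrictScalars ℝ).comp (fderiv ℝ θ x))
        (EuclideanSpace.single k 1)) =
      ((inner ℝ (EuclideanSpace.single k (1 : ℝ)) (eLast n) : ℝ) : ℂ) •
        fderiv ℝ θ x (EuclideanSpace.single k 1) -
      extIns (eLast n) (EuclideanSpace.single k 1) (fderiv ℝ θ x (EuclideanSpace.single k 1)) :=
    fun k => ins_extProd _ _ _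
  rw [Finset.sum_congr rfl fun k _ => e k, Finset.sum_sub_distrib,
    sum_single_inner_smul (eLast n) (fun k => fderiv ℝ θ x (EuclideanSpace.single k 1)) _ rfl,
    neg_sub', sub_neg_eq_add]
  rfl

lemma dIns_schwartz [NeZero n] (θ : 𝓢(Euc n, Form n p)) (x : Euc n) :
    dIns θ x = ∑ k, extIns (EuclideanSpace.single k 1) (eLast n)
        ((∂_{(EuclideanSpace.single k (1 : ℝ) : Euc n)} θ : 𝓢(Euc n, Form n p)) x) := by
  cases p with
  | zero => exact Finset.sum_const_zero.symm
  | succ p =>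
    have h : HasFDerivAt (fun x => ins (eLast n) (θ x))
        (((insCLM (eLast n)).restrictScalars ℝ).comp (fderiv ℝ θ x)) x :=
      ((insCLM (eLast n)).restrictScalars ℝ).hasFDerivAt.comp x (schwartz_hasFDerivAt θ x)
    refine (extDeriv_eq_of_hasFDerivAt h).trans ?_
    simp only [SchwartzMap.lineDerivOp_apply_eq_fderiv]
    rfl

lemma extDeriv_schwartz (φ : 𝓢(Euc n, Form n p)) :
    extDeriv φ = fun x => ∑ l, extProd (EuclideanSpace.single l 1)
      ((∂_{(EuclideanSpace.single l (1 : ℝ) : Euc n)} φ : 𝓢(Euc n, Form n p)) x) := by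
  funext x
  simp only [SchwartzMap.lineDerivOp_apply_eq_fderiv]
  exact extDeriv_eq_of_hasFDerivAt (schwartz_hasFDerivAt φ x)

lemma codiff_schwartz (φ : 𝓢(Euc n, Form n (p + 1))) :
    codiff φ = fun x => -∑ l, ins (EuclideanSpace.single l 1)
      ((∂_{(EuclideanSpace.single l (1 : ℝ) : Euc n)} φ : 𝓢(Euc n, Form n (p + 1))) x) := by
  funext x
  simp only [SchwartzMap.lineDerivOp_apply_eq_fderiv]
  rfl

/-- Anticommutation splits δd into minus the Laplacian and a double sum; `dCodiff_schwartz` shows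
that dδ is minus the same sum, so both are expressed by ε_{e_l} i_{e_k} ∂_k ∂_l. -/
lemma codiffD_schwartz (φ : 𝓢(Euc n, Form n p)) (x : Euc n) :
    codiffD φ x = -∑ k, (∂_{(EuclideanSpace.single k (1 : ℝ) : Euc n)}
        (∂_{(EuclideanSpace.single k (1 : ℝ) : Euc n)} φ) : 𝓢(Euc n, Form n p)) x +
      ∑ k, ∑ l, extIns (EuclideanSpace.single l 1) (EuclideanSpace.single k 1)
        ((∂_{(EuclideanSpace.single k (1 : ℝ) : Euc n)}
          (∂_{(EuclideanSpace.single l (1 : ℝ) : Euc n)} φ) : 𝓢(Euc n, Form n p)) x) := by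
  have h : HasFDerivAt (fun x => ∑ l, extProd (EuclideanSpace.single l 1)
      ((∂_{(EuclideanSpace.single l (1 : ℝ) : Euc n)} φ : 𝓢(Euc n, Form n p)) x))
      (∑ l, ((extProdCLM (EuclideanSpace.single l 1)).restrictScalars ℝ).comp
        (fderiv ℝ (∂_{(EuclideanSpace.single l (1 : ℝ) : Euc n)} φ : 𝓢(Euc n, Form n p)) x)) x :=
    HasFDerivAt.fun_sum fun l _ =>
      ((extProdCLM (EuclideanSpace.single l 1)).restrictScalars ℝ).hasFDerivAt.comp x
        (schwartz_hasFDerivAt _ x)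
  rw [codiffD, extDeriv_schwartz, codiff_eq_of_hasFDerivAt h]
  have e : ∀ k : Fin n, ins (EuclideanSpace.single k 1)
      ((∑ l, ((extProdCLM (EuclideanSpace.single l 1)).restrictScalars ℝ).comp
        (fderiv ℝ (∂_{(EuclideanSpace.single l (1 : ℝ) : Euc n)} φ : 𝓢(Euc n, Form n p)) x))
        (EuclideanSpace.single k 1)) =
      (∂_{(EuclideanSpace.single k (1 : ℝ) : Euc n)}
        (∂_{(EuclideanSpace.single k (1 : ℝ) : Euc n)} φ) : 𝓢(Euc n, Form n p)) x -
      ∑ l, extIns (EuclideanSpace.single l 1) (EuclideanSpace.single k 1)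
        ((∂_{(EuclideanSpace.single k (1 : ℝ) : Euc n)}
          (∂_{(EuclideanSpace.single l (1 : ℝ) : Euc n)} φ) : 𝓢(Euc n, Form n p)) x) := by
    intro k
    rw [← insCLM_apply, sum_apply, map_sum]
    have e' : ∀ l : Fin n, insCLM (EuclideanSpace.single k 1)
        ((((extProdCLM (EuclideanSpace.single l 1)).restrictScalars ℝ).comp
          (fderiv ℝ (∂_{(EuclideanSpace.single l (1 : ℝ) : Euc n)} φ : 𝓢(Euc n, Form n p)) x))
          (EuclideanSpace.single k 1)) =
        ((inner ℝ (EuclideanSpace.single l (1 : ℝ)) (EuclideanSpace.single k (1 : ℝ)) : ℝ) : ℂ) •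
          (∂_{(EuclideanSpace.single k (1 : ℝ) : Euc n)}
            (∂_{(EuclideanSpace.single l (1 : ℝ) : Euc n)} φ) : 𝓢(Euc n, Form n p)) x -
        extIns (EuclideanSpace.single l 1) (EuclideanSpace.single k 1)
          ((∂_{(EuclideanSpace.single k (1 : ℝ) : Euc n)}
            (∂_{(EuclideanSpace.single l (1 : ℝ) : Euc n)} φ) : 𝓢(Euc n, Form n p)) x) := by
      intro l
      rw [real_inner_comm, SchwartzMap.lineDerivOp_apply_eq_fderiv]
      exact ins_extProd _ _ _
    rw [Finset.sum_congr rfl fun l _ => e' l, Finset.sum_sub_distrib,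
      sum_single_inner_smul _ (fun l => (∂_{(EuclideanSpace.single k (1 : ℝ) : Euc n)}
            (∂_{(EuclideanSpace.single l (1 : ℝ) : Euc n)} φ) : 𝓢(Euc n, Form n p)) x) k rfl]
  rw [Finset.sum_congr rfl fun k _ => e k, Finset.sum_sub_distrib, neg_sub', sub_neg_eq_add]

lemma lineDerivOp_comm {E : Type*} [NormedAddCommGroup E] [NormedSpace ℂ E] (φ : 𝓢(Euc n, E))
    (v w : Euc n) : (∂_{v} (∂_{w} φ) : 𝓢(Euc n, E)) = ∂_{w} (∂_{v} φ) := by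
  have hd : Differentiable ℝ (fderiv ℝ φ) :=
    ((φ.smooth ⊤).fderiv_right (m := 1) (by norm_cast)).differentiable (by simp)
  have h : ∀ (v w x : Euc n), (∂_{v} (∂_{w} φ) : 𝓢(Euc n, E)) x = fderiv ℝ (fderiv ℝ φ) x v w := by
    intro v w x
    have e : ((∂_{w} φ : 𝓢(Euc n, E)) : Euc n → E) = fun y => fderiv ℝ φ y w :=
      funext fun y => SchwartzMap.lineDerivOp_apply_eq_fderiv _ _ _
    rw [SchwartzMap.lineDerivOp_apply_eq_fderiv, e,
      fderiv_clm_apply hd.differentiableAt (differentiableAt_const w)]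
    simp
  ext x
  rw [h, h]
  exact ((φ.smooth 2).contDiffAt.isSymmSndFDerivAt (by simp)) v w

lemma dCodiff_schwartz (φ : 𝓢(Euc n, Form n p)) (x : Euc n) :
    dCodiff φ x =
      -∑ k, ∑ l, extIns (EuclideanSpace.single l 1) (EuclideanSpace.single k 1)
        ((∂_{(EuclideanSpace.single k (1 : ℝ) : Euc n)}
          (∂_{(EuclideanSpace.single l (1 : ℝ) : Euc n)} φ) : 𝓢(Euc n, Form n p)) x) := by
  cases p with
  | zero =>
    refine Eq.symm (neg_eq_zero.2 ?_)
    exact Finset.sum_eq_zero fun k _ => Finset.sum_const_zero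
  | succ p =>
    have h : HasFDerivAt (fun x => -∑ k, ins (EuclideanSpace.single k 1)
        ((∂_{(EuclideanSpace.single k (1 : ℝ) : Euc n)} φ : 𝓢(Euc n, Form n (p + 1))) x))
        (-∑ k, ((insCLM (EuclideanSpace.single k 1)).restrictScalars ℝ).comp (fderiv ℝ
          (∂_{(EuclideanSpace.single k (1 : ℝ) : Euc n)} φ : 𝓢(Euc n, Form n (p + 1))) x)) x :=
      (HasFDerivAt.fun_sum fun k _ =>
        ((insCLM (EuclideanSpace.single k 1)).restrictScalars ℝ).hasFDerivAt.comp x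
          (schwartz_hasFDerivAt _ x)).neg
    change extDeriv (codiff φ) x = _
    rw [codiff_schwartz, extDeriv_eq_of_hasFDerivAt h, Finset.sum_comm, ← Finset.sum_neg_distrib]
    refine Finset.sum_congr rfl fun l _ => ?_
    rw [← extProdCLM_apply, _root_.neg_apply, map_neg, sum_apply, map_sum]
    refine congrArg Neg.neg (Finset.sum_congr rfl fun k _ => ?_)
    rw [lineDerivOp_comm, SchwartzMap.lineDerivOp_apply_eq_fderiv]
    rfl

end

end FormKnappStein

/-! ### The main theorem -/

theorem theorem3p10 (n : ℕ) [NeZero n] (p : ℕ) (lam : ℂ)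
    (h₁ : ¬ IsRieszPole n (-2 * ((n : ℂ) - lam)))
    (h₂ : ¬ IsRieszPole n (-2 * (lam + 1)))
    (θ : 𝓢(Euc n, Form n p)) :
    KnappSteinDefined ((n : ℂ) - lam) (⇑θ) ∧
    KnappSteinDefined (lam + 1) (mulLast (knappStein ((n : ℂ) - lam) (⇑θ))) ∧
    ∀ x : Euc n,
      opD lam (⇑θ) x =
        (cBar n (-2 * lam - 2) * cBar n (2 * lam - 2 * n)) •
          (((2 * lam - n) * (lam - p + 1) * (lam - n + p + 1)) • dLast (⇑θ) x
            + (2 * lam - n) • ((lam - p + 1) • codiffExt (⇑θ) x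
                - (lam - n + p + 1) • dIns (⇑θ) x)
            + (((lam - p + 1) * (n - lam - p)) • codiffD (mulLast (⇑θ)) x
                + ((lam - p) * (n - lam - p - 1)) • dCodiff (mulLast (⇑θ)) x)) := by
  have e₁ : -2 * ((n : ℂ) - lam) = 2 * lam - 2 * n := by ring
  have e₂ : -2 * (lam + 1) = -2 * lam - 2 := by ring
  let i : Fin n := ⟨n - 1, Nat.sub_one_lt (NeZero.ne n)⟩
  -- The real parts of λ cancel, and the left side equals -2n-1.
  have hdecay : (2 * lam - 2 * n).re + 1 + (-2 * lam - 2).re < -(n : ℝ) := by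
    have : (0 : ℝ) ≤ n := Nat.cast_nonneg n
    simp
    linarith
  obtain ⟨_, -, hp⟩ := exists_seminorm_regComp (rieszCoef n p)
    (neg_lt_re_add_taylorOrder n (2 * lam - 2 * n)) (neg_lt_re_add_taylorOrder n (-2 * lam - 2))
    hdecay i
  have h₃ := h₁
  have h₄ := h₂
  rw [e₁] at h₃
  rw [e₂] at h₄
  refine ⟨fun x => ?_, fun x => ?_, fun x => ?_⟩
  · exact rieszConverges_of_pairingAdmissible h₁ (pairingAdmissible_schwartz _ _ θ x)
  · refine rieszConverges_of_pairingAdmissible h₂ ?_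
    rw [knappStein_eq_regConv, e₁, e₂]
    exact (hp θ x).1
  · rw [opD, knappStein_eq_regConv, knappStein_eq_regConv, e₁, e₂]
    have hφ : mulLast (⇑θ) = ⇑(coordMulCLM i θ) := by
      funext y
      rw [coordMulCLM_apply]
      rfl
    have hd : dLast (⇑θ) x = (LineDeriv.lineDerivOp (eLast n) θ : 𝓢(Euc n, Form n p)) x :=
      (SchwartzMap.lineDerivOp_apply_eq_fderiv _ _ _).symm
    rw [hφ, hd, codiffExt_schwartz, dIns_schwartz, codiffD_schwartz, dCodiff_schwartz]
    have h := regComp_reflectionCoef (isExtInsFamily_extInsCLM n p) h₃ h₄ i θ x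
    simp only [extInsCLM_apply] at h
    exact h
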